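/- Let $S^2$ be the unit sphere of Euclidean three-space and let $|ab|$ be the spherical distance. A set $C\subseteq S^2$ is convex if it contains no pair of antipodes and contains, with any two of its points, the shorter great circle arc joining them; a convex body is a closed convex set with non-empty interior. A hemisphere supports a convex body $C$ if it contains $C$ and its boundary meets $C$. The thickness of the lune $G\cap H$ of two hemispheres $G\neq H$ with non-antipodal centers is the spherical distance between the midpoints of the two semicircles $\mathrm{bd}(G)\cap H$ and $\mathrm{bd}(H)\cap G$. For a hemisphere $K$ supporting $C$, let $\mathrm{width}_K(C)$ be the minimum thickness of a lune $K\cap K^*$ over all hemispheres $K^*\neq K$ supporting $C$, and let the thickness $\Delta(C)$ be the minimum of $\mathrm{width}_K(C)$ over all supporting hemispheres $K$. A convex body $C$ is reduced if $\Delta(R)<\Delta(C)$ for every convex body $R\subsetneq C$. A spherically convex $n$-gon ($n\ge 3$) is the convex hull (the intersection of all convex sets containing the points) of $n$ points that lie in a convex set, none of which belongs to the convex hull of the others; it is regular if its sides have equal length and its interior angles are equal. Let $V$ be a reduced spherically convex polygon. Then $$\mathrm{area}(V)<2\Bigl(1-\cos\frac{\Delta(V)}{2}\Bigr)\pi .$$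 Moreover, for every odd $n\ge 3$ there is a regular spherical $n$-gon of thickness $\Delta(V)$, and if $W_n$ is any regular spherical $n$-gon of thickness $\Delta(V)$ for each odd $n\ge 3$, then $$\lim_{\substack{n\to\infty\\ n\text{ odd}}}\mathrm{area}(W_n)=2\Bigl(1-\cos\frac{\Delta(V)}{2}\Bigr)\pi .$$ -/

import Mathlib

noncomputable section

namespace SphericalPolygon

open MeasureTheory

/-- Euclidean three-space. -/
abbrev E3 : Type := EuclideanSpace ℝ (Fin 3)

/-- The unit sphere of Euclidean three-space, with its subspace topology. -/
abbrev S2 : Type := Metric.sphere (0 : E3) 1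

/-- The spherical distance: the length of the shorter great circle arc, that is, the angle
between the two unit vectors. -/
def sdist (a b : S2) : ℝ := InnerProductGeometry.angle (a : E3) (b : E3)

/-- The shorter great circle arc with end points `a` and `b` (for `b ≠ -a`): the points of the
sphere in the convex cone spanned by `a` and `b`. -/
def arc (a b : S2) : Set S2 :=
  {p | ∃ s t : ℝ, 0 ≤ s ∧ 0 ≤ t ∧ (p : E3) = s • (a : E3) + t • (b : E3)}

/-- Spherical convexity: no pair of antipodes, and closed under taking arcs. -/
def IsConvex (C : Set S2) : Prop :=
  (∀ a ∈ C, -a ∉ C) ∧ ∀ a ∈ C, ∀ b ∈ C, arc a b ⊆ C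

/-- A convex body: a closed convex set with non-empty interior (interior relative to `S2`). -/
def IsConvexBody (C : Set S2) : Prop :=
  IsClosed C ∧ IsConvex C ∧ (interior C).Nonempty

/-- The spherical disk with center `k` and radius `r`. -/
def disk (k : S2) (r : ℝ) : Set S2 := {p | sdist p k ≤ r}

/-- The spherical circle with center `k` and radius `r`, the boundary of `disk k r`
for `r ∈ (0, π/2]`. -/
def circle (k : S2) (r : ℝ) : Set S2 := {p | sdist p k = r}

/-- The hemisphere with center `k`. A hemisphere determines its center, so that hemispheres are
represented by their centers below. -/
def hemisphere (k : S2) : Set S2 := disk k (Real.pi / 2)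

/-- The hemisphere with center `k` supports `C` at some point. -/
def Supports (k : S2) (C : Set S2) : Prop :=
  C ⊆ hemisphere k ∧ ∃ p, p ∈ circle k (Real.pi / 2) ∩ C

/-- The component of `q` orthogonal to `p`. For `q ≠ p, -p` it is a positive multiple of the unit
tangent vector at `p` of the arc from `p` to `q`. It is also a positive multiple of the
center (midpoint) of the semicircle `circle p (π/2) ∩ hemisphere q`, because that semicircle
consists of the unit vectors orthogonal to `p` at angle at most `π/2` from this component. -/
def orthPart (p q : S2) : E3 := (q : E3) - (inner ℝ (p : E3) (q : E3) : ℝ) • (p : E3)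

/-- The thickness of the lune `G ∩ H`, where `G` and `H` are the hemispheres with centers `g`
and `h` (`h ≠ g, -g`): the spherical distance of the centers of the two semicircles
`bd G ∩ H` and `bd H ∩ G`. The angle does not change when vectors are rescaled by positive
factors, so the centers need not be normalized. -/
def luneThickness (g h : S2) : ℝ :=
  InnerProductGeometry.angle (orthPart g h) (orthPart h g)

/-- The width of `C` determined by the supporting hemisphere with center `k`: the minimum
thickness of a lune formed with another supporting hemisphere. For a convex body and a supporting
hemisphere the set is non-empty and the minimum is attained, so that it equals the infimum. -/
def width (k : S2) (C : Set S2) : ℝ :=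
  sInf {x | ∃ k' : S2, k' ≠ k ∧ Supports k' C ∧ x = luneThickness k k'}

/-- The thickness of `C`: the minimum of its widths over all supporting hemispheres
(attained, for a convex body). -/
def thickness (C : Set S2) : ℝ :=
  sInf {x | ∃ k : S2, Supports k C ∧ x = width k C}

/-- A reduced convex body: every convex body properly contained in it has smaller thickness. -/
def IsReduced (C : Set S2) : Prop :=
  IsConvexBody C ∧ ∀ R : Set S2, IsConvexBody R → R ⊂ C → thickness R < thickness C

/-- The convex hull of a subset of a convex set: the intersection of all convex sets that
contain it. -/
def hull (A : Set S2) : Set S2 := ⋂₀ {C | IsConvex C ∧ A ⊆ C}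

/-- `V` is the spherically convex polygon with the `n` vertices `v i`: there are at least three,
they lie in a convex set, none is in the convex hull of the others, and `V` is their hull. -/
def IsPolygonOn {n : ℕ} (v : ZMod n → S2) (V : Set S2) : Prop :=
  3 ≤ n ∧ (∃ C, IsConvex C ∧ Set.range v ⊆ C) ∧
    (∀ i, v i ∉ hull (v '' {j | j ≠ i})) ∧ V = hull (Set.range v)

/-- A spherically convex polygon. -/
def IsPolygon (V : Set S2) : Prop := ∃ (n : ℕ) (v : ZMod n → S2), IsPolygonOn v V

/-- The determinant of three points of the sphere. -/
def triple (a b c : S2) : ℝ :=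
  Matrix.det !![(a : E3) 0, (a : E3) 1, (a : E3) 2;
                (b : E3) 0, (b : E3) 1, (b : E3) 2;
                (c : E3) 0, (c : E3) 1, (c : E3) 2]

/-- The points `v i` are in counterclockwise cyclic order (seen from outside the sphere): every
other point lies strictly to the left of the great circle directed from `v i` to `v (i + 1)`. -/
def IsCounterclockwise {n : ℕ} (v : ZMod n → S2) : Prop :=
  ∀ i j, j ≠ i → j ≠ i + 1 → 0 < triple (v i) (v (i + 1)) (v j)

/-- The angle at `p` between the arcs from `p` to `a` and from `p` to `b`. -/
def sangle (a p b : S2) : ℝ := InnerProductGeometry.angle (orthPart p a) (orthPart p b)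

/-- A regular spherical `n`-gon: all sides have equal length and all interior angles are equal. -/
def IsRegular (n : ℕ) (W : Set S2) : Prop :=
  ∃ v : ZMod n → S2, IsPolygonOn v W ∧ IsCounterclockwise v ∧
    (∀ i j, sdist (v i) (v (i + 1)) = sdist (v j) (v (j + 1))) ∧
    (∀ i j, sangle (v (i - 1)) (v i) (v (i + 1)) = sangle (v (j - 1)) (v j) (v (j + 1)))

/-- The area on the unit sphere (surface measure, of total mass `4π`). -/
def area (V : Set S2) : ℝ := ((volume : Measure E3).toSphere V).toReal

end SphericalPolygon

end

/-! Pass to the polar polygon, formed by the centers of the hemispheres that contain V. Its vertices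
are the inner unit normals `ed v i` of the sides of V, and its edges correspond to the vertices `v
i`. A lune whose hemispheres have centers at distance d has thickness π - d, so the thickness Δ of V
is π minus the diameter of the polar polygon. With μ the cosine of that diameter, cos (Δ/2) = √((1 -
μ)/2). By Girard's theorem (`Cycle.area_body`) the area of V is 2π minus the perimeter of the polar
polygon, so the inequality says that this perimeter exceeds 2π √((1 - μ)/2).

Reducedness is used by cutting off a vertex `v i` along a great circle close to it. This enlarges
the polar polygon only beyond the edge dual to `v i`, and yet its diameter must grow. That excludes
μ > 0 (`Cycle.minCos_nonpos`). Letting the cut shrink, compactness and first-order conditions yield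
a diameter that meets this edge orthogonally at a foot `p i` (`Cycle.exists_foot`). The other end is
a vertex, since otherwise both ends could be sheared apart (`Cycle.exists_vertex_of_foot`). Any two
such chords cross (`cross_of_feet`), so the opposite vertices follow the cyclic order, and it turns
out that n = 2c + 1 and that chord i ends at vertex i + c (`ChordSystem.exists_half`).

The foot of a chord divides its edge into two half-edges. For the chords i and i + c + 1, the
half-edge from `ed v i` to `p i` and the one from `ed v (i + c)` to `p (i + c + 1)` have equal
length, and this length determines the angle between the planes of the two chords. That angle times
√((1 - μ)/2) is at most the half-edge, with strict inequality unless the half-edge vanishes. The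
normals of the chords, with alternating signs, return reversed after 2c + 1 steps, so the angles add
up to at least π (`pi_le_sum_angle`). As each half-edge length occurs twice in the perimeter, the
bound follows (`ChordSystem.half_perimeter`). For μ = 0 the feet are not determined, but V is its
own polar polygon up to a shift of indices, and the vectors `v i - v (i + c + 1)` replace the
normals.

For regular polygons, equal sides and angles give a linear recurrence for the vertices, hence
equally spaced points on a circle (`Cycle.exists_reg`). If n is odd and the circumradius R and
inradius r satisfy R + r ≤ π/2, then the thickness is R + r. The area is 2π - 2n arcsin (cos r sin
(π/n)), and R - r tends to 0 when R + r = Δ is fixed. So r tends to Δ/2 and the area to 2π - 2π cos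
(Δ/2). -/

noncomputable section

namespace SphericalPolygon

open MeasureTheory InnerProductGeometry

/-! ### Vector algebra: cross products, determinants and the identities between them. -/

/-- The cross product on Euclidean three-space. -/
def cr (a b : E3) : E3 :=
  !₂[a 1 * b 2 - a 2 * b 1, a 2 * b 0 - a 0 * b 2, a 0 * b 1 - a 1 * b 0]

/-- The triple product (determinant) of three vectors. -/
def tr (a b c : E3) : ℝ := inner ℝ (cr a b) c

lemma cr_apply_zero (a b : E3) : cr a b 0 = a 1 * b 2 - a 2 * b 1 := by simp [cr]
lemma cr_apply_one (a b : E3) : cr a b 1 = a 2 * b 0 - a 0 * b 2 := by simp [cr]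
lemma cr_apply_two (a b : E3) : cr a b 2 = a 0 * b 1 - a 1 * b 0 := by simp [cr]

lemma inner_eq_coord (a b : E3) : inner ℝ a b = a 0 * b 0 + a 1 * b 1 + a 2 * b 2 := by
  simp only [PiLp.inner_apply, Fin.sum_univ_three, RCLike.inner_apply, conj_trivial]
  ring

lemma tr_eq_coord (a b c : E3) : tr a b c =
    (a 1 * b 2 - a 2 * b 1) * c 0 + (a 2 * b 0 - a 0 * b 2) * c 1 +
      (a 0 * b 1 - a 1 * b 0) * c 2 := by
  rw [tr, inner_eq_coord, cr_apply_zero, cr_apply_one, cr_apply_two]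

lemma ext_coord {a b : E3} (h0 : a 0 = b 0) (h1 : a 1 = b 1) (h2 : a 2 = b 2) : a = b := by
  ext i
  fin_cases i
  · exact h0
  · exact h1
  · exact h2

lemma triple_eq_tr (a b c : S2) : triple a b c = tr a b c := by
  rw [triple, Matrix.det_fin_three, tr_eq_coord]
  simp
  ring

lemma tr_rotate (a b c : E3) : tr a b c = tr b c a := by
  simp only [tr_eq_coord]; ring

lemma tr_swap (a b c : E3) : tr b a c = -tr a b c := by
  simp only [tr_eq_coord]; ring

lemma tr_swap_right (a b c : E3) : tr a c b = -tr a b c := by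
  simp only [tr_eq_coord]; ring

lemma tr_self_left (a b : E3) : tr a a b = 0 := by
  simp only [tr_eq_coord]; ring

lemma tr_self_right (a b : E3) : tr a b b = 0 := by
  simp only [tr_eq_coord]; ring

lemma tr_self_mid (a b : E3) : tr a b a = 0 := by
  simp only [tr_eq_coord]; ring

lemma tr_add_right (a b c d : E3) : tr a b (c + d) = tr a b c + tr a b d := by
  simp [tr, inner_add_right]

lemma tr_smul_right (a b c : E3) (r : ℝ) : tr a b (r • c) = r * tr a b c := by
  simp [tr, inner_smul_right]

lemma tr_smul_left (a b c : E3) (r : ℝ) : tr (r • a) b c = r * tr a b c := by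
  simp only [tr_eq_coord, PiLp.smul_apply, smul_eq_mul]; ring

lemma tr_add_left (a b c d : E3) : tr (a + b) c d = tr a c d + tr b c d := by
  simp only [tr_eq_coord, PiLp.add_apply]; ring

lemma inner_cr_left (a b : E3) : inner ℝ (cr a b) a = 0 := tr_self_mid a b

lemma inner_cr_right (a b : E3) : inner ℝ (cr a b) b = 0 := tr_self_right a b

lemma inner_cr_cr (a b c d : E3) :
    inner ℝ (cr a b) (cr c d) =
      inner ℝ a c * inner ℝ b d - inner ℝ a d * inner ℝ b c := by
  simp only [inner_eq_coord, cr_apply_zero, cr_apply_one, cr_apply_two]; ring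

/-- The product of two triple products is a Gram determinant. -/
lemma tr_mul_tr (a b c d e f : E3) : tr a b c * tr d e f =
    inner ℝ a d * (inner ℝ b e * inner ℝ c f - inner ℝ b f * inner ℝ c e)
    - inner ℝ a e * (inner ℝ b d * inner ℝ c f - inner ℝ b f * inner ℝ c d)
    + inner ℝ a f * (inner ℝ b d * inner ℝ c e - inner ℝ b e * inner ℝ c d) := by
  simp only [inner_eq_coord, tr_eq_coord]; ring

/-- The linear relation between four vectors. -/
lemma tr_relation (a b c d : E3) :
    tr b c d • a - tr a c d • b + tr a b d • c - tr a b c • d = 0 := by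
  apply ext_coord <;>
  · simp only [tr_eq_coord, PiLp.sub_apply, PiLp.add_apply, PiLp.smul_apply, smul_eq_mul,
      PiLp.zero_apply]
    ring

/-- The Plücker relation for four vectors modulo a fifth. -/
lemma tr_plucker (o a b c d : E3) :
    tr o a c * tr o b d = tr o a b * tr o c d + tr o a d * tr o b c := by
  simp only [tr_eq_coord]; ring

lemma cr_cr (a b c d : E3) : cr (cr a b) (cr c d) = tr a b d • c - tr a b c • d := by
  apply ext_coord <;>
  · simp only [tr_eq_coord, cr_apply_zero, cr_apply_one, cr_apply_two, PiLp.sub_apply,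
      PiLp.smul_apply, smul_eq_mul]
    ring

lemma cr_smul_left (a b : E3) (r : ℝ) : cr (r • a) b = r • cr a b := by
  apply ext_coord <;>
  · simp only [cr_apply_zero, cr_apply_one, cr_apply_two, PiLp.smul_apply, smul_eq_mul]
    ring

lemma cr_smul_right (a b : E3) (r : ℝ) : cr a (r • b) = r • cr a b := by
  apply ext_coord <;>
  · simp only [cr_apply_zero, cr_apply_one, cr_apply_two, PiLp.smul_apply, smul_eq_mul]
    ring

lemma cr_ne_zero_of_tr {a b c : E3} (h : tr a b c ≠ 0) : cr a b ≠ 0 := by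
  intro h0
  apply h
  simp [tr, h0]

/-- Serves throughout as a coordinate test: a vector identity holds once the inner products with
three independent vectors agree. -/
lemma eq_zero_of_inner {a b c x : E3} (h : tr a b c ≠ 0) (ha : inner ℝ a x = 0)
    (hb : inner ℝ b x = 0) (hc : inner ℝ c x = 0) : x = 0 := by
  have h1 : tr a b c * tr x x x = 0 := by rw [tr_self_left, mul_zero]
  have key : ∀ e f : E3, tr a b c * tr x e f = 0 := by
    intro e f
    rw [tr_mul_tr, ha, hb, hc]; ring
  have hcr : ∀ e f : E3, tr x e f = 0 := fun e f =>
    (mul_eq_zero.1 (key e f)).resolve_left h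
  have : inner ℝ x x = (0 : ℝ) := by
    have h2 := hcr (cr b c) a
    have h3 := tr_relation x a b c
    have e1 : tr x b c = 0 := hcr b c
    have e2 : tr x a c = 0 := hcr a c
    have e3 : tr x a b = 0 := hcr a b
    rw [e1, e2, e3] at h3
    simp only [zero_smul, sub_zero, add_zero] at h3
    rcases smul_eq_zero.1 h3 with h4 | h4
    · exact absurd h4 h
    · simp [h4]
  exact inner_self_eq_zero.1 this

lemma inner_self_unit {a : E3} (h : ‖a‖ = 1) : inner ℝ a a = (1 : ℝ) := by
  rw [real_inner_self_eq_norm_sq, h]; norm_num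

lemma norm_coe_S2 (x : S2) : ‖(x : E3)‖ = 1 := by
  simp

/-- The unit vector in the direction of `x`. -/
def nrm (x : E3) : E3 := ‖x‖⁻¹ • x

lemma norm_nrm {x : E3} (h : x ≠ 0) : ‖nrm x‖ = 1 := by
  rw [nrm, norm_smul, norm_inv, norm_norm, inv_mul_cancel₀ (norm_ne_zero_iff.2 h)]

lemma norm_smul_nrm (x : E3) : ‖x‖ • nrm x = x := by
  by_cases h : x = 0
  · simp [h]
  · rw [nrm, smul_smul, mul_inv_cancel₀ (norm_ne_zero_iff.2 h), one_smul]

lemma nrm_of_unit {x : E3} (h : ‖x‖ = 1) : nrm x = x := by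
  simp [nrm, h]

lemma nrm_smul {x : E3} {r : ℝ} (hr : 0 < r) : nrm (r • x) = nrm x := by
  rw [nrm, nrm, norm_smul, smul_smul, Real.norm_of_nonneg hr.le, mul_inv, mul_comm r⁻¹, mul_assoc,
    inv_mul_cancel₀ hr.ne', mul_one]

/-! ### Convex cycles, their polar cycles, and the cones they span. -/

/-- A periodic sequence of vectors in counterclockwise convex position. -/
structure Cycle (n : ℕ) (v : ℤ → E3) : Prop where
  three : 3 ≤ n
  per : ∀ i, v (i + n) = v i
  pos : ∀ i j : ℤ, i + 1 < j → j < i + n → 0 < tr (v i) (v (i + 1)) (v j)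

/-- The unit normals of the planes spanned by consecutive vectors. -/
def ed (v : ℤ → E3) (i : ℤ) : E3 := nrm (cr (v i) (v (i + 1)))

/-- The cone of the vectors that have nonnegative inner products with all `v i`. -/
def dualCone (v : ℤ → E3) : Set E3 := {y | ∀ i, 0 ≤ inner ℝ y (v i)}

lemma per_mul {α : Type*} {n : ℕ} {f : ℤ → α} (hf : ∀ i, f (i + n) = f i) (i m : ℤ) :
    f (i + n * m) = f i := by
  have h : Function.Periodic f (n : ℤ) := hf
  have := h.int_mul m i
  rwa [mul_comm] at this

/-- A statement about all terms of a periodic sequence need only be checked in one window of n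
consecutive indices, placed where convenient. -/
lemma exists_rep {α : Type*} {n : ℕ} (hn : 0 < n) {f : ℤ → α} (hf : ∀ i, f (i + n) = f i)
    (i j : ℤ) : ∃ l, i ≤ l ∧ l < i + n ∧ f l = f j := by
  have hn' : (0 : ℤ) < n := by exact_mod_cast hn
  refine ⟨i + (j - i) % n, ?_, ?_, ?_⟩
  · have := Int.emod_nonneg (j - i) hn'.ne'
    omega
  · have := Int.emod_lt_of_pos (j - i) hn'
    omega
  · have h := Int.emod_add_mul_ediv (j - i) n
    have : j = (i + (j - i) % n) + n * ((j - i) / n) := by linarith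
    conv_rhs => rw [this]
    rw [per_mul hf]

namespace Cycle

variable {n : ℕ} {v : ℤ → E3}

/-- Induction on l. The Plücker relation modulo `v i`, applied to the vectors with indices i + 1, j,
l, l + 1, expresses the new determinant through determinants already known to be positive. -/
lemma pos3 (h : Cycle n v) {i j l : ℤ} (hij : i < j) (hjl : j < l) (hl : l < i + n) :
    0 < tr (v i) (v j) (v l) := by
  rcases eq_or_lt_of_le (Int.add_one_le_of_lt hij) with hj | hj
  · subst hj; exact h.pos i l hjl hl
  have key : ∀ m : ℕ, j + 1 + m < i + n → 0 < tr (v i) (v j) (v (j + 1 + m)) := by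
    intro m
    induction m with
    | zero =>
      intro hm
      have := h.pos j (i + n) (by push_cast at hm; omega) (by omega)
      rw [h.per, ← tr_rotate] at this
      simpa using this
    | succ m ih =>
      intro hm
      push_cast at hm
      have h0 := ih (by omega)
      have h1 : 0 < tr (v i) (v (i + 1)) (v j) := h.pos _ _ hj (by omega)
      have h2 : 0 < tr (v i) (v (i + 1)) (v (j + 1 + m)) := h.pos _ _ (by omega) (by omega)
      have h3 : 0 < tr (v i) (v (i + 1)) (v (j + 1 + (m + 1 : ℕ))) :=
        h.pos _ _ (by push_cast; omega) (by push_cast; omega)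
      have h4 : 0 < tr (v i) (v (j + 1 + m)) (v (j + 1 + (m + 1 : ℕ))) := by
        have := h.pos (j + 1 + m) (i + n) (by omega) (by omega)
        rw [h.per, ← tr_rotate] at this
        push_cast
        rwa [← add_assoc]
      have h5 := tr_plucker (v i) (v (i + 1)) (v j) (v (j + 1 + m)) (v (j + 1 + (m + 1 : ℕ)))
      by_contra hc
      push Not at hc
      have := mul_nonpos_of_nonneg_of_nonpos h2.le hc
      have := mul_pos h1 h4
      have := mul_pos h3 h0
      linarith
  have := key (l - (j + 1)).toNat (by rw [Int.toNat_of_nonneg (by omega)]; omega)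
  rwa [Int.toNat_of_nonneg (by omega), add_sub_cancel] at this

lemma cr_ne_zero (h : Cycle n v) (i : ℤ) : cr (v i) (v (i + 1)) ≠ 0 := by
  have h3 := h.three
  exact cr_ne_zero_of_tr (h.pos i (i + 2) (by omega) (by omega)).ne'

lemma norm_ed (h : Cycle n v) (i : ℤ) : ‖ed v i‖ = 1 := norm_nrm (h.cr_ne_zero i)

lemma inner_ed (i : ℤ) (x : E3) :
    inner ℝ (ed v i) x = ‖cr (v i) (v (i + 1))‖⁻¹ * tr (v i) (v (i + 1)) x := by
  rw [ed, nrm, real_inner_smul_left, tr]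

lemma inv_norm_cr_pos (h : Cycle n v) (i : ℤ) : 0 < ‖cr (v i) (v (i + 1))‖⁻¹ :=
  inv_pos.2 (norm_pos_iff.2 (h.cr_ne_zero i))

lemma inner_ed_pos (h : Cycle n v) {i j : ℤ} (hij : i + 1 < j) (hj : j < i + n) :
    0 < inner ℝ (ed v i) (v j) := by
  rw [inner_ed]
  exact mul_pos (h.inv_norm_cr_pos i) (h.pos i j hij hj)

lemma inner_ed_self (i : ℤ) : inner ℝ (ed v i) (v i) = 0 := by
  rw [inner_ed, tr_self_mid, mul_zero]

lemma inner_ed_succ (i : ℤ) : inner ℝ (ed v i) (v (i + 1)) = 0 := by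
  rw [inner_ed, tr_self_right, mul_zero]

lemma inner_ed_nonneg (h : Cycle n v) (i j : ℤ) : 0 ≤ inner ℝ (ed v i) (v j) := by
  have h3 := h.three
  obtain ⟨l, h1, h2, h3⟩ := exists_rep (by omega) h.per i j
  rw [← h3]
  rcases eq_or_lt_of_le h1 with rfl | h1
  · rw [inner_ed_self]
  rcases eq_or_lt_of_le (Int.add_one_le_of_lt h1) with h1 | h1
  · rw [← h1, inner_ed_succ]
  exact (h.inner_ed_pos h1 h2).le

lemma ed_mem (h : Cycle n v) (i : ℤ) : ed v i ∈ dualCone v := h.inner_ed_nonneg i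

lemma ed_per (h : Cycle n v) (i : ℤ) : ed v (i + n) = ed v i := by
  rw [ed, ed, h.per, show i + (n : ℤ) + 1 = i + 1 + n by ring, h.per]

lemma cr_ed (h : Cycle n v) (i : ℤ) :
    ∃ c : ℝ, 0 < c ∧ cr (ed v (i - 1)) (ed v i) = c • v i := by
  have h3 := h.three
  refine ⟨‖cr (v (i - 1)) (v i)‖⁻¹ * ‖cr (v i) (v (i + 1))‖⁻¹ * tr (v (i - 1)) (v i) (v (i + 1)),
    ?_, ?_⟩
  · have h1 := h.inv_norm_cr_pos (i - 1)
    have h2 := h.inv_norm_cr_pos i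
    have h4 := h.pos (i - 1) (i + 1) (by omega) (by omega)
    rw [sub_add_cancel] at h1 h4
    positivity
  · rw [ed, ed, sub_add_cancel, nrm, nrm, cr_smul_left, cr_smul_right, cr_cr, tr_self_right,
      zero_smul, sub_zero, smul_smul, smul_smul]

/-- By `cr_ed`, the cross product of two consecutive normals is a positive multiple of their common
vertex, so a determinant of normals reduces to the position of a vertex relative to a side. This
makes the polar polygon a cycle too. -/
lemma dual (h : Cycle n v) : Cycle n (ed v) where
  three := h.three
  per := h.ed_per
  pos := by
    intro i j hij hj
    obtain ⟨c, hc, h1⟩ := h.cr_ed (i + 1)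
    rw [add_sub_cancel_right] at h1
    rw [tr, h1, real_inner_smul_left, real_inner_comm, ← h.per (i + 1)]
    exact mul_pos hc (h.inner_ed_pos (by omega) (by omega))

lemma ed_ed (h : Cycle n v) (hv : ∀ i, ‖v i‖ = 1) (i : ℤ) : ed (ed v) i = v (i + 1) := by
  obtain ⟨c, hc, h1⟩ := h.cr_ed (i + 1)
  rw [add_sub_cancel_right] at h1
  rw [ed, h1, nrm_smul hc, nrm_of_unit (hv _)]

/-- Triangulate the polygon as a fan with apex `v 0`. The triangle containing x is found where the
sign of `tr (v 0) (v j) x` first fails to be positive. -/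
lemma cone_rep (h : Cycle n v) {x : E3} (hx : ∀ i, 0 ≤ inner ℝ (ed v i) x) :
    ∃ (j : ℤ) (a b c : ℝ), 0 ≤ a ∧ 0 ≤ b ∧ 0 ≤ c ∧ x = a • v 0 + b • v j + c • v (j + 1) := by
  classical
  have h3 := h.three
  have hx' : ∀ i, 0 ≤ tr (v i) (v (i + 1)) x := by
    intro i
    have := hx i
    rw [inner_ed] at this
    exact nonneg_of_mul_nonneg_right this (h.inv_norm_cr_pos i)
  -- The index n - 3 always qualifies, because x lies on the inner side of the side from `v (n - 1)`
  -- to `v n = v 0`.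
  have hex : ∃ m : ℕ, tr (v 0) (v (m + 2)) x ≤ 0 := by
    refine ⟨n - 3, ?_⟩
    have e : ((n - 3 : ℕ) : ℤ) + 2 = 0 + n - 1 := by omega
    have := hx' (0 + n - 1)
    rw [sub_add_cancel, h.per, tr_swap] at this
    rw [e]
    linarith
  have hle : Nat.find hex ≤ n - 3 := by
    apply Nat.find_min'
    have e : ((n - 3 : ℕ) : ℤ) + 2 = 0 + n - 1 := by omega
    have := hx' (0 + n - 1)
    rw [sub_add_cancel, h.per, tr_swap] at this
    rw [e]
    linarith
  set m := Nat.find hex with hm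
  have h1 : tr (v 0) (v (m + 2)) x ≤ 0 := Nat.find_spec hex
  have h2 : 0 ≤ tr (v 0) (v (m + 1)) x := by
    rcases Nat.eq_zero_or_pos m with h0 | h0
    · rw [h0]
      simpa using hx' 0
    · have := Nat.find_min hex (m := m - 1) (by omega)
      push Not at this
      have e : ((m - 1 : ℕ) : ℤ) + 2 = m + 1 := by omega
      rw [e] at this
      exact this.le
  have h4 := hx' (m + 1)
  rw [show (m : ℤ) + 1 + 1 = m + 2 by ring] at h4
  have h5 : 0 < tr (v 0) (v (m + 1)) (v (m + 2)) := h.pos3 (by omega) (by omega) (by omega)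
  have rel := tr_relation x (v 0) (v (m + 1)) (v (m + 2))
  set T := tr (v 0) (v (m + 1)) (v (m + 2))
  refine ⟨m + 1, T⁻¹ * tr (v (m + 1)) (v (m + 2)) x, T⁻¹ * -tr (v 0) (v (m + 2)) x,
    T⁻¹ * tr (v 0) (v (m + 1)) x, by positivity, mul_nonneg (by positivity) (by linarith),
    by positivity, ?_⟩
  rw [show (m : ℤ) + 1 + 1 = m + 2 by ring]
  rw [tr_rotate x, tr_rotate x, tr_rotate x] at rel
  have : T • x = tr (v (m + 1)) (v (m + 2)) x • v 0 - tr (v 0) (v (m + 2)) x • v (m + 1) +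
      tr (v 0) (v (m + 1)) x • v (m + 2) := by
    rw [← sub_eq_zero, ← rel]
    abel
  have e : x = T⁻¹ • T • x := (inv_smul_smul₀ h5.ne' x).symm
  rw [this] at e
  refine e.trans ?_
  simp only [smul_add, smul_sub, smul_smul, mul_neg, neg_smul]
  abel

/-- This is the edge of the polar polygon dual to the vertex `v i`. The coefficients are read off by
pairing with the two neighbors of `v i`. -/
lemma edge_rep (h : Cycle n v) {y : E3} (hy : y ∈ dualCone v) {i : ℤ}
    (hi : inner ℝ y (v i) = 0) :
    ∃ a b : ℝ, 0 ≤ a ∧ 0 ≤ b ∧ y = a • ed v (i - 1) + b • ed v i := by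
  have h3 := h.three
  have h1 : 0 < inner ℝ (ed v (i - 1)) (v (i + 1)) := h.inner_ed_pos (by omega) (by omega)
  have h2 : 0 < inner ℝ (ed v i) (v (i - 1)) := by
    rw [← h.per (i - 1)]
    exact h.inner_ed_pos (by omega) (by omega)
  refine ⟨inner ℝ y (v (i + 1)) / inner ℝ (ed v (i - 1)) (v (i + 1)),
    inner ℝ y (v (i - 1)) / inner ℝ (ed v i) (v (i - 1)),
    div_nonneg (hy _) h1.le, div_nonneg (hy _) h2.le, ?_⟩
  rw [← sub_eq_zero]
  have e1 : inner ℝ (ed v (i - 1)) (v i) = (0 : ℝ) := by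
    have := inner_ed_succ (v := v) (i - 1)
    rwa [sub_add_cancel] at this
  have e2 := inner_ed_self (v := v) (i - 1)
  have hT : tr (v (i - 1)) (v i) (v (i + 1)) ≠ 0 :=
    (h.pos3 (by omega) (by omega) (by omega)).ne'
  apply eq_zero_of_inner hT <;> rw [real_inner_comm] <;>
    simp only [inner_sub_left, inner_add_left, real_inner_smul_left]
  · rw [e2]; field_simp; ring
  · rw [hi, e1, inner_ed_self]; ring
  · rw [inner_ed_succ]; field_simp; ring

end Cycle

lemma dualCone_add {v : ℤ → E3} {x y : E3} (hx : x ∈ dualCone v) (hy : y ∈ dualCone v) :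
    x + y ∈ dualCone v := by
  intro i
  rw [inner_add_left]
  exact add_nonneg (hx i) (hy i)

lemma dualCone_smul {v : ℤ → E3} {x : E3} {r : ℝ} (hr : 0 ≤ r) (hx : x ∈ dualCone v) :
    r • x ∈ dualCone v := by
  intro i
  rw [real_inner_smul_left]
  exact mul_nonneg hr (hx i)

lemma IsConvex.mem_of_comb_two {C : Set S2} (hC : IsConvex C) {p q x : S2} (hp : p ∈ C)
    (hq : q ∈ C) {a b : ℝ} (ha : 0 ≤ a) (hb : 0 ≤ b) (hx : (x : E3) = a • (p : E3) + b • (q : E3)) :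
    x ∈ C :=
  hC.2 p hp q hq ⟨a, b, ha, hb, hx⟩

/-- Two successive arcs suffice: the last two terms are first combined and normalized. -/
lemma IsConvex.mem_of_comb_three {C : Set S2} (hC : IsConvex C) {p q r x : S2} (hp : p ∈ C)
    (hq : q ∈ C) (hr : r ∈ C) {a b c : ℝ} (ha : 0 ≤ a) (hb : 0 ≤ b) (hc : 0 ≤ c)
    (hx : (x : E3) = a • (p : E3) + b • (q : E3) + c • (r : E3)) : x ∈ C := by
  by_cases hy : b • (q : E3) + c • (r : E3) = 0
  · apply hC.mem_of_comb_two hp hp ha le_rfl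
    rw [hx, add_assoc, hy]; simp
  · have hpos : 0 < ‖b • (q : E3) + c • (r : E3)‖ := norm_pos_iff.2 hy
    set y := b • (q : E3) + c • (r : E3) with hyd
    let z : S2 := ⟨nrm y, by simpa using norm_nrm hy⟩
    have hz : z ∈ C := by
      apply hC.mem_of_comb_two hq hr (a := ‖y‖⁻¹ * b) (b := ‖y‖⁻¹ * c) (by positivity)
        (by positivity)
      change nrm y = _
      rw [nrm]
      nth_rewrite 2 [hyd]
      rw [smul_add, smul_smul, smul_smul]
    apply hC.mem_of_comb_two hp hz ha hpos.le
    change (x : E3) = a • (p : E3) + ‖y‖ • nrm y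
    rw [norm_smul_nrm, hx, add_assoc]

lemma inner_nonneg_of_mem_arc {p q : S2} {f : E3}
    (hp : 0 ≤ inner ℝ f (p : E3)) (hq : 0 ≤ inner ℝ f (q : E3))
    {x : S2} (hx : x ∈ arc p q) : 0 ≤ inner ℝ f (x : E3) := by
  obtain ⟨s, t, hs, ht, h⟩ := hx
  rw [h, inner_add_right, real_inner_smul_right, real_inner_smul_right]
  positivity

/-- The spherical polygon bounded by the great circles through consecutive vertices. -/
def body (v : ℤ → E3) : Set S2 := {x | ∀ i, 0 ≤ inner ℝ (ed v i) (x : E3)}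

namespace Cycle

variable {n : ℕ} {v : ℤ → E3}

lemma tr_consecutive_ne (h : Cycle n v) : tr (v 0) (v 1) (v 2) ≠ 0 := by
  have h3 := h.three
  exact (h.pos3 (by norm_num) (by norm_num) (by omega)).ne'

lemma not_antipodal (h : Cycle n v) {x : S2} (hx : x ∈ body v) : -x ∉ body v := by
  intro hx'
  have h0 : ∀ i, inner ℝ (ed v i) (x : E3) = 0 := by
    intro i
    have := hx' i
    rw [coe_neg_sphere, inner_neg_right] at this
    exact le_antisymm (by linarith) (hx i)
  have : (x : E3) = 0 := eq_zero_of_inner h.dual.tr_consecutive_ne (h0 0) (h0 1) (h0 2)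
  have h1 := norm_coe_S2 x
  rw [this, norm_zero] at h1
  norm_num at h1

lemma isConvex_body (h : Cycle n v) : IsConvex (body v) :=
  ⟨fun _ hx => h.not_antipodal hx, fun _ ha _ hb _ hx i =>
    inner_nonneg_of_mem_arc (ha i) (hb i) hx⟩

lemma hull_eq {v : ℤ → S2} (h : Cycle n (fun i => (v i : E3))) :
    hull (Set.range v) = body (fun i => (v i : E3)) := by
  apply Set.Subset.antisymm
  · apply Set.sInter_subset_of_mem
    refine ⟨h.isConvex_body, ?_⟩
    rintro _ ⟨j, rfl⟩ i
    exact h.inner_ed_nonneg i j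
  · intro x hx C hC
    obtain ⟨hC, hv⟩ := hC
    obtain ⟨j, a, b, c, ha, hb, hc, e⟩ := h.cone_rep hx
    exact hC.mem_of_comb_three (hv ⟨0, rfl⟩) (hv ⟨j, rfl⟩) (hv ⟨j + 1, rfl⟩) ha hb hc e

end Cycle

/-! ### Sorting the vertices of a polygon into a convex cycle. -/

/-- Vectors, none in the cone of the others, whose cone is pointed. -/
structure ConvexPosition {ι : Type*} (v : ι → E3) : Prop where
  norm : ∀ i, ‖v i‖ = 1
  notMem : ∀ (i j k l : ι) (a b c : ℝ), j ≠ i → k ≠ i → l ≠ i → 0 ≤ a → 0 ≤ b → 0 ≤ c →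
    v i ≠ a • v j + b • v k + c • v l
  pointed : ∀ (i j k l : ι) (a b c : ℝ), 0 ≤ a → 0 ≤ b → 0 ≤ c →
    v i + (a • v j + b • v k + c • v l) ≠ 0

namespace ConvexPosition

variable {ι : Type*} {v : ι → E3}

lemma notMem' (h : ConvexPosition v) {i j k l : ι} {t a b c : ℝ} (ht : 0 < t) (hj : j ≠ i)
    (hk : k ≠ i) (hl : l ≠ i) (ha : 0 ≤ a) (hb : 0 ≤ b) (hc : 0 ≤ c) :
    t • v i ≠ a • v j + b • v k + c • v l := by
  intro e
  apply h.notMem i j k l (t⁻¹ * a) (t⁻¹ * b) (t⁻¹ * c) hj hk hl (by positivity) (by positivity)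
    (by positivity)
  rw [← inv_smul_smul₀ ht.ne' (v i), e]
  simp only [smul_add, smul_smul]

lemma pointed' (h : ConvexPosition v) {i j k l : ι} {t a b c : ℝ} (ht : 0 < t)
    (ha : 0 ≤ a) (hb : 0 ≤ b) (hc : 0 ≤ c) :
    t • v i + (a • v j + b • v k + c • v l) ≠ 0 := by
  intro e
  apply h.pointed i j k l (t⁻¹ * a) (t⁻¹ * b) (t⁻¹ * c) (by positivity) (by positivity)
    (by positivity)
  have := congrArg (fun x => t⁻¹ • x) e
  simpa only [smul_add, inv_smul_smul₀ ht.ne', smul_smul, smul_zero] using this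

lemma cr_ne_zero (h : ConvexPosition v) {i j : ι} (hij : i ≠ j) : cr (v i) (v j) ≠ 0 := by
  intro h0
  have e := inner_cr_cr (v i) (v j) (v i) (v j)
  rw [h0, inner_zero_left, inner_self_unit (h.norm i), inner_self_unit (h.norm j),
    real_inner_comm] at e
  have : (inner ℝ (v j) (v i) - 1) * (inner ℝ (v j) (v i) + 1) = (0 : ℝ) := by linarith
  rcases mul_eq_zero.1 this with h1 | h1
  · have : v j = v i :=
      (inner_eq_one_iff_of_norm_eq_one (𝕜 := ℝ) (h.norm j) (h.norm i)).1 (by linarith)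
    exact h.notMem i j j j 1 0 0 hij.symm hij.symm hij.symm zero_le_one le_rfl le_rfl
      (by simp [this])
  · have : v j = -v i := by
      apply (inner_eq_neg_one_iff_of_norm_eq_one (𝕜 := ℝ) (h.norm j) (h.norm i)).1
      linarith
    exact h.pointed i j j j 1 0 0 zero_le_one le_rfl le_rfl (by simp [this])

/-- Coplanarity would give a linear relation between the three vectors in which `v k` has a positive
coefficient. Each pattern of the other two signs either puts one vector into the cone of the others
or contradicts pointedness. -/
lemma tr_ne_zero (h : ConvexPosition v) {i j k : ι} (hij : i ≠ j) (hik : i ≠ k) (hjk : j ≠ k) :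
    tr (v i) (v j) (v k) ≠ 0 := by
  intro h0
  set d := cr (v i) (v j) with hd
  have hpos : 0 < tr (v i) (v j) d := by
    rw [tr, ← hd]
    exact real_inner_self_pos.2 (h.cr_ne_zero hij)
  have rel := tr_relation (v i) (v j) (v k) d
  rw [h0, zero_smul, sub_zero] at rel
  set a := tr (v j) (v k) d
  set b := tr (v i) (v k) d
  set c := tr (v i) (v j) d
  rcases le_total a 0 with ha | ha <;> rcases le_total 0 b with hb | hb
  · refine h.notMem' (i := k) (j := i) (k := j) (l := j) (a := -a) (b := b) (c := 0) hpos hik hjk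
      hjk (by linarith) hb le_rfl ?_
    rw [← sub_eq_zero, ← rel]
    module
  · rcases eq_or_lt_of_le hb with hb | hb
    · refine h.notMem' (i := k) (j := i) (k := j) (l := j) (a := -a) (b := b) (c := 0) hpos hik hjk
        hjk (by linarith) hb.ge le_rfl ?_
      rw [← sub_eq_zero, ← rel]
      module
    rcases eq_or_lt_of_le ha with ha | ha
    · refine h.pointed' (i := k) (j := j) (k := j) (l := j) (a := -b) (b := 0) (c := 0) hpos
        (by linarith) le_rfl le_rfl ?_
      rw [← rel, ha]
      module
    · refine h.notMem' (i := i) (j := j) (k := k) (l := k) (t := -a) (a := -b) (b := c) (c := 0)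
        (by linarith) hij.symm hik.symm hik.symm (by linarith) hpos.le le_rfl ?_
      rw [← sub_eq_zero, ← neg_eq_zero, ← rel]
      module
  · rcases eq_or_lt_of_le hb with hb | hb
    · refine h.pointed' (i := k) (j := i) (k := j) (l := j) (a := a) (b := 0) (c := 0) hpos
        ha le_rfl le_rfl ?_
      rw [← rel, ← hb]
      module
    · refine h.notMem' (i := j) (j := i) (k := k) (l := k) (t := b) (a := a) (b := c) (c := 0)
        hb hij hjk.symm hjk.symm ha hpos.le le_rfl ?_
      rw [← sub_eq_zero, ← neg_eq_zero, ← rel]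
      module
  · refine h.pointed' (i := k) (j := i) (k := j) (l := j) (a := a) (b := -b) (c := 0) hpos
      ha (by linarith) le_rfl ?_
    rw [← rel]
    module

/-- If it failed, the linear relation between the four vectors would put `v o` into the cone of the
others or contradict pointedness, according to the sign of the remaining determinant. This makes the
order of the vertices around `v o` transitive. -/
lemma trans (h : ConvexPosition v) {o a b c : ι} (ha : a ≠ o) (hb : b ≠ o) (hc : c ≠ o)
    (h1 : 0 < tr (v o) (v a) (v b)) (h2 : 0 < tr (v o) (v b) (v c)) :
    0 < tr (v o) (v a) (v c) := by
  have hac : a ≠ c := by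
    rintro rfl
    rw [tr_swap_right] at h2
    linarith
  have hne := h.tr_ne_zero ha.symm hc.symm hac
  by_contra hlt
  have hlt : tr (v o) (v a) (v c) < 0 := lt_of_le_of_ne (not_lt.1 hlt) hne
  have rel := tr_relation (v o) (v a) (v b) (v c)
  rcases lt_or_ge 0 (tr (v a) (v b) (v c)) with h3 | h3
  · refine h.notMem' (i := o) (j := a) (k := b) (l := c) h3 ha hb hc h2.le (neg_nonneg.2 hlt.le)
      h1.le ?_
    rw [← sub_eq_zero, ← rel]
    module
  · refine h.pointed' (i := a) (j := o) (k := b) (l := c) h2 (neg_nonneg.2 h3)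
      (neg_nonneg.2 hlt.le) h1.le ?_
    rw [← neg_eq_zero, ← rel]
    module

/-- Otherwise the relation between the four vectors would put `v b` into the cone of `v a`, `v c`
and `v o`. So a sorted fan around one vertex is convex at all vertices. -/
lemma pos_of_fan (h : ConvexPosition v) {o a b c : ι} (hbo : b ≠ o) (hab : a ≠ b) (hcb : c ≠ b)
    (h1 : 0 < tr (v o) (v a) (v b)) (h2 : 0 < tr (v o) (v b) (v c))
    (h3 : 0 < tr (v o) (v a) (v c)) : 0 < tr (v a) (v b) (v c) := by
  by_contra hlt
  have rel := tr_relation (v o) (v a) (v b) (v c)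
  refine h.notMem' (i := b) (j := a) (k := c) (l := o) h3 hab hcb hbo.symm h2.le h1.le
    (neg_nonneg.2 (not_lt.1 hlt)) ?_
  rw [← sub_eq_zero, ← rel]
  module

end ConvexPosition

lemma IsPolygonOn.convexPosition {n : ℕ} {v : ZMod n → S2} {V : Set S2} (h : IsPolygonOn v V) :
    ConvexPosition (fun i => (v i : E3)) where
  norm i := norm_coe_S2 _
  notMem := by
    intro i j k l a b c hj hk hl ha hb hc e
    apply h.2.2.1 i
    intro C hC
    exact hC.1.mem_of_comb_three (hC.2 ⟨j, hj, rfl⟩) (hC.2 ⟨k, hk, rfl⟩) (hC.2 ⟨l, hl, rfl⟩)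
      ha hb hc e
  pointed := by
    intro i j k l a b c ha hb hc e
    obtain ⟨C, hC, hv⟩ := h.2.1
    apply hC.1 (v i) (hv ⟨i, rfl⟩)
    apply hC.mem_of_comb_three (hv ⟨j, rfl⟩) (hv ⟨k, rfl⟩) (hv ⟨l, rfl⟩) ha hb hc
    rw [coe_neg_sphere]
    exact neg_eq_of_add_eq_zero_right e

/-- Points in convex position can be enumerated in counterclockwise order. -/
lemma exists_sorted {n : ℕ} (hn : 3 ≤ n) {ι : Type} [Fintype ι] [DecidableEq ι]
    (hcard : Fintype.card ι = n) {v : ι → E3} (h : ConvexPosition v) :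
    ∃ f : ℕ → ι, (∀ i, ∃ m < n, f m = i) ∧
      ∀ i j l : ℕ, i < j → j < l → l < n → 0 < tr (v (f i)) (v (f j)) (v (f l)) := by
  classical
  have : Nonempty ι := Fintype.card_pos_iff.1 (by omega)
  let o : ι := Classical.arbitrary ι
  let J := {j : ι // j ≠ o}
  -- Seen from one fixed vertex, "to the left of" is a strict total order on the other vertices. Its
  -- increasing enumeration is the required one.
  let r : J → J → Prop := fun a b => 0 < tr (v o) (v a) (v b)
  have hirr : Std.Irrefl r := ⟨fun a ha => by
    have : 0 < tr (v o) (v a) (v a) := ha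
    rw [tr_self_right] at this; exact lt_irrefl _ this⟩
  have htrans : IsTrans J r := ⟨fun a b c h1 h2 => h.trans a.2 b.2 c.2 h1 h2⟩
  have htri : Std.Trichotomous r := ⟨fun a b h1 h2 => by
    by_contra hab
    have hne := h.tr_ne_zero a.2.symm b.2.symm (fun e => hab (Subtype.ext e))
    rcases lt_or_gt_of_ne hne with h3 | h3
    · apply h2
      change 0 < tr (v o) (v b) (v a)
      rw [tr_swap_right]; linarith
    · exact h1 h3⟩
  have hsto : IsStrictTotalOrder J r := { }
  let _ : LinearOrder J := linearOrderOfSTO r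
  have hJ : Fintype.card J = n - 1 := by
    rw [Fintype.card_subtype_compl, hcard]; simp
  let e : Fin (n - 1) ≃o J := Fintype.orderIsoFinOfCardEq J hJ
  have hlt : ∀ a b : J, a < b → 0 < tr (v o) (v a) (v b) := fun a b hab => hab
  let f : ℕ → ι := fun m => if hm : 1 ≤ m ∧ m < n then (e ⟨m - 1, by omega⟩ : ι) else o
  have f0 : f 0 = o := by simp [f]
  have fm : ∀ m (hm : 1 ≤ m ∧ m < n), f m = (e ⟨m - 1, by omega⟩ : ι) := fun m hm => by
    simp only [f, dif_pos hm]
  have hne : ∀ m, 1 ≤ m → m < n → f m ≠ o := by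
    intro m h1 h2
    rw [fm m ⟨h1, h2⟩]
    exact (e _).2
  have hf : ∀ j l : ℕ, 1 ≤ j → j < l → l < n → 0 < tr (v o) (v (f j)) (v (f l)) := by
    intro j l h1 h2 h3
    rw [fm j ⟨h1, by omega⟩, fm l ⟨by omega, h3⟩]
    apply hlt
    apply e.strictMono
    rw [Fin.mk_lt_mk]
    omega
  refine ⟨f, ?_, ?_⟩
  · intro i
    by_cases hi : i = o
    · exact ⟨0, by omega, by rw [f0, hi]⟩
    · let m := e.symm ⟨i, hi⟩
      refine ⟨m + 1, by omega, ?_⟩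
      rw [fm _ ⟨by omega, by omega⟩]
      simp [m]
  · intro i j l hij hjl hl
    rcases Nat.eq_zero_or_pos i with rfl | hi
    · rw [f0]
      exact hf j l hij hjl hl
    · have hinj : ∀ a b : ℕ, 1 ≤ a → a < b → b < n → f a ≠ f b := by
        intro a b h1 h2 h3 e
        have := hf a b h1 h2 h3
        rw [e, tr_self_right] at this
        exact lt_irrefl _ this
      exact h.pos_of_fan (o := o) (hne j (by omega) (by omega)) (hinj i j hi hij (by omega))
        (hinj j l (by omega) hjl hl).symm
        (hf i j hi hij (by omega)) (hf j l (by omega) hjl hl) (hf i l hi (by omega) hl)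

lemma cycle_of_sorted {n : ℕ} (hn : 3 ≤ n) {f : ℕ → E3}
    (hf : ∀ i j l : ℕ, i < j → j < l → l < n → 0 < tr (f i) (f j) (f l)) :
    Cycle n (fun i : ℤ => f (i % n).toNat) where
  three := hn
  per i := by simp
  pos := by
    intro i j hij hj
    have hn' : (0 : ℤ) < n := by omega
    have key : ∀ a : ℤ, 0 ≤ a → a < n → (a % n).toNat = a.toNat := fun a h0 h1 => by
      rw [Int.emod_eq_of_lt h0 h1]
    have hsub : ∀ a m : ℤ, (a + n * m) % n = a % n := fun a m => by simp
    have main : ∀ i j : ℤ, 0 ≤ i → i < n → i + 1 < j → j < i + n →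
        0 < tr (f (i % n).toNat) (f ((i + 1) % n).toNat) (f (j % n).toNat) := by
      intro i j h0 h1 h2 h3
      rw [key i h0 h1]
      rcases lt_or_ge (i + 1) n with h4 | h4
      · rw [key (i + 1) (by omega) h4]
        rcases lt_or_ge j n with h5 | h5
        · rw [key j (by omega) h5]
          exact hf _ _ _ (by omega) (by omega) (by omega)
        · have := hsub (j - n) 1
          rw [mul_one, sub_add_cancel] at this
          rw [this, key (j - n) (by omega) (by omega), ← tr_rotate]
          exact hf _ _ _ (by omega) (by omega) (by omega)
      · have e1 : i + 1 = 0 + n * 1 := by omega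
        have := hsub (j - n) 1
        rw [mul_one, sub_add_cancel] at this
        rw [e1, hsub, this, key (j - n) (by omega) (by omega), tr_rotate]
        exact hf _ _ _ (by simp; omega) (by omega) (by omega)
    have h1 := Int.emod_add_mul_ediv i n
    have h2 := main (i % n) (j - n * (i / n)) (Int.emod_nonneg _ hn'.ne')
      (Int.emod_lt_of_pos _ hn') (by omega) (by omega)
    have e1 : i % n % n = i % n := Int.emod_emod_of_dvd _ dvd_rfl
    have e2 : (i % n + 1) % n = (i + 1) % n := by
      rw [← hsub (i % n + 1) (i / n)]; congr 1; linarith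
    have e3 : (j - n * (i / n)) % n = j % n := by
      rw [← hsub (j - n * (i / n)) (i / n)]; congr 1; ring
    rwa [e1, e2, e3] at h2

/-- The indexing in `IsPolygonOn` need not follow the boundary, so the vertices are reordered. The
hull depends only on their set. -/
lemma IsPolygon.exists_cycle {V : Set S2} (h : IsPolygon V) :
    ∃ (n : ℕ) (v : ℤ → E3), Cycle n v ∧ (∀ i, ‖v i‖ = 1) ∧ V = body v := by
  obtain ⟨n, v, h⟩ := h
  have hn := h.1
  have : NeZero n := ⟨by omega⟩
  obtain ⟨f, hsurj, hf⟩ := exists_sorted hn (ZMod.card n) h.convexPosition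
  have hc := cycle_of_sorted hn (f := fun m => (v (f m) : E3)) hf
  refine ⟨n, _, hc, fun i => norm_coe_S2 _, ?_⟩
  rw [h.2.2.2, ← Cycle.hull_eq (v := fun i : ℤ => v (f (i % n).toNat)) hc]
  congr 1
  apply Set.Subset.antisymm
  · rintro _ ⟨i, rfl⟩
    obtain ⟨m, hm, rfl⟩ := hsurj i
    refine ⟨m, ?_⟩
    simp only
    rw [Int.emod_eq_of_lt (by omega) (by omega), Int.toNat_natCast]
  · rintro _ ⟨i, rfl⟩
    exact ⟨_, rfl⟩

/-! ### Thickness as the supplement of the diameter of the polar set. -/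

/-- The centers of the hemispheres that contain `C`. -/
def polar (C : Set S2) : Set S2 := {k | ∀ c ∈ C, 0 ≤ inner ℝ (k : E3) (c : E3)}

lemma mem_hemisphere_iff {k p : S2} : p ∈ hemisphere k ↔ 0 ≤ inner ℝ (k : E3) (p : E3) := by
  change angle (p : E3) (k : E3) ≤ Real.pi / 2 ↔ _
  rw [real_inner_comm, angle, norm_coe_S2, norm_coe_S2, mul_one, div_one,
    Real.arccos_le_pi_div_two]

lemma mem_circle_iff {k p : S2} : p ∈ circle k (Real.pi / 2) ↔ inner ℝ (k : E3) (p : E3) = 0 := by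
  change angle (p : E3) (k : E3) = Real.pi / 2 ↔ _
  rw [real_inner_comm]
  exact (inner_eq_zero_iff_angle_eq_pi_div_two _ _).symm

lemma supports_iff {k : S2} {C : Set S2} :
    Supports k C ↔ k ∈ polar C ∧ ∃ p ∈ C, inner ℝ (k : E3) (p : E3) = 0 := by
  rw [Supports]
  constructor
  · rintro ⟨h1, p, hp, hpC⟩
    exact ⟨fun c hc => mem_hemisphere_iff.1 (h1 hc), p, hpC, mem_circle_iff.1 hp⟩
  · rintro ⟨h1, p, hpC, hp⟩
    exact ⟨fun c hc => mem_hemisphere_iff.2 (h1 c hc), p, mem_circle_iff.2 hp, hpC⟩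

lemma inner_unit_ne_one {g h : S2} (h1 : h ≠ g) : inner ℝ (g : E3) (h : E3) ≠ (1 : ℝ) := by
  intro e
  exact h1 (Subtype.ext
    ((inner_eq_one_iff_of_norm_eq_one (𝕜 := ℝ) (norm_coe_S2 g) (norm_coe_S2 h)).1 e).symm)

lemma inner_unit_ne_neg_one {g h : S2} (h1 : h ≠ -g) : inner ℝ (g : E3) (h : E3) ≠ (-1 : ℝ) := by
  intro e
  apply h1
  apply Subtype.ext
  rw [coe_neg_sphere,
    (inner_eq_neg_one_iff_of_norm_eq_one (norm_coe_S2 g) (norm_coe_S2 h)).1 e, neg_neg]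

lemma inner_orthPart_orthPart (g h : S2) : inner ℝ (orthPart g h) (orthPart h g) =
    -(inner ℝ (g : E3) (h : E3)) * (1 - inner ℝ (g : E3) (h : E3) ^ 2) := by
  have e1 : inner ℝ (g : E3) (g : E3) = (1 : ℝ) := inner_self_unit (norm_coe_S2 g)
  have e2 : inner ℝ (h : E3) (h : E3) = (1 : ℝ) := inner_self_unit (norm_coe_S2 h)
  simp only [orthPart, inner_sub_left, inner_sub_right, real_inner_smul_left,
    real_inner_smul_right, real_inner_comm (g : E3) (h : E3), e1, e2]
  ring

lemma norm_orthPart_sq (g h : S2) :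
    ‖orthPart g h‖ ^ 2 = 1 - inner ℝ (g : E3) (h : E3) ^ 2 := by
  have e1 : inner ℝ (g : E3) (g : E3) = (1 : ℝ) := inner_self_unit (norm_coe_S2 g)
  have e2 : inner ℝ (h : E3) (h : E3) = (1 : ℝ) := inner_self_unit (norm_coe_S2 h)
  rw [← real_inner_self_eq_norm_sq]
  simp only [orthPart, inner_sub_left, inner_sub_right, real_inner_smul_left,
    real_inner_smul_right, real_inner_comm (g : E3) (h : E3), e1, e2]
  ring

lemma one_sub_inner_sq_pos {g h : S2} (h1 : h ≠ g) (h2 : h ≠ -g) :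
    0 < 1 - inner ℝ (g : E3) (h : E3) ^ 2 := by
  have h3 := real_inner_le_norm (g : E3) (h : E3)
  have h4 := neg_le_of_abs_le (abs_real_inner_le_norm (g : E3) (h : E3))
  rw [norm_coe_S2, norm_coe_S2, mul_one] at h3 h4
  have h5 := lt_of_le_of_ne h3 (inner_unit_ne_one h1)
  have h6 := lt_of_le_of_ne h4 (inner_unit_ne_neg_one h2).symm
  nlinarith

/-- With c = ⟨g, h⟩, both orthogonal parts have squared length 1 - c² and their inner product is -c
(1 - c²), so the cosine of the thickness is -c. -/
lemma luneThickness_eq {g h : S2} (h1 : h ≠ g) (h2 : h ≠ -g) :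
    luneThickness g h = Real.pi - angle (g : E3) (h : E3) := by
  have hpos := one_sub_inner_sq_pos h1 h2
  rw [luneThickness, angle, angle, inner_orthPart_orthPart, norm_coe_S2, norm_coe_S2,
    ← Real.arccos_neg]
  congr 1
  have e : ‖orthPart g h‖ = ‖orthPart h g‖ := by
    rw [← sq_eq_sq₀ (norm_nonneg _) (norm_nonneg _), norm_orthPart_sq, norm_orthPart_sq,
      real_inner_comm]
  rw [← e, ← sq, norm_orthPart_sq]
  field_simp

lemma isClosed_polar (C : Set S2) : IsClosed (polar C) := by
  have : polar C = ⋂ c ∈ C, {k : S2 | 0 ≤ inner ℝ (k : E3) (c : E3)} := by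
    ext k; simp [polar]
  rw [this]
  refine isClosed_biInter fun c _ => isClosed_le continuous_const ?_
  fun_prop

lemma continuous_angle_coe :
    Continuous fun q : S2 × S2 => angle (q.1 : E3) (q.2 : E3) := by
  have : (fun q : S2 × S2 => angle (q.1 : E3) (q.2 : E3)) =
      fun q : S2 × S2 => Real.arccos (inner ℝ (q.1 : E3) (q.2 : E3)) := by
    funext q
    rw [angle, norm_coe_S2, norm_coe_S2]; simp
  rw [this]
  exact Real.continuous_arccos.comp (by fun_prop)

lemma angle_coe_pos {x y : S2} (h : x ≠ y) : 0 < angle (x : E3) (y : E3) := by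
  refine lt_of_le_of_ne (angle_nonneg _ _) fun h0 => ?_
  have h1 := inner_eq_cos_angle_of_norm_eq_one (norm_coe_S2 x) (norm_coe_S2 y)
  rw [← h0, Real.cos_zero] at h1
  exact inner_unit_ne_one h.symm h1

/-- A hemisphere at maximal distance from another one containing `C` supports `C`. -/
lemma supports_of_isMax {C : Set S2} (hC : IsClosed C) (hCne : C.Nonempty)
    {x y : S2} (hx : x ∈ polar C) (hxy : x ≠ y) (hxy' : y ≠ -x)
    (hmax : ∀ x' ∈ polar C, angle (x' : E3) (y : E3) ≤ angle (x : E3) (y : E3)) :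
    Supports x C := by
  rw [supports_iff]
  refine ⟨hx, ?_⟩
  obtain ⟨p, hp, hmin⟩ := hC.isCompact.exists_isMinOn hCne
    (f := fun c : S2 => inner ℝ (x : E3) (c : E3)) (by fun_prop)
  refine ⟨p, hp, ?_⟩
  by_contra hne
  have hδ : 0 < inner ℝ (x : E3) (p : E3) := lt_of_le_of_ne (hx p hp) (Ne.symm hne)
  set δ := inner ℝ (x : E3) (p : E3)
  -- If x has slack δ on all of C, then x - δ y is still nonnegative on C, because ⟨y, c⟩ ≤ 1. Its
  -- direction is farther from y than x is.
  have hz : (x : E3) - δ • (y : E3) ≠ 0 := by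
    intro h0
    have h1 : (x : E3) = δ • (y : E3) := sub_eq_zero.1 h0
    have h2 := congrArg norm h1
    rw [norm_smul, norm_coe_S2, norm_coe_S2, Real.norm_of_nonneg hδ.le, mul_one] at h2
    rw [← h2, one_smul] at h1
    exact hxy (Subtype.ext h1)
  let z : S2 := ⟨nrm ((x : E3) - δ • (y : E3)), by simpa using norm_nrm hz⟩
  have hz' : (z : E3) = ‖(x : E3) - δ • (y : E3)‖⁻¹ • ((x : E3) - δ • (y : E3)) := rfl
  have hn : 0 < ‖(x : E3) - δ • (y : E3)‖⁻¹ := inv_pos.2 (norm_pos_iff.2 hz)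
  have hzC : z ∈ polar C := by
    intro c hc
    rw [hz', real_inner_smul_left, inner_sub_left, real_inner_smul_left]
    have h1 : δ ≤ inner ℝ (x : E3) (c : E3) := hmin hc
    have h2 := real_inner_le_norm (y : E3) (c : E3)
    rw [norm_coe_S2, norm_coe_S2, mul_one] at h2
    have : δ * inner ℝ (y : E3) (c : E3) ≤ δ * 1 := mul_le_mul_of_nonneg_left h2 hδ.le
    exact mul_nonneg hn.le (by linarith)
  have h1 := hmax z hzC
  rw [hz', angle_smul_left_of_pos _ _ hn] at h1
  have hy0 : (y : E3) ≠ 0 := norm_ne_zero_iff.1 (by rw [norm_coe_S2]; norm_num)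
  -- The vector x lies between x - δ y and y, so the angles add. Maximality makes the first of them
  -- vanish, and then y is a multiple of x, which is excluded.
  have h2 := angle_eq_angle_add_add_angle_add ((x : E3) - δ • (y : E3))
    (smul_ne_zero hδ.ne' hy0)
  rw [sub_add_cancel, angle_smul_right_of_pos _ _ hδ, angle_smul_left_of_pos _ _ hδ,
    angle_comm (y : E3) x] at h2
  have h3 : angle ((x : E3) - δ • (y : E3)) x = 0 :=
    le_antisymm (by linarith) (angle_nonneg _ _)
  obtain ⟨_, r, hr, h4⟩ := angle_eq_zero_iff.1 h3
  have h5 : (y : E3) = ((r * δ)⁻¹ * (r - 1)) • (x : E3) := by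
    rw [mul_smul, eq_inv_smul_iff₀ (by positivity), sub_smul, one_smul]
    nth_rewrite 2 [h4]
    rw [smul_sub, smul_smul]; abel
  have h6 := one_sub_inner_sq_pos hxy.symm hxy'
  rw [h5, real_inner_smul_right, inner_self_unit (norm_coe_S2 x), mul_one] at h6
  have h7 := congrArg norm h5
  rw [norm_smul, norm_coe_S2, norm_coe_S2, mul_one, Real.norm_eq_abs] at h7
  rw [← sq_abs, ← h7] at h6
  norm_num at h6

/-- The thickness of a closed set is the supplement of the diameter of its polar set. -/
lemma exists_thickness_eq {C : Set S2} (hC : IsClosed C) (hCne : C.Nonempty)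
    (hanti : ∀ x ∈ polar C, -x ∉ polar C) (hnontriv : (polar C).Nontrivial) :
    ∃ x ∈ polar C, ∃ y ∈ polar C, thickness C = Real.pi - angle (x : E3) (y : E3) ∧
      ∀ x' ∈ polar C, ∀ y' ∈ polar C, angle (x' : E3) (y' : E3) ≤ angle (x : E3) (y : E3) := by
  have hcpt : IsCompact (polar C ×ˢ polar C) :=
    (isClosed_polar C).isCompact.prod (isClosed_polar C).isCompact
  obtain ⟨⟨x, y⟩, ⟨hx, hy⟩, hmax⟩ := hcpt.exists_isMaxOn
    (hnontriv.nonempty.prod hnontriv.nonempty) continuous_angle_coe.continuousOn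
  have hm : ∀ x' ∈ polar C, ∀ y' ∈ polar C,
      angle (x' : E3) (y' : E3) ≤ angle (x : E3) (y : E3) :=
    fun x' hx' y' hy' => isMaxOn_iff.1 hmax (x', y') (Set.mk_mem_prod hx' hy')
  replace hx : x ∈ polar C := hx
  replace hy : y ∈ polar C := hy
  clear hmax hcpt
  have hxy : x ≠ y := by
    rintro rfl
    obtain ⟨a, ha, b, hb, hab⟩ := hnontriv
    have h1 := hm a ha b hb
    have h2 := angle_coe_pos hab
    rw [angle_self (norm_ne_zero_iff.1 (by rw [norm_coe_S2]; norm_num))] at h1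
    linarith
  have hsx : Supports x C := supports_of_isMax hC hCne hx hxy
    (fun e => hanti x hx (e ▸ hy)) fun x' hx' => hm x' hx' y hy
  have hsy : Supports y C := supports_of_isMax hC hCne hy hxy.symm
    (fun e => hanti y hy (e ▸ hx)) fun x' hx' => by
      rw [angle_comm (y : E3)]; exact hm x' hx' x hx
  have hlune : ∀ k k' : S2, Supports k C → Supports k' C → k' ≠ k →
      luneThickness k k' = Real.pi - angle (k : E3) (k' : E3) := fun k k' h1 h2 h3 =>
    luneThickness_eq h3 fun e => hanti k (supports_iff.1 h1).1 (e ▸ (supports_iff.1 h2).1)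
  have hw : ∀ k, Supports k C → Real.pi - angle (x : E3) (y : E3) ≤ width k C := by
    intro k hk
    apply le_csInf
    · by_cases hkx : k = x
      · exact ⟨_, y, fun e => hxy (hkx ▸ e.symm), hsy, rfl⟩
      · exact ⟨_, x, fun e => hkx e.symm, hsx, rfl⟩
    · rintro _ ⟨k', h1, h2, rfl⟩
      rw [hlune k k' hk h2 h1]
      have := hm k (supports_iff.1 hk).1 k' (supports_iff.1 h2).1
      linarith
  refine ⟨x, hx, y, hy, le_antisymm ?_ ?_, hm⟩
  · have h1 : thickness C ≤ width x C := by
      apply csInf_le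
      · refine ⟨0, ?_⟩
        rintro _ ⟨k, _, rfl⟩
        apply Real.sInf_nonneg
        rintro _ ⟨k', _, _, rfl⟩
        exact angle_nonneg _ _
      · exact ⟨x, hsx, rfl⟩
    have h2 : width x C ≤ luneThickness x y := by
      apply csInf_le
      · refine ⟨0, ?_⟩
        rintro _ ⟨k', _, _, rfl⟩
        exact angle_nonneg _ _
      · exact ⟨y, hxy.symm, hsy, rfl⟩
    rw [hlune x y hsx hsy hxy.symm] at h2
    exact h1.trans h2
  · apply le_csInf
    · exact ⟨_, x, hsx, rfl⟩
    · rintro _ ⟨k, hk, rfl⟩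
      exact hw k hk

/-- `μ` is the least cosine of the angles between vectors of the set `K`. -/
structure IsMinCos (K : Set E3) (μ : ℝ) : Prop where
  le : ∀ x ∈ K, ∀ y ∈ K, μ * (‖x‖ * ‖y‖) ≤ inner ℝ x y
  attained : ∃ x ∈ K, ∃ y ∈ K, ‖x‖ = 1 ∧ ‖y‖ = 1 ∧ inner ℝ x y = μ

lemma IsMinCos.unique {K : Set E3} {μ ν : ℝ} (h : IsMinCos K μ) (h' : IsMinCos K ν) : μ = ν := by
  have key : ∀ μ ν : ℝ, IsMinCos K μ → IsMinCos K ν → μ ≤ ν := by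
    intro μ ν h h'
    obtain ⟨x, hx, y, hy, h1, h2, h3⟩ := h'.attained
    have := h.le x hx y hy
    rw [h1, h2, h3] at this
    linarith
  exact le_antisymm (key _ _ h h') (key _ _ h' h)

namespace Cycle

variable {n : ℕ} {v : ℤ → E3}

lemma isClosed_body : IsClosed (body v) := by
  have : body v = ⋂ i, {x : S2 | 0 ≤ inner ℝ (ed v i) (x : E3)} := by
    ext k; simp [body]
  rw [this]
  refine isClosed_iInter fun c => isClosed_le continuous_const ?_
  fun_prop

lemma vertex_mem_body (h : Cycle n v) {x : S2} {i : ℤ} (hx : (x : E3) = v i) : x ∈ body v :=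
  fun j => by rw [hx]; exact h.inner_ed_nonneg j i

lemma body_nonempty (h : Cycle n v) (hv : ∀ i, ‖v i‖ = 1) : (body v).Nonempty :=
  ⟨⟨v 0, by simpa using hv 0⟩, h.vertex_mem_body (i := 0) rfl⟩

lemma mem_polar_body (h : Cycle n v) (hv : ∀ i, ‖v i‖ = 1) {k : S2} :
    k ∈ polar (body v) ↔ (k : E3) ∈ dualCone v := by
  constructor
  · intro hk i
    exact hk ⟨v i, by simpa using hv i⟩ (h.vertex_mem_body (i := i) rfl)
  · intro hk x hx
    obtain ⟨j, a, b, c, ha, hb, hc, e⟩ := h.cone_rep hx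
    rw [e]
    simp only [inner_add_right, real_inner_smul_right]
    have := hk 0
    have := hk j
    have := hk (j + 1)
    positivity

lemma eq_zero_of_neg_mem_dualCone (h : Cycle n v) {x : E3} (hx : x ∈ dualCone v)
    (hx' : -x ∈ dualCone v) : x = 0 := by
  have h0 : ∀ i, inner ℝ (v i) x = 0 := by
    intro i
    have := hx' i
    rw [inner_neg_left] at this
    rw [real_inner_comm]
    exact le_antisymm (by linarith) (hx i)
  exact eq_zero_of_inner h.tr_consecutive_ne (h0 0) (h0 1) (h0 2)

lemma polar_antipodal (h : Cycle n v) (hv : ∀ i, ‖v i‖ = 1) {x : S2} (hx : x ∈ polar (body v)) :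
    -x ∉ polar (body v) := by
  intro hx'
  rw [h.mem_polar_body hv] at hx hx'
  rw [coe_neg_sphere] at hx'
  have h1 := norm_coe_S2 x
  rw [h.eq_zero_of_neg_mem_dualCone hx hx', norm_zero] at h1
  norm_num at h1

lemma ed_ne (h : Cycle n v) : ed v 0 ≠ ed v 1 := by
  intro e
  have := h.dual.tr_consecutive_ne
  rw [e, tr_self_left] at this
  exact this rfl

lemma polar_nontrivial (h : Cycle n v) (hv : ∀ i, ‖v i‖ = 1) : (polar (body v)).Nontrivial :=
  ⟨⟨ed v 0, by simpa using h.norm_ed 0⟩, (h.mem_polar_body hv).2 (h.ed_mem 0),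
    ⟨ed v 1, by simpa using h.norm_ed 1⟩, (h.mem_polar_body hv).2 (h.ed_mem 1),
    fun e => h.ed_ne (congrArg Subtype.val e)⟩

/-- Restates `exists_thickness_eq` homogeneously on the dual cone. The bounds on μ are strict
because the polar set contains no antipodes and more than one point. -/
lemma exists_isMinCos (h : Cycle n v) (hv : ∀ i, ‖v i‖ = 1) :
    ∃ μ, IsMinCos (dualCone v) μ ∧ -1 < μ ∧ μ < 1 ∧
      thickness (body v) = Real.pi - Real.arccos μ := by
  obtain ⟨x, hx, y, hy, ht, hmax⟩ := exists_thickness_eq isClosed_body (h.body_nonempty hv)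
    (fun x hx => h.polar_antipodal hv hx) (h.polar_nontrivial hv)
  have hang : ∀ x y : S2, angle (x : E3) (y : E3) = Real.arccos (inner ℝ (x : E3) (y : E3)) := by
    intro x y
    rw [angle, norm_coe_S2, norm_coe_S2]; simp
  have hcos : ∀ x y : S2, Real.cos (angle (x : E3) (y : E3)) = inner ℝ (x : E3) (y : E3) :=
    fun x y => (inner_eq_cos_angle_of_norm_eq_one (norm_coe_S2 x) (norm_coe_S2 y)).symm
  refine ⟨inner ℝ (x : E3) (y : E3), ⟨?_, ?_⟩, ?_, ?_, ?_⟩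
  · intro p hp q hq
    by_cases hp0 : p = 0
    · simp [hp0]
    by_cases hq0 : q = 0
    · simp [hq0]
    have hpn : 0 < ‖p‖ := norm_pos_iff.2 hp0
    have hqn : 0 < ‖q‖ := norm_pos_iff.2 hq0
    let p' : S2 := ⟨nrm p, by simpa using norm_nrm hp0⟩
    let q' : S2 := ⟨nrm q, by simpa using norm_nrm hq0⟩
    have h1 := hmax p' ((h.mem_polar_body hv).2 (dualCone_smul (by positivity) hp))
      q' ((h.mem_polar_body hv).2 (dualCone_smul (by positivity) hq))
    have h2 := Real.cos_le_cos_of_nonneg_of_le_pi (angle_nonneg _ _) (angle_le_pi _ _) h1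
    rw [hcos, hcos] at h2
    change _ ≤ inner ℝ (nrm p) (nrm q) at h2
    rw [← norm_smul_nrm p, ← norm_smul_nrm q, real_inner_smul_left, real_inner_smul_right,
      norm_smul_nrm, norm_smul_nrm]
    have : 0 < ‖p‖ * ‖q‖ := by positivity
    nlinarith
  · exact ⟨x, (h.mem_polar_body hv).1 hx, y, (h.mem_polar_body hv).1 hy, norm_coe_S2 x,
      norm_coe_S2 y, rfl⟩
  · have h4 := neg_le_of_abs_le (abs_real_inner_le_norm (x : E3) (y : E3))
    rw [norm_coe_S2, norm_coe_S2, mul_one] at h4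
    refine lt_of_le_of_ne h4 (inner_unit_ne_neg_one ?_).symm
    intro e
    exact h.polar_antipodal hv hx (e ▸ hy)
  · have h3 := real_inner_le_norm (x : E3) (y : E3)
    rw [norm_coe_S2, norm_coe_S2, mul_one] at h3
    refine lt_of_le_of_ne h3 fun e => ?_
    obtain ⟨a, ha, b, hb, hab⟩ := h.polar_nontrivial hv
    have h1 := hmax a ha b hb
    have h2 := angle_coe_pos hab
    rw [hang x y, e, Real.arccos_one] at h1
    linarith
  · rw [ht, hang]

end Cycle

/-! ### Cutting off a vertex of a reduced polygon, and the limit of shrinking cuts. -/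

lemma norm_add_le_of_unit {y q : E3} (hy : ‖y‖ = 1) :
    ‖y + q‖ ≤ 1 + inner ℝ y q + ‖q‖ ^ 2 / 2 := by
  have h1 := norm_add_sq_real y q
  rw [hy] at h1
  have h2 := norm_nonneg (y + q)
  by_contra hc
  push Not at hc
  nlinarith [sq_nonneg (‖y + q‖), sq_nonneg (‖y + q‖ - 1)]

/-- First order condition for a pair of unit vectors at maximal distance. -/
lemma IsMinCos.first_order {v : ℤ → E3} {μ : ℝ} (h : IsMinCos (dualCone v) μ) (h0 : μ ≤ 0)
    (h1 : -1 < μ) {x y q : E3} (hx : x ∈ dualCone v) (hy : y ∈ dualCone v) (hq : q ∈ dualCone v)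
    (hxn : ‖x‖ = 1) (hyn : ‖y‖ = 1) (hxy : inner ℝ x y = μ) :
    μ * inner ℝ y q ≤ inner ℝ x q := by
  by_contra hlt
  push Not at hlt
  set d := μ * inner ℝ y q - inner ℝ x q with hd
  have hdpos : 0 < d := by linarith
  -- The step is so short that the second-order term t ‖q‖² stays below the first-order gain d.
  -- Moving y towards q would then increase the distance from x.
  set t := d / (‖q‖ ^ 2 + 1) with ht
  have htpos : 0 < t := by positivity
  have htd : t * ‖q‖ ^ 2 < d := by
    rw [ht, div_mul_eq_mul_div, div_lt_iff₀ (by positivity)]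
    nlinarith
  have h2 := h.le x hx (y + t • q) (dualCone_add hy (dualCone_smul htpos.le hq))
  have h3 := norm_add_le_of_unit (q := t • q) hyn
  rw [inner_add_right, real_inner_smul_right, hxy, hxn, one_mul] at h2
  rw [real_inner_smul_right, norm_smul, Real.norm_of_nonneg htpos.le] at h3
  have h4 := mul_le_mul_of_nonpos_left h3 h0
  have h5 : 0 ≤ t * (inner ℝ x q - μ * inner ℝ y q - μ * (t * ‖q‖ ^ 2) / 2) := by nlinarith
  have h6 := nonneg_of_mul_nonneg_right h5 htpos
  nlinarith [mul_nonneg htpos.le (sq_nonneg ‖q‖)]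

/-- The part of the polygon cut off by the hemisphere with normal vector `z`. -/
def cut (v : ℤ → E3) (z : E3) : Set S2 := {x | x ∈ body v ∧ 0 ≤ inner ℝ z (x : E3)}

namespace Cycle

variable {n : ℕ} {v : ℤ → E3}

/-- Three consecutive vertices are independent, so a nonzero dual vector cannot vanish on all of
them. This supplies an interior point of the polygon. -/
lemma sum_three_pos (h : Cycle n v) {y : E3} (hy : y ∈ dualCone v) (hy0 : y ≠ 0) :
    0 < inner ℝ y (v 0 + v 1 + v 2) := by
  rw [inner_add_right, inner_add_right]
  have h0 := hy 0
  have h1 := hy 1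
  have h2 := hy 2
  refine lt_of_le_of_ne (by positivity) fun e => hy0 ?_
  apply eq_zero_of_inner h.tr_consecutive_ne <;> rw [real_inner_comm] <;> linarith

lemma sum_three_ne_zero (h : Cycle n v) : v 0 + v 1 + v 2 ≠ 0 := by
  intro e
  have := h.sum_three_pos (h.ed_mem 0) (norm_ne_zero_iff.1 (by rw [h.norm_ed]; norm_num))
  rw [e, inner_zero_right] at this
  exact lt_irrefl _ this

/-- An interior point of the polygon. -/
lemma exists_interior (h : Cycle n v) :
    ∃ x₀ : S2, ∀ y ∈ dualCone v, y ≠ 0 → 0 < inner ℝ y (x₀ : E3) := by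
  refine ⟨⟨nrm (v 0 + v 1 + v 2), by simpa using norm_nrm h.sum_three_ne_zero⟩, ?_⟩
  intro y hy hy0
  change 0 < inner ℝ y (nrm (v 0 + v 1 + v 2))
  rw [nrm, real_inner_smul_right]
  have := norm_pos_iff.2 h.sum_three_ne_zero
  have := h.sum_three_pos hy hy0
  positivity

lemma isOpen_strict (h : Cycle n v) : IsOpen {x : S2 | ∀ i, 0 < inner ℝ (ed v i) (x : E3)} := by
  have h3 := h.three
  have : {x : S2 | ∀ i, 0 < inner ℝ (ed v i) (x : E3)} =
      ⋂ i ∈ Finset.Ico (0 : ℤ) n, {x : S2 | 0 < inner ℝ (ed v i) (x : E3)} := by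
    ext x
    simp only [Set.mem_iInter, Finset.mem_Ico]
    constructor
    · intro hx i _
      exact hx i
    · intro hx i
      obtain ⟨l, h1, h2, e⟩ := exists_rep (by omega) h.ed_per 0 i
      rw [← e]
      exact hx l ⟨h1, by omega⟩
  rw [this]
  refine isOpen_biInter_finset fun i _ => isOpen_lt continuous_const ?_
  fun_prop

lemma isConvexBody_cut (h : Cycle n v) {z : E3} {x₀ : S2}
    (hx₀ : ∀ y ∈ dualCone v, y ≠ 0 → 0 < inner ℝ y (x₀ : E3)) (hz : 0 < inner ℝ z (x₀ : E3)) :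
    IsConvexBody (cut v z) := by
  refine ⟨?_, ⟨fun a ha ha' => h.not_antipodal ha.1 ha'.1, fun a ha b hb x hx =>
    ⟨h.isConvex_body.2 a ha.1 b hb.1 hx, inner_nonneg_of_mem_arc ha.2 hb.2 hx⟩⟩, x₀, ?_⟩
  · have hcl : IsClosed {x : S2 | 0 ≤ inner ℝ z (x : E3)} :=
      isClosed_le continuous_const (by fun_prop)
    exact isClosed_body.inter hcl
  · rw [mem_interior]
    refine ⟨{x : S2 | ∀ i, 0 < inner ℝ (ed v i) (x : E3)} ∩ {x : S2 | 0 < inner ℝ z (x : E3)},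
      fun x hx => ⟨fun i => (hx.1 i).le, le_of_lt hx.2⟩,
      h.isOpen_strict.inter (isOpen_lt continuous_const (by fun_prop)),
      fun i => hx₀ _ (h.ed_mem i) (norm_ne_zero_iff.1 (by rw [h.norm_ed]; norm_num)), hz⟩

/-- The functional `ed v (i - 1) + ed v i` vanishes at the vertex i and is bounded away from 0 on
the finitely many others. Subtracting `ε • v i` with ε < c therefore gives the normal of a great
circle that separates the vertex i from the other vertices. -/
lemma exists_edge_bound (h : Cycle n v) (i : ℤ) :
    ∃ c : ℝ, 0 < c ∧ ∀ j, v j = v i ∨ c ≤ inner ℝ (ed v (i - 1) + ed v i) (v j) := by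
  have h3 := h.three
  obtain ⟨m, hm, hmin⟩ := Finset.exists_min_image (Finset.Ioo i (i + n))
    (fun j => inner ℝ (ed v (i - 1) + ed v i) (v j)) ⟨i + 1, by simp; omega⟩
  rw [Finset.mem_Ioo] at hm
  refine ⟨inner ℝ (ed v (i - 1) + ed v i) (v m), ?_, fun j => ?_⟩
  · rw [inner_add_left]
    by_cases h1 : m = i + 1
    · have := h.inner_ed_pos (i := i - 1) (j := m) (by omega) (by omega)
      have := h.inner_ed_nonneg i m
      positivity
    · have := h.inner_ed_pos (i := i) (j := m) (by omega) (by omega)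
      have := h.inner_ed_nonneg (i - 1) m
      positivity
  · obtain ⟨l, h1, h2, e⟩ := exists_rep (by omega) h.per i j
    rw [← e]
    rcases eq_or_lt_of_le h1 with rfl | h1
    · exact Or.inl rfl
    · exact Or.inr (hmin l (Finset.mem_Ioo.2 ⟨h1, h2⟩))

lemma inner_ed_pred (i : ℤ) : inner ℝ (ed v (i - 1)) (v i) = 0 := by
  have := inner_ed_succ (v := v) (i - 1)
  rwa [sub_add_cancel] at this

/-- The vectors that are nonnegative on the polygon cut at the vertex `v i`. -/
lemma polar_cut (h : Cycle n v) (hv : ∀ i, ‖v i‖ = 1) {i : ℤ} {c ε : ℝ} (hε : 0 < ε) (hεc : ε < c)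
    (hc : ∀ j, v j = v i ∨ c ≤ inner ℝ (ed v (i - 1) + ed v i) (v j)) {y : E3}
    (hy : ∀ x ∈ cut v (ed v (i - 1) + ed v i - ε • v i), 0 ≤ inner ℝ y (x : E3))
    (hyK : y ∉ dualCone v) :
    ∃ t a b : ℝ, 0 < t ∧ 0 ≤ a ∧ 0 ≤ b ∧ y = t • (ed v (i - 1) + ed v i - ε • v i) +
      (a • ed v (i - 1) + b • ed v i) ∧ t * (c - ε) ≤ ‖y‖ := by
  set z := ed v (i - 1) + ed v i - ε • v i with hz
  have h3 := h.three
  have hzi : inner ℝ z (v i) = -ε := by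
    rw [hz, inner_sub_left, inner_add_left, inner_ed_pred, inner_ed_self, real_inner_smul_left,
      inner_self_unit (hv i)]
    ring
  have hzj : ∀ j, v j = v i ∨ c - ε ≤ inner ℝ z (v j) := by
    intro j
    rcases hc j with h1 | h1
    · exact Or.inl h1
    · right
      rw [hz, inner_sub_left, real_inner_smul_left]
      have := real_inner_le_norm (v i) (v j)
      rw [hv, hv, mul_one] at this
      have := mul_le_mul_of_nonneg_left this hε.le
      linarith
  -- The vector ⟨z, v j⟩ v i + ε v j is orthogonal to z, so its direction lies on the cutting circle
  -- and in the cut polygon, where y is nonnegative.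
  have hcomb : ∀ j, v j = v i ∨ 0 ≤ inner ℝ z (v j) * inner ℝ y (v i) + ε * inner ℝ y (v j) := by
    intro j
    rcases hzj j with h1 | h1
    · exact Or.inl h1
    right
    have hpos : 0 < inner ℝ z (v j) := by linarith
    set x := inner ℝ z (v j) • v i + ε • v j with hx
    have e : inner ℝ z (v j) * inner ℝ y (v i) + ε * inner ℝ y (v j) = inner ℝ y x := by
      rw [hx, inner_add_right, real_inner_smul_right, real_inner_smul_right]
    rw [e]
    by_cases hx0 : x = 0
    · rw [hx0, inner_zero_right]
    rw [← norm_smul_nrm x, real_inner_smul_right]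
    refine mul_nonneg (norm_nonneg _) (hy ⟨nrm x, by simpa using norm_nrm hx0⟩ ⟨?_, ?_⟩)
    · intro l
      change 0 ≤ inner ℝ (ed v l) (nrm x)
      rw [nrm, real_inner_smul_right, hx, inner_add_right, real_inner_smul_right,
        real_inner_smul_right]
      have := h.inner_ed_nonneg l i
      have := h.inner_ed_nonneg l j
      positivity
    · change 0 ≤ inner ℝ z (nrm x)
      rw [nrm, real_inner_smul_right, hx, inner_add_right, real_inner_smul_right,
        real_inner_smul_right, hzi]
      apply mul_nonneg (by positivity)
      linarith
  have hneg : inner ℝ y (v i) < 0 := by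
    by_contra hc'
    push Not at hc'
    apply hyK
    intro j
    rcases hzj j with h1 | h1
    · rwa [h1]
    · refine hy ⟨v j, by simpa using hv j⟩ ⟨h.vertex_mem_body (i := j) rfl, ?_⟩
      change 0 ≤ inner ℝ z (v j)
      linarith
  -- With this t the vector y - t z vanishes at `v i`. By `hcomb` it is in the dual cone, hence on
  -- the edge dual to `v i`.
  set t := -inner ℝ y (v i) / ε with ht
  have htpos : 0 < t := div_pos (by linarith) hε
  have htε : t * ε = -inner ℝ y (v i) := by rw [ht]; field_simp
  have hyz : y - t • z ∈ dualCone v := by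
    intro j
    rw [inner_sub_left, real_inner_smul_left]
    rcases hcomb j with h1 | h1
    · rw [h1, hzi]; linarith
    · have h2 : inner ℝ z (v j) * inner ℝ y (v i) = -(ε * (t * inner ℝ z (v j))) := by
        rw [show inner ℝ y (v i) = -(t * ε) by linarith]; ring
      rw [h2] at h1
      have h4 : 0 ≤ ε * (inner ℝ y (v j) - t * inner ℝ z (v j)) := by linarith
      exact nonneg_of_mul_nonneg_right h4 hε
  obtain ⟨a, b, ha, hb, e⟩ := h.edge_rep hyz (i := i) (by
    rw [inner_sub_left, real_inner_smul_left, hzi]; linarith)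
  refine ⟨t, a, b, htpos, ha, hb, by rw [← e]; abel, ?_⟩
  -- Testing y - t z at a neighboring vertex, where z is at least c - ε, bounds t uniformly in ε.
  have h4 := hyz (i + 1)
  rw [inner_sub_left, real_inner_smul_left] at h4
  have h5 := real_inner_le_norm y (v (i + 1))
  rw [hv, mul_one] at h5
  rcases hzj (i + 1) with h6 | h6
  · exfalso
    have := h.pos i (i + 2) (by omega) (by omega)
    rw [h6, tr_self_left] at this
    exact lt_irrefl _ this
  · have := mul_le_mul_of_nonneg_left h6 htpos.le
    linarith

/-- If the polygon is reduced, cutting off a vertex yields hemispheres at a greater distance. -/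
lemma exists_far_pair (h : Cycle n v) (hv : ∀ i, ‖v i‖ = 1) (hred : IsReduced (body v)) {μ : ℝ}
    (hμ : IsMinCos (dualCone v) μ) (i : ℤ) :
    ∃ c : ℝ, 0 < c ∧ ∀ ε, 0 < ε → ε ≤ c / 2 → ∃ x y : E3, ‖x‖ = 1 ∧ ‖y‖ = 1 ∧ inner ℝ x y < μ ∧
      (∃ t a b : ℝ, 0 < t ∧ 0 ≤ a ∧ 0 ≤ b ∧ y = t • (ed v (i - 1) + ed v i - ε • v i) +
        (a • ed v (i - 1) + b • ed v i) ∧ t * (c / 2) ≤ 1) ∧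
      (x ∈ dualCone v ∨ ∃ t a b : ℝ, 0 < t ∧ 0 ≤ a ∧ 0 ≤ b ∧
        x = t • (ed v (i - 1) + ed v i - ε • v i) +
        (a • ed v (i - 1) + b • ed v i) ∧ t * (c / 2) ≤ 1) := by
  obtain ⟨c₁, hc₁, hc₁'⟩ := h.exists_edge_bound i
  obtain ⟨x₀, hx₀⟩ := h.exists_interior
  have hed0 : ∀ j, ed v j ≠ 0 := fun j => norm_ne_zero_iff.1 (by rw [h.norm_ed]; norm_num)
  have hx₀' : 0 < inner ℝ (ed v (i - 1) + ed v i) (x₀ : E3) := by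
    rw [inner_add_left]
    exact add_pos (hx₀ _ (h.ed_mem _) (hed0 _)) (hx₀ _ (h.ed_mem _) (hed0 _))
  -- The second bound keeps the interior point `x₀` inside the cut polygon, which is therefore still
  -- a body.
  set c := min c₁ (inner ℝ (ed v (i - 1) + ed v i) (x₀ : E3)) with hcdef
  have hc : 0 < c := lt_min hc₁ hx₀'
  have hc' : ∀ j, v j = v i ∨ c ≤ inner ℝ (ed v (i - 1) + ed v i) (v j) := fun j =>
    (hc₁' j).imp_right fun h1 => (min_le_left _ _).trans h1
  refine ⟨c, hc, fun ε hε hεc => ?_⟩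
  have hεc' : ε < c := by linarith
  set z := ed v (i - 1) + ed v i - ε • v i with hz
  have hzx : 0 < inner ℝ z (x₀ : E3) := by
    rw [hz, inner_sub_left, real_inner_smul_left]
    have h1 := real_inner_le_norm (v i) (x₀ : E3)
    rw [hv, norm_coe_S2, mul_one] at h1
    have h2 := mul_le_mul_of_nonneg_left h1 hε.le
    have h3 : c ≤ inner ℝ (ed v (i - 1) + ed v i) (x₀ : E3) := min_le_right _ _
    linarith
  have hbody := h.isConvexBody_cut hx₀ hzx
  have hzi : inner ℝ z (v i) = -ε := by
    rw [hz, inner_sub_left, inner_add_left, inner_ed_pred, inner_ed_self, real_inner_smul_left,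
      inner_self_unit (hv i)]
    ring
  have hsub : cut v z ⊂ body v := by
    refine ⟨fun x hx => hx.1, fun hle => ?_⟩
    have := (hle (a := ⟨v i, by simpa using hv i⟩) (h.vertex_mem_body (i := i) rfl)).2
    change 0 ≤ inner ℝ z (v i) at this
    linarith
  have hthick := hred.2 _ hbody hsub
  have hpol := fun (y : E3) (hy : ∀ x ∈ cut v z, 0 ≤ inner ℝ y (x : E3))
    (hyK : y ∉ dualCone v) => h.polar_cut hv hε hεc' hc' hy hyK
  have hposx₀ : ∀ y ∈ polar (cut v z), 0 < inner ℝ (y : E3) (x₀ : E3) := by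
    intro y hy
    by_cases hyK : (y : E3) ∈ dualCone v
    · exact hx₀ _ hyK (norm_ne_zero_iff.1 (by rw [norm_coe_S2]; norm_num))
    · obtain ⟨t, a, b, ht, ha, hb, e, _⟩ := hpol y hy hyK
      rw [e, inner_add_left, inner_add_left, real_inner_smul_left, real_inner_smul_left,
        real_inner_smul_left]
      have := hx₀ _ (h.ed_mem i) (hed0 _)
      have := hx₀ _ (h.ed_mem (i - 1)) (hed0 _)
      positivity
  have hKpol : polar (body v) ⊆ polar (cut v z) := fun k hk x hx => hk x hx.1
  obtain ⟨x, hx, y, hy, ht, -⟩ := exists_thickness_eq hbody.1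
    (hbody.2.2.mono interior_subset) (fun x hx hx' => by
      have h1 := hposx₀ x hx
      have h2 := hposx₀ _ hx'
      rw [coe_neg_sphere, inner_neg_left] at h2
      linarith) ((h.polar_nontrivial hv).mono hKpol)
  obtain ⟨ν, hν, hν1, hν2, htν⟩ := h.exists_isMinCos hv
  obtain rfl := hμ.unique hν
  rw [ht, htν] at hthick
  have hlt : inner ℝ (x : E3) (y : E3) < μ := by
    rw [inner_eq_cos_angle_of_norm_eq_one (norm_coe_S2 x) (norm_coe_S2 y),
      ← Real.cos_arccos hν1.le hν2.le]
    exact Real.cos_lt_cos_of_nonneg_of_le_pi (Real.arccos_nonneg _) (angle_le_pi _ _) (by linarith)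
  have hrep : ∀ y ∈ polar (cut v z), (y : E3) ∈ dualCone v ∨ ∃ t a b : ℝ, 0 < t ∧ 0 ≤ a ∧ 0 ≤ b ∧
        (y : E3) = t • z + (a • ed v (i - 1) + b • ed v i) ∧ t * (c / 2) ≤ 1 := by
    intro y hy
    by_cases hyK : (y : E3) ∈ dualCone v
    · exact Or.inl hyK
    · obtain ⟨t, a, b, ht, ha, hb, e, h5⟩ := hpol y hy hyK
      refine Or.inr ⟨t, a, b, ht, ha, hb, e, ?_⟩
      rw [norm_coe_S2] at h5
      have : t * (c / 2) ≤ t * (c - ε) := mul_le_mul_of_nonneg_left (by linarith) ht.le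
      linarith
  -- Two points of the old polar cone are never this far apart, so at least one end is new. By
  -- symmetry the new end is called y.
  rcases hrep y hy with hyK | hyR
  · rcases hrep x hx with hxK | hxR
    · exfalso
      have := hμ.le _ hxK _ hyK
      rw [norm_coe_S2, norm_coe_S2] at this
      linarith
    · exact ⟨y, x, norm_coe_S2 y, norm_coe_S2 x, by rwa [real_inner_comm], hxR, Or.inl hyK⟩
  · exact ⟨x, y, norm_coe_S2 x, norm_coe_S2 y, hlt, hyR, hrep x hx⟩

end Cycle

namespace Cycle

variable {n : ℕ} {v : ℤ → E3}

lemma tr_ed_ed_ne (h : Cycle n v) (hv : ∀ i, ‖v i‖ = 1) (i : ℤ) :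
    tr (ed v (i - 1)) (ed v i) (v i) ≠ 0 := by
  obtain ⟨c, hc, e⟩ := h.cr_ed i
  rw [tr, e, real_inner_smul_left, inner_self_unit (hv i), mul_one]
  exact hc.ne'

lemma ed_pred_ne (h : Cycle n v) (hv : ∀ i, ‖v i‖ = 1) (i : ℤ) : ed v (i - 1) ≠ ed v i := by
  intro e
  have := h.tr_ed_ed_ne hv i
  rw [e, tr_self_left] at this
  exact this rfl

/-- The thickness of a reduced polygon is at most `π / 2`. -/
lemma minCos_nonpos (h : Cycle n v) (hv : ∀ i, ‖v i‖ = 1) (hred : IsReduced (body v)) {μ : ℝ}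
    (hμ : IsMinCos (dualCone v) μ) : μ ≤ 0 := by
  by_contra hpos
  push Not at hpos
  obtain ⟨c, hc, hfar⟩ := h.exists_far_pair hv hred hμ 0
  set a := ed v (0 - 1) with ha
  set b := ed v 0 with hb
  have han : ‖a‖ = 1 := h.norm_ed _
  have hbn : ‖b‖ = 1 := h.norm_ed _
  have hab : ‖a + b‖ < 2 := by
    have h1 := norm_add_sq_real a b
    have h2 := norm_sub_sq_real a b
    have h3 : 0 < ‖a - b‖ := norm_pos_iff.2 (sub_ne_zero.2 (h.ed_pred_ne hv 0))
    rw [han, hbn] at h1 h2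
    nlinarith [norm_nonneg (a + b)]
  -- Lower bounds for inner products with the unit vectors a and b add up, whereas a + b is shorter
  -- than 2. For μ > 0 this slack of μ (2 - ‖a + b‖) absorbs the perturbation by ε, so that z makes
  -- no larger angle than arccos μ with vectors of the cone.
  set ε := min (c / 2) (μ * (2 - ‖a + b‖) / (1 + μ)) with hε
  have hεpos : 0 < ε := lt_min (by positivity) (div_pos (mul_pos hpos (by linarith)) (by linarith))
  have hε2 : ε * (1 + μ) ≤ μ * (2 - ‖a + b‖) := by
    rw [← le_div_iff₀ (by linarith)]
    exact min_le_right _ _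
  obtain ⟨x, y, hx, hy, hlt, ⟨t, α, β, ht, hα, hβ, ey, -⟩, hxr⟩ :=
    hfar ε hεpos (min_le_left _ _)
  set z := a + b - ε • v 0 with hz
  have hzn : ‖z‖ ≤ ‖a + b‖ + ε := by
    refine (norm_sub_le _ _).trans ?_
    rw [norm_smul, hv, Real.norm_of_nonneg hεpos.le, mul_one]
  have haK : a ∈ dualCone v := h.ed_mem _
  have hbK : b ∈ dualCone v := h.ed_mem _
  have hzu : ∀ u ∈ dualCone v, μ * (‖z‖ * ‖u‖) ≤ inner ℝ z u := by
    intro u hu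
    rw [hz, inner_sub_left, inner_add_left, real_inner_smul_left]
    have h1 := hμ.le a haK u hu
    have h2 := hμ.le b hbK u hu
    have h3 := real_inner_le_norm (v 0) u
    rw [han] at h1
    rw [hbn] at h2
    rw [hv] at h3
    have h4 := mul_le_mul_of_nonneg_left h3 hεpos.le
    have h5 : μ * (‖z‖ * ‖u‖) ≤ μ * ((‖a + b‖ + ε) * ‖u‖) := by gcongr
    have h6 : 0 ≤ (μ * (2 - ‖a + b‖) - ε * (1 + μ)) * ‖u‖ :=
      mul_nonneg (by linarith) (norm_nonneg _)
    nlinarith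
  have hμ1 : μ ≤ 1 := by
    obtain ⟨x, _, y, _, h1, h2, h3⟩ := hμ.attained
    have := real_inner_le_norm x y
    rw [h1, h2] at this
    linarith
  have hzz : μ * (‖z‖ * ‖z‖) ≤ inner ℝ z z := by
    rw [real_inner_self_eq_norm_mul_norm]
    nlinarith [mul_self_nonneg ‖z‖]
  obtain ⟨s, u, hs, hu, ex⟩ : ∃ (s : ℝ) (u : E3), 0 ≤ s ∧ u ∈ dualCone v ∧ x = s • z + u := by
    rcases hxr with hxK | ⟨s, α', β', hs, hα', hβ', ex, -⟩
    · exact ⟨0, x, le_rfl, hxK, by simp⟩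
    · exact ⟨s, _, hs.le, dualCone_add (dualCone_smul hα' haK) (dualCone_smul hβ' hbK), ex⟩
  set w := α • a + β • b with hw
  have hwK : w ∈ dualCone v := dualCone_add (dualCone_smul hα haK) (dualCone_smul hβ hbK)
  have hxn : ‖x‖ ≤ s * ‖z‖ + ‖u‖ := by
    rw [ex]
    refine (norm_add_le _ _).trans ?_
    rw [norm_smul, Real.norm_of_nonneg hs]
  have hyn : ‖y‖ ≤ t * ‖z‖ + ‖w‖ := by
    rw [ey]
    refine (norm_add_le _ _).trans ?_
    rw [norm_smul, Real.norm_of_nonneg ht.le]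
  have hxy : inner ℝ x y = s * t * inner ℝ z z + s * inner ℝ z w + t * inner ℝ z u +
      inner ℝ u w := by
    rw [ex, ey]
    simp only [inner_add_left, inner_add_right, real_inner_smul_left, real_inner_smul_right,
      real_inner_comm z u]
    ring
  -- Expanding ⟨x, y⟩, every term is at least μ times the product of the norms involved. The
  -- triangle inequality together with μ > 0 then gives ⟨x, y⟩ ≥ μ, a contradiction.
  have k1 := mul_le_mul_of_nonneg_left hzz (mul_nonneg hs ht.le)
  have k2 := mul_le_mul_of_nonneg_left (hzu w hwK) hs
  have k3 := mul_le_mul_of_nonneg_left (hzu u hu) ht.le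
  have k4 := hμ.le u hu w hwK
  have k5 : 1 ≤ (s * ‖z‖ + ‖u‖) * (t * ‖z‖ + ‖w‖) := by
    rw [hx] at hxn
    rw [hy] at hyn
    nlinarith
  have k6 := mul_le_mul_of_nonneg_left k5 hpos.le
  nlinarith

/-- The limit of far pairs of the cut polygons: every edge of the polar polygon contains the foot
of a diameter of the polar polygon. -/
lemma exists_foot (h : Cycle n v) (hv : ∀ i, ‖v i‖ = 1) (hred : IsReduced (body v)) {μ : ℝ}
    (hμ : IsMinCos (dualCone v) μ) (h0 : μ ≤ 0) (h1 : -1 < μ) (i : ℤ) :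
    ∃ p ∈ dualCone v, ∃ w ∈ dualCone v, ‖p‖ = 1 ∧ ‖w‖ = 1 ∧ inner ℝ p (v i) = 0 ∧
      inner ℝ w p = μ ∧ w = μ • p + √(1 - μ ^ 2) • v i := by
  obtain ⟨c, hc, hfar⟩ := h.exists_far_pair hv hred hμ i
  set a := ed v (i - 1) with ha
  set b := ed v i with hb
  have haK : a ∈ dualCone v := h.ed_mem _
  have hbK : b ∈ dualCone v := h.ed_mem _
  have han : ‖a‖ = 1 := h.norm_ed _
  have hbn : ‖b‖ = 1 := h.norm_ed _
  have hai : inner ℝ a (v i) = 0 := inner_ed_pred i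
  have hbi : inner ℝ b (v i) = 0 := inner_ed_self i
  -- Cuts that shrink to the vertex. As the coefficients t are at most 2 / c, the new ends leave the
  -- old cone only by multiples of `v i` that tend to 0.
  let ε : ℕ → ℝ := fun m => c / 2 * (1 / ((m : ℝ) + 1))
  have hεpos : ∀ m, 0 < ε m := fun m => by positivity
  have hεle : ∀ m, ε m ≤ c / 2 := by
    intro m
    apply mul_le_of_le_one_right (by positivity)
    rw [div_le_one (by positivity)]
    have : (0 : ℝ) ≤ m := Nat.cast_nonneg m
    linarith
  have hεlim : Filter.Tendsto ε Filter.atTop (nhds 0) := by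
    have := tendsto_one_div_add_atTop_nhds_zero_nat (𝕜 := ℝ)
    simpa [ε] using this.const_mul (c / 2)
  choose x y hx hy hxy hyr hxr using fun m => hfar (ε m) (hεpos m) (hεle m)
  choose t α β ht hα hβ ey htc using hyr
  -- the projection of `x m` to the polar cone
  have hproj : ∀ m, ∃ δ : ℝ, 0 ≤ δ ∧ δ ≤ 2 / c * ε m ∧ x m + δ • v i ∈ dualCone v ∧
      ‖x m + δ • v i‖ ≤ 1 := by
    intro m
    rcases hxr m with hxK | ⟨s, α', β', hs, hα', hβ', ex, hsc⟩
    · refine ⟨0, le_rfl, by have := hεpos m; positivity, ?_, ?_⟩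
      · simpa using hxK
      · simp [hx m]
    · refine ⟨s * ε m, mul_nonneg hs.le (hεpos m).le, ?_, ?_, ?_⟩
      · apply mul_le_mul_of_nonneg_right _ (hεpos m).le
        rw [le_div_iff₀ hc]; linarith
      · have e : x m + (s * ε m) • v i = s • (a + b) + (α' • a + β' • b) := by
          rw [ex]; module
        rw [e]
        exact dualCone_add (dualCone_smul hs.le (dualCone_add haK hbK))
          (dualCone_add (dualCone_smul hα' haK) (dualCone_smul hβ' hbK))
      · have hxi : inner ℝ (x m) (v i) = -(s * ε m) := by
          rw [ex]
          simp only [inner_add_left, inner_sub_left, real_inner_smul_left, hai, hbi,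
            inner_self_unit (hv i)]
          ring
        have h2 := norm_add_sq_real (x m) ((s * ε m) • v i)
        rw [real_inner_smul_right, hxi, hx, norm_smul, hv, mul_one, Real.norm_eq_abs, sq_abs] at h2
        have h3 := norm_nonneg (x m + (s * ε m) • v i)
        nlinarith [sq_nonneg (s * ε m)]
  choose δ hδ0 hδε hδK hδn using hproj
  have hδlim : Filter.Tendsto δ Filter.atTop (nhds 0) := by
    refine squeeze_zero hδ0 hδε ?_
    simpa using hεlim.const_mul (2 / c)
  have htε : ∀ m, t m * ε m ≤ 2 / c * ε m := fun m => by
    apply mul_le_mul_of_nonneg_right _ (hεpos m).le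
    rw [le_div_iff₀ hc]; have := htc m; linarith
  have htεlim : Filter.Tendsto (fun m => t m * ε m) Filter.atTop (nhds 0) := by
    refine squeeze_zero (fun m => mul_nonneg (ht m).le (hεpos m).le) htε ?_
    simpa using hεlim.const_mul (2 / c)
  -- passage to the limit
  obtain ⟨⟨X, Y⟩, ⟨hX, hY⟩, φ, hφ, hlim⟩ :=
    ((isCompact_sphere (0 : E3) 1).prod (isCompact_sphere (0 : E3) 1)).tendsto_subseq
      (x := fun m => (x m, y m)) (fun m => ⟨by simp [hx m], by simp [hy m]⟩)
  replace hX : ‖X‖ = 1 := by simpa using hX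
  replace hY : ‖Y‖ = 1 := by simpa using hY
  have hxl : Filter.Tendsto (fun m => x (φ m)) Filter.atTop (nhds X) :=
    (continuous_fst.tendsto _).comp hlim
  have hyl : Filter.Tendsto (fun m => y (φ m)) Filter.atTop (nhds Y) :=
    (continuous_snd.tendsto _).comp hlim
  have hφ' := hφ.tendsto_atTop
  have hεφ := hεlim.comp hφ'
  have hXK : X ∈ dualCone v := by
    intro j
    have h2 : Filter.Tendsto (fun m => inner ℝ (x (φ m) + δ (φ m) • v i) (v j)) Filter.atTop
        (nhds (inner ℝ (X + (0 : ℝ) • v i) (v j))) :=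
      (hxl.add ((hδlim.comp hφ').smul_const (v i))).inner tendsto_const_nhds
    rw [zero_smul, add_zero] at h2
    exact ge_of_tendsto' h2 fun m => hδK (φ m) j
  have hyproj : ∀ m, y m + (t m * ε m) • v i = t m • (a + b) + (α m • a + β m • b) := by
    intro m
    rw [ey]; module
  have hYlim : Filter.Tendsto (fun m => y (φ m) + (t (φ m) * ε (φ m)) • v i) Filter.atTop
      (nhds Y) := by
    have := hyl.add ((htεlim.comp hφ').smul_const (v i))
    simpa using this
  have hYK : Y ∈ dualCone v := by
    intro j
    refine ge_of_tendsto' (hYlim.inner tendsto_const_nhds) fun m => ?_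
    rw [hyproj]
    exact dualCone_add (dualCone_smul (ht _).le (dualCone_add haK hbK))
      (dualCone_add (dualCone_smul (hα _) haK) (dualCone_smul (hβ _) hbK)) j
  have hYi : inner ℝ Y (v i) = 0 := by
    refine tendsto_nhds_unique (hYlim.inner tendsto_const_nhds) ?_
    have : ∀ m, inner ℝ (y (φ m) + (t (φ m) * ε (φ m)) • v i) (v i) = (0 : ℝ) := by
      intro m
      rw [hyproj]
      simp only [inner_add_left, real_inner_smul_left, hai, hbi]
      ring
    simp [this]
  have hXY : inner ℝ X Y = μ := by
    apply le_antisymm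
    · exact le_of_tendsto' (hxl.inner hyl) fun m => (hxy _).le
    · have := hμ.le X hXK Y hYK
      rwa [hX, hY, mul_one, mul_one] at this
  have hYX : inner ℝ X Y = μ := hXY
  have fa := hμ.first_order h0 h1 hXK hYK haK hX hY hXY
  have fb := hμ.first_order h0 h1 hXK hYK hbK hX hY hXY
  -- the functional vanishes on the edge
  have hcontra : inner ℝ X (a + b) ≤ μ * inner ℝ Y (a + b) := by
    by_contra hgt
    push Not at hgt
    obtain ⟨s, r, hs, hr, eY⟩ := h.edge_rep hYK hYi
    rw [← ha, ← hb] at eY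
    -- The functional X - μ Y is nonnegative on a and b by the first-order condition and vanishes at
    -- Y. If Y is in the relative interior of the edge, it vanishes on the whole edge at once.
    have hsr : s * (inner ℝ X a - μ * inner ℝ Y a) + r * (inner ℝ X b - μ * inner ℝ Y b) = 0 := by
      have e1 : inner ℝ X Y = s * inner ℝ X a + r * inner ℝ X b := by
        conv_lhs => rw [eY]
        rw [inner_add_right, real_inner_smul_right, real_inner_smul_right]
      have e2 : inner ℝ Y Y = s * inner ℝ Y a + r * inner ℝ Y b := by
        conv_lhs => arg 3; rw [eY]
        rw [inner_add_right, real_inner_smul_right, real_inner_smul_right]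
      rw [inner_self_unit hY] at e2
      rw [hXY] at e1
      linear_combination μ * e2 - e1
    rw [inner_add_right, inner_add_right] at hgt
    -- If Y is an end a' of the edge, the limit alone says nothing about the other end b'. Were X -
    -- μ Y positive at b', then for large m the functional x_m - μ Y would be nonnegative on a', b'
    -- and the cutting normal, hence on y_m. It is negative there, because ⟨x_m, y_m⟩ < μ and μ ⟨Y,
    -- y_m⟩ ≥ μ.
    have key : ∀ {a' b' : E3}, inner ℝ Y a' = (1 : ℝ) → inner ℝ X a' = μ → Y = a' →
        ‖a'‖ = 1 → a' ∈ dualCone v → inner ℝ a' (v i) = (0 : ℝ) →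
        μ * inner ℝ Y b' < inner ℝ X b' →
        (∃ α' β' : ℕ → ℝ, (∀ m, 0 ≤ α' m) ∧ (∀ m, 0 ≤ β' m) ∧ ∀ m, y m =
          t m • (a + b - ε m • v i) + (α' m • a' + β' m • b')) → False := by
      intro a' b' q1 q2 q3 q4 q5 q6 q7 ⟨α', β', hα', hβ', ey'⟩
      have l1 : Filter.Tendsto (fun m => inner ℝ (x (φ m) - μ • Y) b') Filter.atTop
          (nhds (inner ℝ (X - μ • Y) b')) :=
        (hxl.sub tendsto_const_nhds).inner tendsto_const_nhds
      have l2 : Filter.Tendsto (fun m => inner ℝ (x (φ m) - μ • Y) (a + b - ε (φ m) • v i))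
          Filter.atTop (nhds (inner ℝ (X - μ • Y) (a + b - (0 : ℝ) • v i))) :=
        (hxl.sub tendsto_const_nhds).inner (tendsto_const_nhds.sub (hεφ.smul_const _))
      have p1 : 0 < inner ℝ (X - μ • Y) b' := by
        rw [inner_sub_left, real_inner_smul_left]; linarith
      have p2 : 0 < inner ℝ (X - μ • Y) (a + b - (0 : ℝ) • v i) := by
        rw [zero_smul, sub_zero, inner_sub_left, real_inner_smul_left, inner_add_right,
          inner_add_right]
        linarith
      obtain ⟨m, r1, r2⟩ := ((l1.eventually_const_lt p1).and (l2.eventually_const_lt p2)).exists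
      have r3 : 0 ≤ inner ℝ (x (φ m) - μ • Y) a' := by
        rw [inner_sub_left, real_inner_smul_left, q1]
        have s1 := hμ.le _ (hδK (φ m)) _ q5
        rw [inner_add_left, real_inner_smul_left, real_inner_comm a' (v i), q6, q4] at s1
        have s2 := mul_le_mul_of_nonpos_left (hδn (φ m)) h0
        linarith
      have r4 : inner ℝ (x (φ m) - μ • Y) (y (φ m)) < 0 := by
        rw [inner_sub_left, real_inner_smul_left]
        have s1 := real_inner_le_norm Y (y (φ m))
        rw [hY, hy, mul_one] at s1
        have s2 := mul_le_mul_of_nonpos_left s1 h0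
        have s3 := hxy (φ m)
        linarith
      rw [ey', inner_add_right, inner_add_right, real_inner_smul_right, real_inner_smul_right,
        real_inner_smul_right] at r4
      have s1 := mul_nonneg (ht (φ m)).le r2.le
      have s2 := mul_nonneg (hα' (φ m)) r3
      have s3 := mul_nonneg (hβ' (φ m)) r1.le
      linarith
    have hunit : ∀ {a' : E3} {s : ℝ}, 0 ≤ s → ‖a'‖ = 1 → Y = s • a' → Y = a' := by
      intro a' s hs ha' e
      have := congrArg norm e
      rw [hY, norm_smul, ha', mul_one, Real.norm_of_nonneg hs] at this
      rw [e, ← this, one_smul]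
    rcases eq_or_lt_of_le hs with hs0 | hs0
    · have hYb : Y = b := hunit hr hbn (by rw [eY, ← hs0]; simp)
      refine key (a' := b) (b' := a) (by rw [hYb, inner_self_unit hbn]) (by rw [← hYb, hXY]) hYb hbn
        hbK hbi ?_ ⟨β, α, hβ, hα, fun m => by rw [ey m, add_comm (β m • b)]⟩
      have : inner ℝ X b = μ * inner ℝ Y b := by
        rw [hYb, inner_self_unit hbn, ← hYb, hXY, mul_one]
      linarith
    · rcases eq_or_lt_of_le hr with hr0 | hr0
      · have hYa : Y = a := hunit hs han (by rw [eY, ← hr0]; simp)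
        refine key (a' := a) (b' := b) (by rw [hYa, inner_self_unit han]) (by rw [← hYa, hXY]) hYa
          han haK hai ?_ ⟨α, β, hα, hβ, ey⟩
        have : inner ℝ X a = μ * inner ℝ Y a := by
          rw [hYa, inner_self_unit han, ← hYa, hXY, mul_one]
        linarith
      · have s1 := mul_nonneg hs (sub_nonneg.2 fa)
        have s2 := mul_nonneg hr (sub_nonneg.2 fb)
        rcases mul_eq_zero.1 (show s * (inner ℝ X a - μ * inner ℝ Y a) = 0 by linarith) with s3 | s3
        · linarith
        · rcases mul_eq_zero.1 (show r * (inner ℝ X b - μ * inner ℝ Y b) = 0 by linarith) with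
            s4 | s4 <;> linarith
  rw [inner_add_right, inner_add_right] at hcontra
  refine ⟨Y, hYK, X, hXK, hY, hX, hYi, hXY, ?_⟩
  -- Being orthogonal to both ends of the edge, X - μ Y is a multiple of `v i`. Its coefficient
  -- follows from ‖X‖ = 1 and ⟨X, v i⟩ ≥ 0.
  have e0 : X - μ • Y - inner ℝ X (v i) • v i = 0 := by
    apply eq_zero_of_inner (h.tr_ed_ed_ne hv i) <;> rw [real_inner_comm] <;>
      simp only [inner_sub_left, real_inner_smul_left, ← ha, ← hb]
    · rw [real_inner_comm a (v i), hai]; linarith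
    · rw [real_inner_comm b (v i), hbi]; linarith
    · rw [hYi, inner_self_unit (hv i)]; ring
  have e1 : X = μ • Y + inner ℝ X (v i) • v i := by
    rw [← sub_eq_zero, ← e0]; abel
  have hXi : inner ℝ X (v i) = √(1 - μ ^ 2) := by
    symm
    rw [Real.sqrt_eq_iff_mul_self_eq (by nlinarith) (hXK i)]
    have e2 : inner ℝ X X = μ * inner ℝ X Y + inner ℝ X (v i) * inner ℝ X (v i) := by
      conv_lhs => arg 3; rw [e1]
      rw [inner_add_right, real_inner_smul_right, real_inner_smul_right]
    rw [inner_self_unit hX, hXY] at e2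
    linarith
  rwa [← hXi]

end Cycle

/-! ### Shear arguments: a polar diameter from a foot ends at a vertex. -/

/-- Two points at maximal distance cannot be moved apart along opposite normal directions. -/
lemma IsMinCos.no_shear {K : Set E3} {μ : ℝ} (h : IsMinCos K μ) (h1 : -1 < μ) {x y N : E3} {t : ℝ}
    (ht : 0 < t) (hx : x + t • N ∈ K) (hy : y + t • -N ∈ K) (hxn : ‖x‖ = 1) (hyn : ‖y‖ = 1)
    (hxy : inner ℝ x y = μ) (hNx : inner ℝ N x = 0) (hNy : inner ℝ N y = 0) : N = 0 := by
  by_contra hN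
  have hpos : 0 < ‖N‖ := norm_pos_iff.2 hN
  have e1 := norm_add_sq_real x (t • N)
  have e2 := norm_add_sq_real y (t • -N)
  rw [real_inner_smul_right, real_inner_comm, hNx, hxn, norm_smul, Real.norm_of_nonneg ht.le] at e1
  rw [real_inner_smul_right, inner_neg_right, real_inner_comm, hNy, hyn, norm_smul, norm_neg,
    Real.norm_of_nonneg ht.le] at e2
  have e3 : ‖x + t • N‖ = ‖y + t • -N‖ := by
    rw [← sq_eq_sq₀ (norm_nonneg _) (norm_nonneg _), e1, e2]; ring
  -- Both moved points have squared norm 1 + t²‖N‖², while their inner product drops to μ - t²‖N‖².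
  -- The minimality of μ would then force μ ≤ -1.
  have e4 := h.le _ hx _ hy
  rw [← e3, ← sq, e1] at e4
  simp only [inner_add_left, inner_add_right, real_inner_smul_left, real_inner_smul_right,
    inner_neg_right, hxy, hNy, real_inner_comm N x, hNx, real_inner_self_eq_norm_sq] at e4
  have : 0 < t ^ 2 * ‖N‖ ^ 2 := by positivity
  nlinarith

namespace Cycle

variable {n : ℕ} {v : ℤ → E3}

/-- Only finitely many constraints occur. Those inactive at p survive small moves, and the active
ones are covered by the hypothesis on N. -/
lemma eventually_add_smul_mem (h : Cycle n v) {p N : E3} (hp : p ∈ dualCone v)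
    (hN : ∀ l, inner ℝ p (v l) = 0 → 0 ≤ inner ℝ N (v l)) :
    ∀ᶠ t : ℝ in nhdsWithin 0 (Set.Ioi 0), p + t • N ∈ dualCone v := by
  have h3 := h.three
  have key : ∀ᶠ t : ℝ in nhdsWithin 0 (Set.Ioi 0), ∀ l ∈ Finset.Ico (0 : ℤ) n,
      0 ≤ inner ℝ (p + t • N) (v l) := by
    rw [Filter.eventually_all_finset]
    intro l _
    rcases eq_or_lt_of_le (hp l) with h0 | h0
    · filter_upwards [self_mem_nhdsWithin] with t ht
      rw [inner_add_left, real_inner_smul_left, ← h0, zero_add]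
      exact mul_nonneg (le_of_lt ht) (hN l h0.symm)
    · have hc : Continuous fun t : ℝ => inner ℝ (p + t • N) (v l) := by fun_prop
      have h1 : 0 < inner ℝ (p + (0 : ℝ) • N) (v l) := by simpa using h0
      exact (((hc.tendsto 0).eventually_const_lt h1).filter_mono nhdsWithin_le_nhds).mono
        fun t ht => ht.le
  filter_upwards [key] with t ht l
  obtain ⟨l', h1, h2, e⟩ := exists_rep (by omega) h.per 0 l
  rw [← e]
  exact ht l' (Finset.mem_Ico.2 ⟨h1, by omega⟩)

lemma inner_ed_eq_zero (h : Cycle n v) {i l : ℤ} (h0 : inner ℝ (ed v i) (v l) = 0) :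
    v l = v i ∨ v l = v (i + 1) := by
  have h3 := h.three
  obtain ⟨l', h1, h2, e⟩ := exists_rep (by omega) h.per i l
  rw [← e] at h0 ⊢
  rcases eq_or_lt_of_le h1 with rfl | h1
  · exact Or.inl rfl
  rcases eq_or_lt_of_le (Int.add_one_le_of_lt h1) with h1 | h1
  · right; rw [h1]
  · exact absurd h0 (h.inner_ed_pos h1 h2).ne'

lemma inner_edge_eq_zero (h : Cycle n v) {i l : ℤ} {a b : ℝ} (ha : 0 < a) (hb : 0 < b)
    (h0 : inner ℝ (a • ed v (i - 1) + b • ed v i) (v l) = 0) : v l = v i := by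
  obtain ⟨c, hc, hcl⟩ := h.exists_edge_bound i
  refine (hcl l).resolve_right fun h1 => ?_
  rw [inner_add_left, real_inner_smul_left, real_inner_smul_left] at h0
  rw [inner_add_left] at h1
  have h2 := h.inner_ed_nonneg (i - 1) l
  have h3 := h.inner_ed_nonneg i l
  have h4 : a * inner ℝ (ed v (i - 1)) (v l) = 0 := by
    have := mul_nonneg ha.le h2; have := mul_nonneg hb.le h3; linarith
  have h5 : b * inner ℝ (ed v i) (v l) = 0 := by linarith
  rw [mul_eq_zero] at h4 h5
  rcases h4 with h4 | h4 <;> rcases h5 with h5 | h5 <;> linarith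

lemma eq_ed_of_smul (h : Cycle n v) {w : E3} {j : ℤ} {b : ℝ} (hb : 0 ≤ b) (hw : ‖w‖ = 1)
    (e : w = b • ed v j) : w = ed v j := by
  have := congrArg norm e
  rw [hw, norm_smul, h.norm_ed, mul_one, Real.norm_of_nonneg hb] at this
  rw [e, ← this, one_smul]

/-- A point at maximal distance from another one lies on an edge. -/
lemma exists_edge_of_isMin (h : Cycle n v) {μ : ℝ} (hμ : IsMinCos (dualCone v) μ) (h0 : μ ≤ 0)
    (h1 : -1 < μ) {p w : E3} (hw : w ∈ dualCone v) (hp : p ∈ dualCone v) (hwn : ‖w‖ = 1)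
    (hpn : ‖p‖ = 1) (hwp : inner ℝ w p = μ) : ∃ j, inner ℝ w (v j) = 0 := by
  by_contra hne
  push Not at hne
  -- If no constraint were active at w, then w could be moved straight away from p inside the cone.
  obtain ⟨t, ht, htpos⟩ := ((h.eventually_add_smul_mem (N := -p) hw
    fun l hl => absurd hl (hne l)).and self_mem_nhdsWithin).exists
  replace htpos : 0 < t := htpos
  have e1 := norm_add_sq_real w (t • -p)
  rw [real_inner_smul_right, inner_neg_right, hwp, hwn, norm_smul, norm_neg, hpn,
    Real.norm_of_nonneg htpos.le] at e1
  have e2 := hμ.le _ ht _ hp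
  rw [inner_add_left, real_inner_smul_left, inner_neg_left, hwp, inner_self_unit hpn, hpn] at e2
  have e3 := norm_nonneg (w + t • -p)
  have e4 : (t - μ) ≤ -μ * ‖w + t • -p‖ := by linarith
  have e5 : (t - μ) ^ 2 ≤ (-μ * ‖w + t • -p‖) ^ 2 := pow_le_pow_left₀ (by linarith) e4 2
  rw [mul_pow, e1] at e5
  have h6 : 0 < (1 - μ ^ 2) := by nlinarith
  have : 0 < t ^ 2 - 2 * t * μ := by nlinarith
  nlinarith

/-- The point opposite to a foot is a vertex. -/
lemma exists_vertex_of_foot (h : Cycle n v) (hv : ∀ i, ‖v i‖ = 1) {μ : ℝ}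
    (hμ : IsMinCos (dualCone v) μ) (h0 : μ ≤ 0) (h1 : -1 < μ) {i : ℤ} {p w : E3} {σ : ℝ}
    (hp : p ∈ dualCone v) (hw : w ∈ dualCone v) (hpn : ‖p‖ = 1) (hwn : ‖w‖ = 1)
    (hpi : inner ℝ p (v i) = 0) (hwp : inner ℝ w p = μ) (hσ : 0 < σ) (e : w = μ • p + σ • v i) :
    ∃ j, w = ed v j := by
  obtain ⟨j, hj⟩ := h.exists_edge_of_isMin hμ h0 h1 hw hp hwn hpn hwp
  obtain ⟨a, b, ha, hb, ew⟩ := h.edge_rep hw hj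
  rcases eq_or_lt_of_le ha with ha | ha
  · exact ⟨j, h.eq_ed_of_smul hb hwn (by rw [ew, ← ha]; simp)⟩
  rcases eq_or_lt_of_le hb with hb | hb
  · exact ⟨j - 1, h.eq_ed_of_smul ha.le hwn (by rw [ew, ← hb]; simp)⟩
  exfalso
  -- Here w is in the relative interior of the edge j. The first-order conditions then make the
  -- chord orthogonal to this edge as well, so that p = μ w + τ v j.
  have hpw : inner ℝ p w = μ := by rw [real_inner_comm, hwp]
  have f1 := hμ.first_order h0 h1 hp hw (h.ed_mem (j - 1)) hpn hwn hpw
  have f2 := hμ.first_order h0 h1 hp hw (h.ed_mem j) hpn hwn hpw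
  have f3 : a * (inner ℝ p (ed v (j - 1)) - μ * inner ℝ w (ed v (j - 1))) +
      b * (inner ℝ p (ed v j) - μ * inner ℝ w (ed v j)) = 0 := by
    have e1 : inner ℝ p w = a * inner ℝ p (ed v (j - 1)) + b * inner ℝ p (ed v j) := by
      conv_lhs => rw [ew]
      rw [inner_add_right, real_inner_smul_right, real_inner_smul_right]
    have e2 : inner ℝ w w = a * inner ℝ w (ed v (j - 1)) + b * inner ℝ w (ed v j) := by
      conv_lhs => arg 3; rw [ew]
      rw [inner_add_right, real_inner_smul_right, real_inner_smul_right]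
    rw [inner_self_unit hwn] at e2
    rw [hpw] at e1
    linear_combination μ * e2 - e1
  have f4 := mul_nonneg ha.le (sub_nonneg.2 f1)
  have f5 := mul_nonneg hb.le (sub_nonneg.2 f2)
  have f6 : inner ℝ p (ed v (j - 1)) - μ * inner ℝ w (ed v (j - 1)) = 0 :=
    (mul_eq_zero.1 (by linarith : a * _ = 0)).resolve_left ha.ne'
  have f7 : inner ℝ p (ed v j) - μ * inner ℝ w (ed v j) = 0 :=
    (mul_eq_zero.1 (by linarith : b * _ = 0)).resolve_left hb.ne'
  have g1 : p = μ • w + inner ℝ p (v j) • v j := by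
    rw [← sub_eq_zero]
    apply eq_zero_of_inner (h.tr_ed_ed_ne hv j) <;> rw [real_inner_comm] <;>
      simp only [inner_sub_left, inner_add_left, real_inner_smul_left, real_inner_comm (ed v _) (v j)]
    · rw [inner_ed_pred]; linarith
    · rw [inner_ed_self]; linarith
    · rw [hj, inner_self_unit (hv j)]; ring
  -- The normal of the chord is orthogonal to `v i` and `v j`, hence tangent to both edges. It is
  -- the direction of the shear.
  set N := cr p w with hN
  have hNp : inner ℝ N p = 0 := inner_cr_left p w
  have hNw : inner ℝ N w = 0 := inner_cr_right p w
  have hNN : inner ℝ N N = 1 - μ ^ 2 := by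
    rw [hN, inner_cr_cr, inner_self_unit hpn, inner_self_unit hwn, hwp, hpw]; ring
  have hN0 : N ≠ 0 := by
    intro hz
    rw [hz, inner_zero_left] at hNN
    nlinarith
  have hNi : inner ℝ N (v i) = 0 := by
    have := hNw
    rw [e, inner_add_right, real_inner_smul_right, real_inner_smul_right, hNp] at this
    rw [mul_zero, zero_add, mul_eq_zero] at this
    exact this.resolve_left hσ.ne'
  have hNj : inner ℝ N (v j) = 0 := by
    have := hNp
    rw [g1, inner_add_right, real_inner_smul_right, real_inner_smul_right, hNw] at this
    rw [mul_zero, zero_add, mul_eq_zero] at this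
    refine this.resolve_left fun hz => ?_
    rw [hz, zero_smul, add_zero] at g1
    have := congrArg (fun x => inner ℝ x w) g1
    simp only [real_inner_smul_left, hpw, inner_self_unit hwn] at this
    have h2 := congrArg norm g1
    rw [hpn, norm_smul, hwn, mul_one, Real.norm_eq_abs, abs_of_nonpos h0] at h2
    linarith
  have hmove : ∀ s : ℝ, ∀ᶠ t : ℝ in nhdsWithin 0 (Set.Ioi 0), w + t • (s • N) ∈ dualCone v := by
    intro s
    apply h.eventually_add_smul_mem hw
    intro l hl
    rw [ew] at hl
    rw [h.inner_edge_eq_zero ha hb hl, real_inner_smul_left, hNj, mul_zero]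
  have hsign : ∀ l : ℤ, ∃ s : ℝ, s ≠ 0 ∧ 0 ≤ inner ℝ (s • N) (v l) := by
    intro l
    rcases le_total 0 (inner ℝ N (v l)) with hl | hl
    · exact ⟨1, one_ne_zero, by simpa using hl⟩
    · exact ⟨-1, by norm_num, by simpa using hl⟩
  -- The foot p may be an end of its edge and then moves to one side only, whereas w moves to both.
  -- So the sign is chosen for p, and w takes the opposite one.
  obtain ⟨s, hs, hpm⟩ : ∃ s : ℝ, s ≠ 0 ∧
      ∀ᶠ t : ℝ in nhdsWithin 0 (Set.Ioi 0), p + t • (s • N) ∈ dualCone v := by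
    obtain ⟨a', b', ha', hb', ep⟩ := h.edge_rep hp hpi
    rcases eq_or_lt_of_le ha' with ha' | ha'
    · have hpe : p = ed v i := h.eq_ed_of_smul hb' hpn (by rw [ep, ← ha']; simp)
      obtain ⟨s, hs, hs'⟩ := hsign (i + 1)
      refine ⟨s, hs, h.eventually_add_smul_mem hp fun l hl => ?_⟩
      rw [hpe] at hl
      rcases h.inner_ed_eq_zero hl with hl | hl
      · rw [hl, real_inner_smul_left, hNi, mul_zero]
      · rwa [hl]
    rcases eq_or_lt_of_le hb' with hb' | hb'
    · have hpe : p = ed v (i - 1) := h.eq_ed_of_smul ha'.le hpn (by rw [ep, ← hb']; simp)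
      obtain ⟨s, hs, hs'⟩ := hsign (i - 1)
      refine ⟨s, hs, h.eventually_add_smul_mem hp fun l hl => ?_⟩
      rw [hpe] at hl
      rcases h.inner_ed_eq_zero hl with hl | hl
      · rwa [hl]
      · rw [hl, sub_add_cancel, real_inner_smul_left, hNi, mul_zero]
    · refine ⟨1, one_ne_zero, h.eventually_add_smul_mem hp fun l hl => ?_⟩
      rw [ep] at hl
      rw [h.inner_edge_eq_zero ha' hb' hl, real_inner_smul_left, hNi, mul_zero]
  obtain ⟨t, ⟨ht1, ht2⟩, ht⟩ := ((hpm.and (hmove (-s))).and self_mem_nhdsWithin).exists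
  have := hμ.no_shear (N := s • N) h1 ht ht1 (by simpa using ht2) hpn hwn hpw
    (by rw [real_inner_smul_left, hNp, mul_zero]) (by rw [real_inner_smul_left, hNw, mul_zero])
  exact (smul_ne_zero hs hN0) this

end Cycle

/-! ### Crossing chords and the parity of the number of vertices. -/

/-- Two segments of maximal length, each orthogonal to a supporting plane at its foot, cross. -/
lemma cross_of_feet {μ σ : ℝ} (h0 : μ ≤ 0) (h1 : -1 < μ) (hσ : 0 < σ) {p w u p' w' u' : E3}
    (hp : ‖p‖ = 1) (hp' : ‖p'‖ = 1) (hw : ‖w‖ = 1) (hw' : ‖w'‖ = 1)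
    (hwp : inner ℝ w p = μ) (hwp' : inner ℝ w' p' = μ) (e : w = μ • p + σ • u)
    (e' : w' = μ • p' + σ • u') (k1 : 0 ≤ inner ℝ p' u) (k2 : 0 ≤ inner ℝ w' u)
    (k3 : 0 ≤ inner ℝ p u') (hpp : μ ≤ inner ℝ p p') :
    tr p w p' * tr p w w' ≤ 0 := by
  have c1 : μ * inner ℝ p p' ≤ inner ℝ w p' := by
    rw [e, inner_add_left, real_inner_smul_left, real_inner_smul_left, real_inner_comm p' u]
    have := mul_nonneg hσ.le k1
    linarith
  have c2 : μ * inner ℝ p w' ≤ inner ℝ w w' := by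
    rw [e, inner_add_left, real_inner_smul_left, real_inner_smul_left, real_inner_comm w' u]
    have := mul_nonneg hσ.le k2
    linarith
  have c3 : μ * inner ℝ p p' ≤ inner ℝ p w' := by
    rw [e', inner_add_right, real_inner_smul_right, real_inner_smul_right]
    have := mul_nonneg hσ.le k3
    linarith
  have c4 : inner ℝ p w' ≤ 1 := by
    have := real_inner_le_norm p w'
    rwa [hp, hw', mul_one] at this
  have c5 : inner ℝ p p' ≤ 1 := by
    have := real_inner_le_norm p p'
    rwa [hp, hp', mul_one] at this
  rw [tr_mul_tr, inner_self_unit hp, inner_self_unit hw, real_inner_comm w p, hwp,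
    real_inner_comm w' p', hwp', real_inner_comm w p', real_inner_comm p p']
  set A := inner ℝ p p'
  set B := inner ℝ w w'
  set C := inner ℝ p w'
  set E := inner ℝ w p'
  have c6 : μ ≤ A * C := by
    rcases le_total 0 A with hA | hA
    · rcases le_total 0 C with hC | hC
      · have := mul_nonneg hA hC; linarith
      · nlinarith
    · nlinarith
  -- The product of determinants equals -(E - μ A)(B - μ C) - (1 - μ²)(A C - μ), and both products
  -- are nonnegative.
  have c7 := mul_nonneg (sub_nonneg.2 c1) (sub_nonneg.2 c2)
  have c8 : 0 ≤ (1 - μ ^ 2) * (A * C - μ) := mul_nonneg (by nlinarith) (by linarith)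
  nlinarith

/-- A system of longest chords of the polar polygon: the chord `i` joins the foot `p i` on the
edge `i` with the opposite vertex `o i`. -/
structure ChordSystem (n : ℕ) (v : ℤ → E3) (μ : ℝ) (p : ℤ → E3) (o : ℤ → ℤ) : Prop where
  cycle : Cycle n v
  norm : ∀ i, ‖v i‖ = 1
  minCos : IsMinCos (dualCone v) μ
  nonpos : μ ≤ 0
  gt : -1 < μ
  foot_mem : ∀ i, p i ∈ dualCone v
  norm_foot : ∀ i, ‖p i‖ = 1
  inner_foot : ∀ i, inner ℝ (p i) (v i) = 0
  inner_chord : ∀ i, inner ℝ (ed v (o i)) (p i) = μ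
  eq : ∀ i, ed v (o i) = μ • p i + √(1 - μ ^ 2) • v i
  lt : ∀ i, i < o i
  lt' : ∀ i, o i < i + n - 1
  foot_per : ∀ i, p (i + n) = p i
  opp_per : ∀ i, o (i + n) = o i + n
  nondeg : μ < 0 ∨ μ = 0 ∧ ∀ i l, inner ℝ (p i) (v l) = 0 → v l = v i

lemma Cycle.ed_injOn {n : ℕ} {v : ℤ → E3} (h : Cycle n v) {i j l : ℤ} (hj : i < j)
    (hj' : j < i + n) (hl : i < l) (hl' : l < i + n) (e : ed v j = ed v l) : j = l := by
  rcases lt_trichotomy j l with hlt | rfl | hlt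
  · have := h.dual.pos3 hj hlt hl'
    rw [e, tr_self_right] at this
    exact absurd this (lt_irrefl _)
  · rfl
  · have := h.dual.pos3 hl hlt hj'
    rw [e, tr_self_right] at this
    exact absurd this (lt_irrefl _)

lemma Cycle.succ_ne {n : ℕ} {v : ℤ → E3} (h : Cycle n v) (i : ℤ) : v (i + 1) ≠ v i := by
  intro e
  have h3 := h.three
  have := h.pos i (i + 2) (by omega) (by omega)
  rw [e, tr_self_left] at this
  exact lt_irrefl _ this

lemma Cycle.exists_chordSystem {n : ℕ} {v : ℤ → E3} (h : Cycle n v) (hv : ∀ i, ‖v i‖ = 1)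
    (hred : IsReduced (body v)) {μ : ℝ} (hμ : IsMinCos (dualCone v) μ) (h1 : -1 < μ) :
    ∃ p o, ChordSystem n v μ p o := by
  have h0 := h.minCos_nonpos hv hred hμ
  have hσ : 0 < √(1 - μ ^ 2) := Real.sqrt_pos.2 (by nlinarith)
  have h3 := h.three
  have hfoot : ∀ i, ∃ p ∈ dualCone v, ∃ w ∈ dualCone v, ‖p‖ = 1 ∧ ‖w‖ = 1 ∧ inner ℝ p (v i) = 0 ∧
      inner ℝ w p = μ ∧ w = μ • p + √(1 - μ ^ 2) • v i ∧
      (μ < 0 ∨ μ = 0 ∧ ∀ l, inner ℝ p (v l) = 0 → v l = v i) := by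
    intro i
    obtain ⟨p, hp, w, hw, hpn, hwn, hpi, hwp, e⟩ := h.exists_foot hv hred hμ h0 h1 i
    rcases lt_or_eq_of_le h0 with hneg | hzero
    · exact ⟨p, hp, w, hw, hpn, hwn, hpi, hwp, e, Or.inl hneg⟩
    -- For μ = 0 the opposite end is `v i` itself and every point of the edge is a foot. The
    -- midpoint is chosen because it determines its edge.
    · have hne : ed v (i - 1) + ed v i ≠ 0 := by
        intro hz
        obtain ⟨c, hc, hcl⟩ := h.exists_edge_bound i
        rcases hcl (i + 1) with h4 | h4
        · exact h.succ_ne i h4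
        · rw [hz, inner_zero_left] at h4; linarith
      have hn : 0 < ‖ed v (i - 1) + ed v i‖⁻¹ := inv_pos.2 (norm_pos_iff.2 hne)
      have hwv : w = v i := by rw [e, hzero]; simp
      have hq : nrm (ed v (i - 1) + ed v i) = ‖ed v (i - 1) + ed v i‖⁻¹ • ed v (i - 1) +
          ‖ed v (i - 1) + ed v i‖⁻¹ • ed v i := by rw [nrm, smul_add]
      have hqi : inner ℝ (nrm (ed v (i - 1) + ed v i)) (v i) = 0 := by
        rw [nrm, real_inner_smul_left, inner_add_left, Cycle.inner_ed_pred, Cycle.inner_ed_self]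
        ring
      refine ⟨nrm (ed v (i - 1) + ed v i), ?_, w, hw, norm_nrm hne, hwn, hqi, ?_, ?_,
        Or.inr ⟨hzero, fun l hl => ?_⟩⟩
      · rw [hq]
        exact dualCone_add (dualCone_smul hn.le (h.ed_mem _)) (dualCone_smul hn.le (h.ed_mem _))
      · rw [hwv, real_inner_comm, hqi, hzero]
      · rw [hwv, hzero]; simp
      · rw [hq] at hl
        exact h.inner_edge_eq_zero hn hn hl
  choose p₀ hp w₀ hw hpn hwn hpi hwp e hnd using hfoot
  have hmod : ∀ i : ℤ, v (i % n) = v i := by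
    intro i
    have h4 := per_mul h.per (i % n) (i / n)
    rw [Int.emod_add_mul_ediv] at h4
    exact h4.symm
  have hvert : ∀ i : ℤ, ∃ j : ℤ, i < j ∧ j < i + n - 1 ∧ ed v j = w₀ (i % n) := by
    intro i
    obtain ⟨j, hj⟩ := h.exists_vertex_of_foot hv hμ h0 h1 (hp (i % n)) (hw _) (hpn _) (hwn _) (hpi _)
      (hwp _) hσ (e _)
    obtain ⟨l, h4, h5, h6⟩ := exists_rep (by omega) h.ed_per i j
    -- This inner product is positive, which rules out the two normals of the sides at `v i`. Hence
    -- the index of the opposite vertex lies strictly between i and i + n - 1.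
    have h7 : inner ℝ (ed v l) (v i) = √(1 - μ ^ 2) := by
      rw [h6, ← hj, ← hmod i, e (i % n), inner_add_left, real_inner_smul_left,
        real_inner_smul_left, hpi, inner_self_unit (hv _)]
      ring
    refine ⟨l, lt_of_le_of_ne h4 ?_, lt_of_le_of_ne (by omega) ?_, by rw [h6, hj]⟩
    · rintro rfl
      rw [Cycle.inner_ed_self] at h7
      linarith
    · rintro rfl
      have : ed v (i + n - 1) = ed v (i - 1) := by
        rw [← h.ed_per (i - 1)]; congr 1; ring
      rw [this, Cycle.inner_ed_pred] at h7
      linarith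
  choose o ho1 ho2 ho3 using hvert
  refine ⟨fun i => p₀ (i % n), o, h, hv, hμ, h0, h1, fun i => hp _, fun i => hpn _, ?_, ?_, ?_, ho1,
    ho2, ?_, ?_, ?_⟩
  · intro i
    rw [← hmod i]; exact hpi _
  · intro i
    rw [ho3]; exact hwp _
  · intro i
    rw [ho3, ← hmod i]; exact e _
  · intro i
    simp
  · intro i
    have h4 := ho1 (i + n)
    have h5 := ho2 (i + n)
    have h6 : ed v (o (i + n)) = ed v (o i + n) := by
      rw [ho3, h.ed_per, ho3]; simp
    exact h.ed_injOn (i := i + n) h4 (by omega) (by have := ho1 i; omega)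
      (by have := ho2 i; omega) h6
  · rcases lt_or_eq_of_le h0 with hneg | hzero
    · exact Or.inl hneg
    · right
      refine ⟨hzero, fun i l hl => ?_⟩
      rw [← hmod i]
      exact ((hnd (i % n)).resolve_left (by rw [hzero]; exact lt_irrefl _)).2 l hl

namespace ChordSystem

variable {n : ℕ} {v : ℤ → E3} {μ : ℝ} {p : ℤ → E3} {o : ℤ → ℤ}

lemma sigma_pos (h : ChordSystem n v μ p o) : 0 < √(1 - μ ^ 2) := by
  have := h.nonpos
  have := h.gt
  exact Real.sqrt_pos.2 (by nlinarith)

lemma cross (h : ChordSystem n v μ p o) (i j : ℤ) :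
    tr (p i) (ed v (o i)) (p j) * tr (p i) (ed v (o i)) (ed v (o j)) ≤ 0 := by
  refine cross_of_feet h.nonpos h.gt h.sigma_pos (h.norm_foot i) (h.norm_foot j) (h.cycle.norm_ed _)
    (h.cycle.norm_ed _) (h.inner_chord i) (h.inner_chord j) (h.eq i) (h.eq j) (h.foot_mem j i)
    (h.cycle.ed_mem _ i) (h.foot_mem i j) ?_
  have := h.minCos.le _ (h.foot_mem i) _ (h.foot_mem j)
  rwa [h.norm_foot, h.norm_foot, mul_one, mul_one] at this

/-- From ⟨x, y + z⟩ = 2μ ≥ μ ‖y + z‖ and μ < 0 one gets ‖y + z‖ ≥ 2, so the unit vectors y and z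
coincide. -/
lemma unique_partner (h : ChordSystem n v μ p o) (hneg : μ < 0) {x y z : E3}
    (hx : x ∈ dualCone v) (hy : y ∈ dualCone v) (hz : z ∈ dualCone v)
    (hxn : ‖x‖ = 1) (hyn : ‖y‖ = 1) (hzn : ‖z‖ = 1) (hxy : inner ℝ x y = μ)
    (hxz : inner ℝ x z = μ) : y = z := by
  have h1 := h.minCos.le x hx _ (dualCone_add hy hz)
  rw [inner_add_right, hxy, hxz, hxn, one_mul] at h1
  have h2 : 2 ≤ ‖y + z‖ := by nlinarith
  have h3 := norm_add_sq_real y z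
  have h4 := real_inner_le_norm y z
  rw [hyn, hzn] at h3 h4
  have h5 : inner ℝ y z = (1 : ℝ) := by nlinarith
  exact (inner_eq_one_iff_of_norm_eq_one (𝕜 := ℝ) hyn hzn).1 h5

/-- For μ < 0 the foot determines the other end, and both ends determine the direction `v i`. For μ
= 0 this is what the nondegeneracy condition on the feet is for. -/
lemma vertex_of_foot_eq (h : ChordSystem n v μ p o) {i j : ℤ} (e : p i = p j) : v i = v j := by
  rcases h.nondeg with hneg | ⟨_, hnd⟩
  · have h1 : ed v (o i) = ed v (o j) := h.unique_partner hneg (h.foot_mem i) (h.cycle.ed_mem _)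
      (h.cycle.ed_mem _) (h.norm_foot i) (h.cycle.norm_ed _) (h.cycle.norm_ed _)
      (by rw [real_inner_comm, h.inner_chord]) (by rw [e, real_inner_comm, h.inner_chord])
    rw [h.eq i, h.eq j, e] at h1
    exact smul_right_injective _ h.sigma_pos.ne' (add_left_cancel h1)
  · exact hnd j i (by rw [← e]; exact h.inner_foot i)

lemma vertex_of_opp_eq (h : ChordSystem n v μ p o) {i j : ℤ} (e : ed v (o i) = ed v (o j)) :
    v i = v j := by
  rcases h.nondeg with hneg | ⟨hzero, _⟩
  · apply h.vertex_of_foot_eq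
    exact h.unique_partner hneg (h.cycle.ed_mem (o i)) (h.foot_mem i)
      (h.foot_mem j) (h.cycle.norm_ed _) (h.norm_foot i) (h.norm_foot j) (h.inner_chord i)
      (by rw [e, h.inner_chord])
  · rw [h.eq i, h.eq j, hzero] at e
    simpa using e

lemma foot_ne_ed (h : ChordSystem n v μ p o) (hzero : ¬ μ < 0) (i m : ℤ) : p i ≠ ed v m := by
  intro e
  have hnd := (h.nondeg.resolve_left hzero).2 i
  rw [e] at hnd
  have h1 := hnd m (Cycle.inner_ed_self m)
  have h2 := hnd (m + 1) (Cycle.inner_ed_succ m)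
  exact h.cycle.succ_ne m (h2.trans h1.symm)

lemma opp_eq_of_foot_eq (h : ChordSystem n v μ p o) {i j : ℤ} (e : p j = ed v (o i)) :
    ed v (o j) = p i := by
  by_cases hneg : μ < 0
  · exact h.unique_partner hneg (h.foot_mem j) (h.cycle.ed_mem _) (h.foot_mem i) (h.norm_foot j)
      (h.cycle.norm_ed _) (h.norm_foot i) (by rw [real_inner_comm, h.inner_chord])
      (by rw [e, h.inner_chord])
  · exact absurd e (h.foot_ne_ed hneg _ _)

lemma foot_eq_of_opp_eq (h : ChordSystem n v μ p o) {i j : ℤ} (e : ed v (o j) = p i) :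
    p j = ed v (o i) := by
  by_cases hneg : μ < 0
  · exact h.unique_partner hneg (h.cycle.ed_mem (o j)) (h.foot_mem j) (h.cycle.ed_mem _)
      (h.cycle.norm_ed _) (h.norm_foot _) (h.cycle.norm_ed _) (h.inner_chord j)
      (by rw [e, real_inner_comm, h.inner_chord])
  · exact absurd e.symm (h.foot_ne_ed hneg _ _)

/-- A chord is not orthogonal to edges on different sides at its two end points. -/
lemma not_both_orthogonal (h : ChordSystem n v μ p o) {i j : ℤ} (e : p j = ed v (o i))
    (e' : ed v (o j) = p i) {N q q' : E3} (hNx : inner ℝ N (p i) = 0)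
    (hNy : inner ℝ N (p j) = 0)
    (hq : q ∈ dualCone v) (hqi : inner ℝ q (v i) = 0) (hqN : 0 < inner ℝ q N)
    (hq' : q' ∈ dualCone v) (hqj : inner ℝ q' (v j) = 0) (hqN' : inner ℝ q' N < 0) : False := by
  -- The great circle of edge i is spanned by `p i` and N. A point q of the edge on the side of N
  -- therefore allows `p i` to move a little along N within the cone.
  have key : ∀ (i j : ℤ), p j = ed v (o i) → ∀ N q : E3, inner ℝ N (p i) = 0 →
      inner ℝ N (p j) = 0 → q ∈ dualCone v → inner ℝ q (v i) = 0 → 0 < inner ℝ q N →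
      ∃ t₀ > 0, ∀ t : ℝ, 0 ≤ t → t ≤ t₀ → p i + t • N ∈ dualCone v := by
    intro i j e N q hNx hNy hq hqi hqN
    have hN0 : N ≠ 0 := by rintro rfl; simp at hqN
    have hNN : 0 < inner ℝ N N := real_inner_self_pos.2 hN0
    have hNv : inner ℝ N (v i) = 0 := by
      have h1 := hNy
      rw [e, h.eq, inner_add_right, real_inner_smul_right, real_inner_smul_right, hNx, mul_zero,
        zero_add, mul_eq_zero] at h1
      exact h1.resolve_left h.sigma_pos.ne'
    set α := inner ℝ q (p i) with hα
    set β := inner ℝ q N / inner ℝ N N with hβ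
    have hβpos : 0 < β := div_pos hqN hNN
    have hqe : q = α • p i + β • N := by
      have hT : inner ℝ N (cr (p i) (v i)) ≠ (0 : ℝ) := by
        intro hT
        have : N = 0 := by
          have h2 : tr (p i) (v i) (cr (p i) (v i)) ≠ 0 := by
            rw [tr, inner_cr_cr, inner_self_unit (h.norm_foot i), inner_self_unit (h.norm i),
              h.inner_foot, zero_mul, mul_one, sub_zero]
            exact one_ne_zero
          apply eq_zero_of_inner h2 <;> rw [real_inner_comm]
          · exact hNx
          · exact hNv
          · exact hT
        exact hN0 this
      rw [← sub_eq_zero]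
      have hT' : tr (p i) (v i) N ≠ 0 := by rwa [tr, real_inner_comm]
      apply eq_zero_of_inner hT' <;> rw [real_inner_comm] <;>
        simp only [inner_sub_left, inner_add_left, real_inner_smul_left]
      · rw [inner_self_unit (h.norm_foot i), hNx]; ring
      · rw [hqi, h.inner_foot, hNv]; ring
      · rw [real_inner_comm, real_inner_comm N (p i), hNx, hβ]
        rw [real_inner_comm N q]
        field_simp
        ring
    refine ⟨β / (|α| + 1), by positivity, fun t ht ht' => ?_⟩
    have h2 : t * α ≤ β := by
      rw [le_div_iff₀ (by positivity)] at ht'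
      have := mul_le_mul_of_nonneg_left (le_abs_self α) ht
      linarith
    have h3 : p i + t • N = ((β - t * α) / β) • p i + (t / β) • q := by
      conv_rhs => rw [hqe]
      rw [smul_add, smul_smul, smul_smul, ← add_assoc, ← add_smul]
      congr 1
      · rw [show (β - t * α) / β + t / β * α = 1 by field_simp; ring, one_smul]
      · rw [div_mul_cancel₀ _ hβpos.ne']
    rw [h3]
    exact dualCone_add (dualCone_smul (div_nonneg (by linarith) hβpos.le) (h.foot_mem i))
      (dualCone_smul (div_nonneg ht hβpos.le) hq)
  obtain ⟨t₁, ht₁, k1⟩ := key i j e N q hNx hNy hq hqi hqN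
  obtain ⟨t₂, ht₂, k2⟩ := key j i e'.symm (-N) q' (by simp [hNy]) (by simp [hNx]) hq' hqj
    (by simpa using hqN')
  have hpos : 0 < min t₁ t₂ := lt_min ht₁ ht₂
  have := h.minCos.no_shear h.gt hpos (k1 _ hpos.le (min_le_left _ _))
    (k2 _ hpos.le (min_le_right _ _)) (h.norm_foot i) (h.norm_foot j)
    (by rw [e, real_inner_comm, h.inner_chord]) hNx hNy
  rw [this, inner_zero_right] at hqN
  exact lt_irrefl _ hqN

lemma edge_rep (h : ChordSystem n v μ p o) (i : ℤ) :
    ∃ a b : ℝ, 0 ≤ a ∧ 0 ≤ b ∧ p i = a • ed v (i - 1) + b • ed v i :=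
  h.cycle.edge_rep (h.foot_mem i) (h.inner_foot i)

lemma tr_chord (i : ℤ) {a b : ℝ} (e : p i = a • ed v (i - 1) + b • ed v i) (x : E3) :
    tr (p i) (ed v (o i)) x =
      a * tr (ed v (i - 1)) (ed v (o i)) x + b * tr (ed v i) (ed v (o i)) x := by
  rw [e, tr_add_left, tr_smul_left, tr_smul_left]

lemma coeff_pos (h : ChordSystem n v μ p o) {i : ℤ} {a b : ℝ} (ha : 0 ≤ a) (hb : 0 ≤ b)
    (e : p i = a • ed v (i - 1) + b • ed v i) : 0 < a ∨ 0 < b := by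
  by_contra hc
  push Not at hc
  rw [le_antisymm hc.1 ha, le_antisymm hc.2 hb] at e
  have := h.norm_foot i
  rw [e] at this
  simp at this

/-- The foot is a nonnegative combination of `ed v (i - 1)` and `ed v i`, so convexity of the polar
cycle tells on which side of the chord a vertex lies: here the negative side, and in `tr_pos` the
positive one. -/
lemma tr_neg (h : ChordSystem n v μ p o) {i l : ℤ} (h1 : i < l) (h2 : l < o i) :
    tr (p i) (ed v (o i)) (ed v l) < 0 := by
  obtain ⟨a, b, ha, hb, e⟩ := h.edge_rep i
  have h3 := h.lt' i
  have k1 := h.cycle.dual.pos3 (i := i - 1) (j := l) (l := o i) (by omega) h2 (by omega)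
  have k2 := h.cycle.dual.pos3 h1 h2 (by omega)
  rw [tr_chord i e, tr_swap_right, tr_swap_right (ed v i)]
  rcases h.coeff_pos ha hb e with h4 | h4 <;> nlinarith [mul_nonneg ha k1.le, mul_nonneg hb k2.le,
    mul_pos h4 k1, mul_pos h4 k2]

lemma tr_pos (h : ChordSystem n v μ p o) {i l : ℤ} (h1 : o i < l) (h2 : l < i + n - 1) :
    0 < tr (p i) (ed v (o i)) (ed v l) := by
  obtain ⟨a, b, ha, hb, e⟩ := h.edge_rep i
  have h3 := h.lt i
  have k1 := h.cycle.dual.pos3 (i := i - 1) (j := o i) (l := l) (by omega) h1 (by omega)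
  have k2 := h.cycle.dual.pos3 h3 h1 (by omega)
  rw [tr_chord i e]
  rcases h.coeff_pos ha hb e with h4 | h4 <;> nlinarith [mul_nonneg ha k1.le, mul_nonneg hb k2.le,
    mul_pos h4 k1, mul_pos h4 k2]

lemma tr_self_neg (h : ChordSystem n v μ p o) (i : ℤ) :
    tr (p i) (ed v (o i)) (ed v i) < 0 ∨
      tr (p i) (ed v (o i)) (ed v i) = 0 ∧ p i = ed v i := by
  obtain ⟨a, b, ha, hb, e⟩ := h.edge_rep i
  have h3 := h.lt i
  have h4 := h.lt' i
  have k1 := h.cycle.dual.pos3 (i := i - 1) (j := i) (l := o i) (by omega) h3 (by omega)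
  rw [tr_chord i e, tr_swap_right, tr_self_mid]
  rcases eq_or_lt_of_le ha with h5 | h5
  · right
    rw [← h5] at e ⊢
    exact ⟨by ring, h.cycle.eq_ed_of_smul hb (h.norm_foot i) (by rw [e]; simp)⟩
  · left
    nlinarith [mul_pos h5 k1]

lemma tr_pred_pos (h : ChordSystem n v μ p o) (i : ℤ) :
    0 < tr (p i) (ed v (o i)) (ed v (i - 1)) ∨
      tr (p i) (ed v (o i)) (ed v (i - 1)) = 0 ∧ p i = ed v (i - 1) := by
  obtain ⟨a, b, ha, hb, e⟩ := h.edge_rep i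
  have h3 := h.lt i
  have h4 := h.lt' i
  have k1 := h.cycle.dual.pos3 (i := i - 1) (j := i) (l := o i) (by omega) h3 (by omega)
  rw [tr_chord i e, tr_self_mid, ← tr_rotate]
  rcases eq_or_lt_of_le hb with h5 | h5
  · right
    rw [← h5] at e ⊢
    exact ⟨by ring, h.cycle.eq_ed_of_smul ha (h.norm_foot i) (by rw [e]; simp)⟩
  · left
    nlinarith [mul_pos h5 k1]

/-- Otherwise chord i + 1 either shares its opposite vertex with chord i, which would identify `v i`
and `v (i + 1)`, or lies strictly on one side of it, against `cross`. -/
lemma opp_lt_succ (h : ChordSystem n v μ p o) (i : ℤ) : o i < o (i + 1) := by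
  by_contra hle
  push Not at hle
  rcases eq_or_lt_of_le hle with heq | hlt
  · exact h.cycle.succ_ne i (h.vertex_of_opp_eq (by rw [heq]))
  have h1 := h.lt (i + 1)
  have n1 : tr (p i) (ed v (o i)) (ed v (o (i + 1))) < 0 := h.tr_neg (by omega) hlt
  have n2 : tr (p i) (ed v (o i)) (ed v (i + 1)) < 0 := h.tr_neg (by omega) (by omega)
  have n3 : tr (p i) (ed v (o i)) (p (i + 1)) < 0 := by
    obtain ⟨a, b, ha, hb, e⟩ := h.edge_rep (i + 1)
    have hab := h.coeff_pos ha hb e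
    rw [add_sub_cancel_right] at e
    rw [e, tr_add_right, tr_smul_right, tr_smul_right]
    rcases eq_or_lt_of_le hb with hb0 | hb0
    · have ha0 : 0 < a := hab.resolve_right (by rw [← hb0]; exact lt_irrefl _)
      rcases h.tr_self_neg i with n4 | ⟨_, n4⟩
      · rw [← hb0]; nlinarith
      · exfalso
        have : p (i + 1) = ed v i :=
          h.cycle.eq_ed_of_smul ha (h.norm_foot _) (by rw [e, ← hb0]; simp)
        exact h.cycle.succ_ne i (h.vertex_of_foot_eq (this.trans n4.symm))
    · have n4 : tr (p i) (ed v (o i)) (ed v i) ≤ 0 := by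
        rcases h.tr_self_neg i with n4 | ⟨n4, _⟩
        · exact n4.le
        · exact n4.le
      nlinarith [mul_pos_of_neg_of_neg n2 (neg_lt_zero.2 hb0),
        mul_nonneg_of_nonpos_of_nonpos n4 (neg_nonpos.2 ha)]
  have := h.cross i (i + 1)
  have := mul_pos_of_neg_of_neg n3 n1
  linarith

/-- By `opp_lt_succ` the difference o i - i is nondecreasing. It is also periodic, hence constant.
-/
lemma exists_shift (h : ChordSystem n v μ p o) : ∃ c : ℤ, 0 < c ∧ c < n - 1 ∧ ∀ i, o i = i + c := by
  have hmono : ∀ i, ∀ m : ℕ, o i - i ≤ o (i + m) - (i + m) := by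
    intro i m
    induction m with
    | zero => simp
    | succ m ih =>
      have := h.opp_lt_succ (i + m)
      push_cast
      rw [← add_assoc]
      omega
  have hle : ∀ i j, o i - i ≤ o j - j := by
    intro i j
    have hper : ∀ m : ℤ, o (j + n * m) - (j + n * m) = o j - j := by
      have : ∀ i, o (i + n) - (i + n) = o i - i := fun i => by rw [h.opp_per]; ring
      intro m
      exact per_mul (f := fun i => o i - i) this j m
    have h3 := h.cycle.three
    have hle' : i ≤ j + n * |i - j| := by
      have := abs_nonneg (i - j)
      have := le_abs_self (i - j)
      nlinarith
    have h4 := hmono i (j + n * |i - j| - i).toNat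
    rw [Int.toNat_of_nonneg (by omega), add_sub_cancel, hper] at h4
    exact h4
  refine ⟨o 0, by have := h.lt 0; omega, by have := h.lt' 0; omega, fun i => ?_⟩
  have := hle i 0
  have := hle 0 i
  omega

/-- The vertex opposite to an edge splits the remaining edges into halves. -/
lemma exists_half (h : ChordSystem n v μ p o) :
    ∃ c : ℕ, n = 2 * c + 1 ∧ ∀ i, o i = i + c := by
  obtain ⟨c, hc, hcn, ho⟩ := h.exists_shift
  have h3 := h.cycle.three
  have hpos0 : ∀ l : ℤ, 0 < l → l < n - 1 → p 0 ≠ ed v l := by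
    intro l h1 h2 e
    have h4 := h.inner_foot 0
    have h5 := h.cycle.per 0
    rw [e, ← h5] at h4
    exact (h.cycle.inner_ed_pos (by omega) (by omega)).ne' h4
  have hN1 : inner ℝ (cr (p 0) (ed v (o 0))) (p 0) = 0 := inner_cr_left _ _
  have hN2 : inner ℝ (cr (p 0) (ed v (o 0))) (ed v (o 0)) = 0 := inner_cr_right _ _
  -- If 2c ≥ n, then chord c has its foot and its opposite vertex 2c - n weakly on the same side of
  -- chord 0. As the chords cross, this is only possible if they are the same chord, reversed.
  have upper : 2 * c ≤ n - 1 := by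
    by_contra hgt
    push Not at hgt
    have hl : ed v (o c) = ed v (2 * c - n) := by
      rw [ho, ← h.cycle.ed_per (2 * c - n)]; congr 1; ring
    obtain ⟨a, b, ha, hb, e⟩ := h.edge_rep c
    have s1 : tr (p 0) (ed v (o 0)) (ed v (c - 1)) < 0 :=
      h.tr_neg (by omega) (by rw [ho]; omega)
    have s2 : tr (p 0) (ed v (o 0)) (p c) = a * tr (p 0) (ed v (o 0)) (ed v (c - 1)) := by
      rw [e, tr_add_right, tr_smul_right, tr_smul_right, ho 0, zero_add, tr_self_right (p 0)]
      ring
    have main : p c = ed v (o 0) ∧ ed v (o c) = p 0 := by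
      rcases eq_or_lt_of_le ha with ha0 | ha0
      · have e1 : p c = ed v (o 0) := by
          rw [ho, zero_add]
          exact h.cycle.eq_ed_of_smul hb (h.norm_foot c) (by rw [e, ← ha0]; simp)
        exact ⟨e1, h.opp_eq_of_foot_eq e1⟩
      · have s3 : tr (p 0) (ed v (o 0)) (p c) < 0 := by rw [s2]; nlinarith
        have s4 := h.cross 0 c
        have s5 : ¬ tr (p 0) (ed v (o 0)) (ed v (2 * c - n)) < 0 := by
          intro s6
          rw [hl] at s4
          have := mul_pos_of_neg_of_neg s3 s6
          linarith
        rcases eq_or_lt_of_le (show 0 ≤ 2 * c - n by omega) with hl0 | hl0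
        · rw [← hl0] at hl s5
          rcases h.tr_self_neg 0 with s6 | ⟨_, s6⟩
          · exact absurd s6 s5
          · have e1 : ed v (o c) = p 0 := by rw [hl, s6]
            exact ⟨h.foot_eq_of_opp_eq e1, e1⟩
        · exact absurd (h.tr_neg hl0 (by rw [ho]; omega)) s5
    have hl0 : 2 * c - n = 0 := by
      by_contra hne
      refine hpos0 (2 * c - n) (by omega) (by omega) ?_
      rw [← main.2, hl]
    -- Both ends are now vertices, and the two edges orthogonal to the chord leave it on different
    -- sides, which `not_both_orthogonal` forbids.
    have e0 : p 0 = ed v 0 := by rw [← main.2, hl, hl0]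
    refine h.not_both_orthogonal (i := 0) (j := c) main.1 main.2
      (N := cr (p 0) (ed v (o 0))) (q := ed v (0 - 1)) (q' := ed v (c - 1)) hN1
      (by rw [main.1]; exact hN2) (h.cycle.ed_mem _) (Cycle.inner_ed_pred 0) ?_ (h.cycle.ed_mem _)
      (Cycle.inner_ed_pred c) ?_
    · rw [real_inner_comm]
      rcases h.tr_pred_pos 0 with s6 | ⟨_, s6⟩
      · exact s6
      · exfalso
        have := h.cycle.dual.succ_ne (-1)
        rw [e0] at s6
        exact this s6
    · rw [real_inner_comm]
      exact s1
  -- The mirror image of the previous argument, comparing chord 0 with chord c + 1.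
  have lower : (n : ℤ) ≤ 2 * c + 1 := by
    by_contra hgt
    push Not at hgt
    have hl : ed v (o (c + 1)) = ed v (2 * c + 1) := by
      rw [ho]; congr 1; ring
    obtain ⟨a, b, ha, hb, e⟩ := h.edge_rep (c + 1)
    rw [add_sub_cancel_right] at e
    have s1 : 0 < tr (p 0) (ed v (o 0)) (ed v (c + 1)) :=
      h.tr_pos (by rw [ho]; omega) (by omega)
    have s2 : tr (p 0) (ed v (o 0)) (p (c + 1)) = b * tr (p 0) (ed v (o 0)) (ed v (c + 1)) := by
      rw [e, tr_add_right, tr_smul_right, tr_smul_right, ho 0, zero_add, tr_self_right (p 0)]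
      ring
    have hn1 : ed v (n - 1) = ed v (0 - 1) := by
      rw [← h.cycle.ed_per (0 - 1)]; rfl
    have main : p (c + 1) = ed v (o 0) ∧ ed v (o (c + 1)) = p 0 := by
      rcases eq_or_lt_of_le hb with hb0 | hb0
      · have e1 : p (c + 1) = ed v (o 0) := by
          rw [ho, zero_add]
          exact h.cycle.eq_ed_of_smul ha (h.norm_foot _) (by rw [e, ← hb0]; simp)
        exact ⟨e1, h.opp_eq_of_foot_eq e1⟩
      · have s3 : 0 < tr (p 0) (ed v (o 0)) (p (c + 1)) := by rw [s2]; positivity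
        have s4 := h.cross 0 (c + 1)
        have s5 : ¬ 0 < tr (p 0) (ed v (o 0)) (ed v (2 * c + 1)) := by
          intro s6
          rw [hl] at s4
          have := mul_pos s3 s6
          linarith
        rcases eq_or_lt_of_le (show 2 * c + 1 ≤ n - 1 by omega) with hl0 | hl0
        · rw [hl0, hn1] at hl s5
          rcases h.tr_pred_pos 0 with s6 | ⟨_, s6⟩
          · exact absurd s6 s5
          · have e1 : ed v (o (c + 1)) = p 0 := by rw [hl, s6]
            exact ⟨h.foot_eq_of_opp_eq e1, e1⟩
        · exact absurd (h.tr_pos (i := 0) (by rw [ho]; omega) (by omega)) s5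
    have hl0 : 2 * c + 1 = n - 1 := by
      by_contra hne
      refine hpos0 (2 * c + 1) (by omega) (by omega) ?_
      rw [← main.2, hl]
    have e0 : p 0 = ed v (0 - 1) := by rw [← main.2, hl, hl0, hn1]
    refine h.not_both_orthogonal (i := 0) (j := c + 1) main.1 main.2
      (N := -cr (p 0) (ed v (o 0))) (q := ed v 0) (q' := ed v (c + 1))
      (by rw [inner_neg_left, hN1, neg_zero])
      (by rw [main.1, inner_neg_left, hN2, neg_zero]) (h.cycle.ed_mem _) (Cycle.inner_ed_self 0) ?_
      (h.cycle.ed_mem _) (Cycle.inner_ed_self _) ?_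
    · rw [inner_neg_right, real_inner_comm]
      rcases h.tr_self_neg 0 with s6 | ⟨_, s6⟩
      · exact neg_pos.2 s6
      · exfalso
        have := h.cycle.dual.succ_ne (-1)
        rw [e0] at s6
        exact this s6.symm
    · rw [inner_neg_right, real_inner_comm]
      exact neg_lt_zero.2 s1
  refine ⟨c.toNat, by omega, fun i => ?_⟩
  rw [ho, Int.toNat_of_nonneg hc.le]

end ChordSystem

/-! ### The lower bound for the perimeter of the polar polygon. -/

lemma mul_arctan_lt {s t : ℝ} (hs : 0 < s) (hs1 : s < 1) (ht : 0 < t) :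
    s * Real.arctan t < Real.arctan (s * t) := by
  have hd : ∀ x : ℝ, HasDerivAt (fun x => Real.arctan (s * x) - s * Real.arctan x)
      (1 / (1 + (s * x) ^ 2) * (s * 1) - s * (1 / (1 + x ^ 2))) x := fun x =>
    (((hasDerivAt_id x).const_mul s).arctan).sub ((Real.hasDerivAt_arctan x).const_mul s)
  have hm : StrictMonoOn (fun x => Real.arctan (s * x) - s * Real.arctan x) (Set.Ici 0) := by
    apply strictMonoOn_of_deriv_pos (convex_Ici 0)
    · exact fun x _ => (hd x).continuousAt.continuousWithinAt
    · intro x hx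
      rw [interior_Ici] at hx
      have hx : 0 < x := hx
      rw [(hd x).deriv]
      have h1 : (s * x) ^ 2 < x ^ 2 := by
        rw [mul_pow]
        have : s ^ 2 < 1 := by nlinarith
        have : 0 < x ^ 2 := by positivity
        nlinarith
      have h2 : 1 / (1 + x ^ 2) < 1 / (1 + (s * x) ^ 2) :=
        one_div_lt_one_div_of_lt (by positivity) (by linarith)
      nlinarith
  have := hm (Set.mem_Ici.2 le_rfl) (Set.mem_Ici.2 ht.le) ht
  simp only [mul_zero, Real.arctan_zero, sub_zero] at this
  linarith

lemma arccos_eq_two_mul_arctan {x : ℝ} (h0 : -1 < x) (h1 : x ≤ 1) :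
    Real.arccos x = 2 * Real.arctan √((1 - x) / (1 + x)) := by
  set t := Real.arctan √((1 - x) / (1 + x)) with ht
  have hq : 0 ≤ (1 - x) / (1 + x) := div_nonneg (by linarith) (by linarith)
  have h2 : 0 ≤ t := Real.arctan_nonneg.2 (Real.sqrt_nonneg _)
  have h3 : t < Real.pi / 2 := Real.arctan_lt_pi_div_two _
  have h4 : Real.cos (2 * t) = x := by
    rw [Real.cos_two_mul, Real.cos_sq_arctan, Real.sq_sqrt hq]
    have : 1 + x ≠ 0 := by linarith
    field_simp
    ring
  rw [← h4, Real.arccos_cos (by linarith) (by linarith)]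

/-- The hypothesis compares the squared tangents of half the angles, so the claim reduces to s
arctan t < arctan (s t), an effect of the strict concavity of arctan. -/
lemma mul_arccos_lt {s x y : ℝ} (hs : 0 < s) (hs1 : s < 1) (hx : -1 < x) (hx1 : x ≤ 1)
    (hy : -1 < y) (hy1 : y < 1) (h : s ^ 2 * ((1 - x) / (1 + x)) ≤ (1 - y) / (1 + y)) :
    s * Real.arccos x < Real.arccos y := by
  rcases eq_or_lt_of_le hx1 with rfl | hx1
  · rw [Real.arccos_one, mul_zero]
    exact Real.arccos_pos.2 hy1
  rw [arccos_eq_two_mul_arctan hx hx1.le, arccos_eq_two_mul_arctan hy hy1.le]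
  have ht : 0 < √((1 - x) / (1 + x)) := Real.sqrt_pos.2 (div_pos (by linarith) (by linarith))
  have h2 := mul_arctan_lt hs hs1 ht
  have h3 : s * √((1 - x) / (1 + x)) ≤ √((1 - y) / (1 + y)) := by
    apply Real.le_sqrt_of_sq_le
    rwa [mul_pow, Real.sq_sqrt (div_nonneg (by linarith) (by linarith))]
  have h4 := Real.arctan_strictMono.monotone h3
  linarith

lemma sum_range_eq_sum_zmod {n : ℕ} [NeZero n] (f : ℤ → ℝ) :
    ∑ i ∈ Finset.range n, f i = ∑ z : ZMod n, f z.val := by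
  refine Finset.sum_nbij' (fun i => (i : ZMod n)) (fun z => z.val) (by simp)
    (fun z _ => Finset.mem_range.2 (ZMod.val_lt z)) ?_ (by simp) ?_
  · intro i hi
    exact ZMod.val_cast_of_lt (Finset.mem_range.1 hi)
  · intro i hi
    rw [ZMod.val_cast_of_lt (Finset.mem_range.1 hi)]

/-- Sums over a period can be reindexed by affine bijections modulo the period. -/
lemma sum_range_affine {n : ℕ} (hn : 0 < n) {f : ℤ → ℝ} (hf : ∀ i, f (i + n) = f i) {m m' q : ℤ}
    (hm : m * m' = 1 + n * q) (a : ℤ) :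
    ∑ i ∈ Finset.range n, f (m * i + a) = ∑ i ∈ Finset.range n, f i := by
  have : NeZero n := ⟨hn.ne'⟩
  rw [sum_range_eq_sum_zmod f, sum_range_eq_sum_zmod fun i => f (m * i + a)]
  have hval : ∀ i : ℤ, f ((i : ZMod n).val) = f i := by
    intro i
    rw [ZMod.val_intCast, ← per_mul hf (i % n) (i / n), Int.emod_add_mul_ediv]
  have hmm : (m : ZMod n) * (m' : ZMod n) = 1 := by
    have := congrArg (Int.cast : ℤ → ZMod n) hm
    push_cast at this
    rw [this]; simp
  refine Finset.sum_nbij' (fun z => (m : ZMod n) * z + a) (fun z => (m' : ZMod n) * (z - a))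
    (by simp) (by simp) ?_ ?_ ?_
  · intro z _
    linear_combination z * hmm
  · intro z _
    linear_combination (z - a) * hmm
  · intro z _
    rw [← hval]; congr 2; push_cast; simp

lemma sum_range_shift {n : ℕ} (hn : 0 < n) {f : ℤ → ℝ} (hf : ∀ i, f (i + n) = f i) (a : ℤ) :
    ∑ i ∈ Finset.range n, f (i + a) = ∑ i ∈ Finset.range n, f i := by
  have := sum_range_affine hn hf (m := 1) (m' := 1) (q := 0) (by ring) a
  simpa only [one_mul] using this

/-- A closed chain of directions that returns reversed has total turning at least `π`. -/
lemma pi_le_sum_angle {c : ℕ} {q : ℤ → E3} (hq : ∀ i, q (i + (2 * c + 1 : ℕ)) = q i)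
    (h0 : q 0 ≠ 0) :
    Real.pi ≤ ∑ i ∈ Finset.range (2 * c + 1), angle (q i) (-q (i + c + 1)) := by
  set f : ℤ → ℝ := fun i => angle (q i) (-q (i + c + 1)) with hf
  have hper : ∀ i, f (i + (2 * c + 1 : ℕ)) = f i := by
    intro i
    simp only [hf]
    rw [hq, ← hq (i + c + 1)]
    congr 3; ring
  -- Since 2 (c + 1) = 1 + (2c + 1), steps of length c + 1 visit every index once modulo 2c + 1.
  -- With one change of sign per step, an odd number of steps ends at the opposite of the starting
  -- vector, and the triangle inequality for angles applies.
  have h1 := sum_range_affine (n := 2 * c + 1) (by omega) hper (m := c + 1) (m' := 2) (q := 1)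
    (by push_cast; ring) 0
  set x : ℕ → E3 := fun t => (-1 : ℝ) ^ t • q ((c + 1) * t + 0) with hx
  have h2 : ∀ t, angle (x t) (x (t + 1)) = f ((c + 1) * t + 0) := by
    intro t
    have e : q ((c + 1) * (t + 1 : ℕ) + 0) = q ((c + 1) * t + 0 + c + 1) := by
      congr 1
    simp only [hx, hf]
    rw [e, pow_succ]
    rcases neg_one_pow_eq_or ℝ t with h | h <;> rw [h]
    · simp
    · rw [← angle_neg_neg]; simp
  have h3 : ∀ m : ℕ, angle (x 0) (x m) ≤ ∑ t ∈ Finset.range m, f ((c + 1) * t + 0) ∨ m = 0 := by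
    intro m
    induction m with
    | zero => right; rfl
    | succ m ih =>
      left
      rw [Finset.sum_range_succ, ← h2]
      rcases ih with ih | rfl
      · linarith [angle_le_angle_add_angle (x 0) (x m) (x (m + 1))]
      · simp
  have h4 := (h3 (2 * c + 1)).resolve_right (by omega)
  rw [h1] at h4
  have h5 : x (2 * c + 1) = -x 0 := by
    simp only [hx]
    rw [Odd.neg_one_pow ⟨c, rfl⟩]
    have := per_mul hq ((c + 1) * (0 : ℕ) + 0) (c + 1)
    rw [pow_zero, one_smul, neg_smul, one_smul, ← this]
    congr 2; push_cast; ring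
  have h6 : x 0 ≠ 0 := by simpa [hx] using h0
  rw [h5, angle_self_neg_of_nonzero h6] at h4
  exact h4

lemma angle_split {x y z : E3} (hy : y ≠ 0) {a b : ℝ} (ha : 0 ≤ a) (hb : 0 ≤ b)
    (e : y = a • x + b • z) : angle x z = angle x y + angle y z := by
  apply angle_eq_angle_add_add_angle_add_of_mem_span hy
  rw [Submodule.mem_span_pair]
  exact ⟨⟨a, ha⟩, ⟨b, hb⟩, e.symm⟩

/-- The relation between the angle `arccos g` at the boundary and the angle `arccos t` of two
consecutive longest chords. -/
lemma half_angle_bound {μ g u : ℝ} (h0 : μ < 0) (h1 : -1 < μ) (hg : g ≤ 1) (hu : μ ≤ u)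
    (hgu : μ * u ≤ g) (hug : μ * g < 1)
    (hrel : (u * (1 + μ * g) + 1 - g * μ - μ ^ 2 - g ^ 2) *
      ((u - g * μ) * (1 - μ * g) - (1 - μ ^ 2) * (1 - g ^ 2)) = 0) (hg1 : -1 < g) :
    g * g - u * (μ * g) = (1 - μ ^ 2) * (g * (g - μ) / (1 - μ * g)) := by
  -- For given g the relation leaves two values of u. The one from the first factor violates μ u ≤ g
  -- or μ ≤ u, according to whether g < -μ or not; for g = 1 the two values agree.
  have hF : (u - g * μ) * (1 - μ * g) = (1 - μ ^ 2) * (1 - g ^ 2) := by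
    rcases eq_or_lt_of_le hg with rfl | hg
    · rcases mul_eq_zero.1 hrel with h | h
      · have : (1 + μ) * (u - μ) = 0 := by linear_combination h
        have h2 : u = μ := by
          rcases mul_eq_zero.1 this with h3 | h3 <;> linarith
        rw [h2]; ring
      · linarith
    · rcases mul_eq_zero.1 hrel with h | h
      · exfalso
        have k1 : 0 < 1 + μ * g := by nlinarith
        rcases lt_or_ge g (-μ) with hlt | hge
        · have k2 : 0 < (1 - μ ^ 2) * (-μ - g) := mul_pos (by nlinarith) (by linarith)
          have k3 : 0 ≤ (g - μ * u) * (1 + μ * g) := mul_nonneg (by linarith) k1.le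
          nlinarith
        · have k2 : 0 < (1 - g) * (1 + g + μ - μ ^ 2) := mul_pos (by linarith) (by nlinarith)
          have k3 : 0 ≤ (u - μ) * (1 + μ * g) := mul_nonneg (by linarith) k1.le
          nlinarith
      · linarith
  have k : 1 - μ * g ≠ 0 := by linarith
  rw [mul_div_assoc', eq_div_iff k]
  linear_combination (-μ * g) * hF

namespace ChordSystem

variable {n : ℕ} {v : ℤ → E3} {μ : ℝ} {p : ℤ → E3} {o : ℤ → ℤ}

/-- Compares half-edges of the polar polygon with the angles between the chords i and i + c + 1.
These chords join the neighboring edges i and i + c + 1 to the vertices i + c and i crosswise. -/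
lemma half_perimeter (h : ChordSystem n v μ p o) {c : ℕ} (hn : n = 2 * c + 1)
    (ho : ∀ i, o i = i + c) (hneg : μ < 0) :
    2 * Real.pi * √((1 - μ) / 2) <
      ∑ i ∈ Finset.range n, angle (ed v ((i : ℤ) - 1)) (ed v i) := by
  have hc := h.cycle
  have h1 := h.gt
  have hσ := h.sigma_pos
  have hσ2 : √(1 - μ ^ 2) ^ 2 = 1 - μ ^ 2 := Real.sq_sqrt (by nlinarith)
  have hw : ∀ i, ed v (i + c) = μ • p i + √(1 - μ ^ 2) • v i := fun i => by rw [← ho, h.eq]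
  have hk : ∀ i, ed v i = μ • p (i + c + 1) + √(1 - μ ^ 2) • v (i + c + 1) := fun i => by
    rw [← hw, ← hc.ed_per, hn]; congr 1; push_cast; ring
  have hwp : ∀ i, inner ℝ (ed v (i + c)) (p i) = μ := fun i => by rw [← ho, h.inner_chord]
  have hkp : ∀ i, inner ℝ (ed v i) (p (i + c + 1)) = μ := fun i => by
    rw [← hwp (i + c + 1), ← hc.ed_per, hn]; congr 2; push_cast; ring
  have hkw : ∀ i, inner ℝ (ed v i) (ed v (i + c)) = μ * inner ℝ (ed v i) (p i) := fun i => by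
    rw [hw, inner_add_right, real_inner_smul_right, real_inner_smul_right, Cycle.inner_ed_self]
    ring
  -- Expanding ⟨ed v i, ed v (i + c)⟩ along either chord gives μ times the cosine of a half-edge.
  -- Cancelling μ shows that the two half-edges are equal, which is why μ = 0 needs another proof.
  have hwp' : ∀ i, inner ℝ (ed v (i + c)) (p (i + c + 1)) = inner ℝ (ed v i) (p i) := fun i => by
    have h2 := hkw i
    rw [hk i, inner_add_left, real_inner_smul_left, real_inner_smul_left, ← hk i,
      real_inner_comm _ (v _), Cycle.inner_ed_succ, mul_zero, add_zero,
      real_inner_comm (ed v (i + c))] at h2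
    exact mul_left_cancel₀ hneg.ne h2
  have hle1 : ∀ x y : E3, ‖x‖ = 1 → ‖y‖ = 1 → inner ℝ x y ≤ 1 := fun x y hx hy => by
    have := real_inner_le_norm x y
    rwa [hx, hy, mul_one] at this
  have hmin : ∀ x ∈ dualCone v, ∀ y ∈ dualCone v, ‖x‖ = 1 → ‖y‖ = 1 → μ ≤ inner ℝ x y :=
    fun x hx y hy hx' hy' => by
      have := h.minCos.le x hx y hy
      rwa [hx', hy', mul_one, mul_one] at this
  have hang : ∀ x y : E3, ‖x‖ = 1 → ‖y‖ = 1 → angle x y = Real.arccos (inner ℝ x y) :=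
    fun x y hx hy => by rw [angle, hx, hy]; simp
  set q : ℤ → E3 := fun i => cr (p i) (ed v (i + c)) with hq
  have hqq : ∀ i, inner ℝ (q i) (q i) = 1 - μ ^ 2 := fun i => by
    rw [hq, inner_cr_cr, inner_self_unit (h.norm_foot i), inner_self_unit (hc.norm_ed _),
      real_inner_comm (ed v (i + c)), hwp]; ring
  have hqn : ∀ i, ‖q i‖ = √(1 - μ ^ 2) := fun i => by
    rw [← hqq i, real_inner_self_eq_norm_sq, Real.sqrt_sq (norm_nonneg _)]
  set g : ℤ → ℝ := fun i => inner ℝ (ed v i) (p i) with hg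
  have hg1 : ∀ i, g i ≤ 1 := fun i => hle1 _ _ (hc.norm_ed i) (h.norm_foot i)
  have hgμ : ∀ i, μ ≤ g i := fun i =>
    hmin _ (hc.ed_mem i) _ (h.foot_mem i) (hc.norm_ed i) (h.norm_foot i)
  have hφ : ∀ i, angle (q i) (-q (i + c + 1)) =
      Real.arccos (g i * (g i - μ) / (1 - μ * g i)) := by
    intro i
    set u := inner ℝ (p i) (p (i + c + 1)) with hu
    have e1 : inner ℝ (q i) (-q (i + c + 1)) = g i * g i - u * (μ * g i) := by
      have e : ed v (i + c + 1 + c) = ed v i := by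
        rw [← hc.ed_per i, hn]; congr 1; push_cast; ring
      rw [inner_neg_right, hq, inner_cr_cr, e, real_inner_comm (ed v i) (ed v (i + c)), hkw, hwp',
        real_inner_comm (ed v i) (p i)]
      ring
    have t1 := tr_mul_tr (p i) (ed v (i + c)) (ed v i) (p i) (ed v (i + c)) (p (i + c + 1))
    have t2 := tr_mul_tr (p i) (ed v (i + c)) (ed v i) (p i) (ed v (i + c)) (ed v i)
    have t3 := tr_mul_tr (p i) (ed v (i + c)) (p (i + c + 1)) (p i) (ed v (i + c)) (p (i + c + 1))
    have r1 := inner_self_unit (h.norm_foot i)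
    have r2 := inner_self_unit (h.norm_foot (i + c + 1))
    have r3 := inner_self_unit (hc.norm_ed i)
    have r4 := inner_self_unit (hc.norm_ed (i + c))
    have r5 : inner ℝ (p i) (ed v (i + c)) = μ := by rw [real_inner_comm, hwp]
    have r6 : inner ℝ (p i) (ed v i) = g i := by rw [real_inner_comm]
    have r7 : inner ℝ (ed v (i + c)) (ed v i) = μ * g i := by rw [real_inner_comm, hkw]
    have r8 : inner ℝ (p (i + c + 1)) (ed v (i + c)) = g i := by rw [real_inner_comm, hwp']
    have r9 : inner ℝ (p (i + c + 1)) (p i) = u := real_inner_comm _ _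
    simp only [r1, r2, r3, r4, r5, r6, r7, r8, r9, hkw i, hwp i, hkp i, hwp' i, ← hu] at t1 t2 t3
    have hgi : inner ℝ (ed v i) (p i) = g i := rfl
    simp only [hgi] at t1 t2 t3
    have hμ2 : 1 - μ ^ 2 ≠ 0 := by nlinarith
    have hrel : (u * (1 + μ * g i) + 1 - g i * μ - μ ^ 2 - g i ^ 2) *
        ((u - g i * μ) * (1 - μ * g i) - (1 - μ ^ 2) * (1 - g i ^ 2)) = 0 := by
      -- Determinants that share the vectors of chord i are numbers, so the square of the mixed Gram
      -- expression is the product of the other two. This is the equation for u in terms of g.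
      have t4 : (tr (p i) (ed v (i + c)) (ed v i) * tr (p i) (ed v (i + c)) (p (i + c + 1))) ^ 2 =
          (tr (p i) (ed v (i + c)) (ed v i) * tr (p i) (ed v (i + c)) (ed v i)) *
          (tr (p i) (ed v (i + c)) (p (i + c + 1)) * tr (p i) (ed v (i + c)) (p (i + c + 1))) := by
        ring
      rw [t1, t2, t3] at t4
      apply mul_left_cancel₀ hμ2
      linear_combination t4
    rw [angle, hqn, norm_neg, hqn, e1, half_angle_bound hneg h1 (hg1 i)
      (hmin _ (h.foot_mem i) _ (h.foot_mem _) (h.norm_foot i) (h.norm_foot _)) ?_ ?_ hrel ?_]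
    · congr 1
      rw [← pow_two, hσ2]
      field_simp
    · have := mul_nonneg hσ.le (h.foot_mem (i + c + 1) i)
      have e2 := hwp' i
      rw [hw i, inner_add_left, real_inner_smul_left, real_inner_smul_left,
        real_inner_comm _ (v i)] at e2
      change _ ≤ inner ℝ (ed v i) (p i)
      linarith
    · have := hgμ i
      nlinarith [hg1 i]
    · have := hgμ i
      linarith
  set S := √((1 - μ) / 2) with hS
  have hS2 : S ^ 2 = (1 - μ) / 2 := Real.sq_sqrt (by linarith)
  have hS0 : 0 < S := Real.sqrt_pos.2 (by linarith)
  have hS1 : S < 1 := by nlinarith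
  have hlt : ∀ i, g i < 1 → S * angle (q i) (-q (i + c + 1)) < angle (ed v i) (p i) := by
    intro i hi
    have hk1 : 0 < 1 - μ * g i := by nlinarith [hgμ i]
    have hk2 : 0 < 1 - 2 * μ * g i + g i ^ 2 := by nlinarith [sq_nonneg (g i - μ)]
    have hk1' := hk1.ne'
    have ep : 1 + g i * (g i - μ) / (1 - μ * g i) =
        (1 - 2 * μ * g i + g i ^ 2) / (1 - μ * g i) := by
      rw [eq_div_iff hk1', add_mul, div_mul_cancel₀ _ hk1']; ring
    have em : 1 - g i * (g i - μ) / (1 - μ * g i) = (1 - g i ^ 2) / (1 - μ * g i) := by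
      rw [eq_div_iff hk1', sub_mul, div_mul_cancel₀ _ hk1']; ring
    have hgi := hgμ i
    rw [hφ, hang _ _ (hc.norm_ed i) (h.norm_foot i)]
    refine mul_arccos_lt hS0 hS1 ?_ ?_ (by linarith : -1 < g i) hi ?_
    · have := div_pos hk2 hk1
      linarith
    · have : 0 ≤ (1 - g i ^ 2) / (1 - μ * g i) := div_nonneg (by nlinarith) hk1.le
      linarith
    · change _ ≤ (1 - g i) / (1 + g i)
      rw [ep, em, div_div_div_cancel_right₀ hk1.ne', hS2, ← mul_div_assoc,
        div_le_div_iff₀ hk2 (by linarith)]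
      -- After cross-multiplication the difference of the two sides is a positive multiple of (1 -
      -- g)(1 + μ)(1 - g)².
      have : 0 ≤ (1 - g i) * ((1 + μ) * (1 - g i) ^ 2) :=
        mul_nonneg (by linarith) (mul_nonneg (by linarith) (sq_nonneg _))
      nlinarith
  have hle : ∀ i, S * angle (q i) (-q (i + c + 1)) ≤ angle (ed v i) (p i) := by
    intro i
    rcases eq_or_lt_of_le (hg1 i) with e | hi
    · rw [hφ, e]
      have : (1 : ℝ) * (1 - μ) / (1 - μ * 1) = 1 := by
        rw [one_mul, mul_one, div_self (by linarith)]
      rw [this, Real.arccos_one, mul_zero]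
      exact angle_nonneg _ _
    · exact (hlt i hi).le
  have hpp : ∀ i, p (i + n) = p i := h.foot_per
  have hqper : ∀ i, q (i + (2 * c + 1 : ℕ)) = q i := by
    intro i
    simp only [hq]
    rw [← hn, hpp, ← hc.ed_per (i + c)]
    congr 2; ring
  have hq0 : q 0 ≠ 0 := by
    intro e
    have := hqq 0
    rw [e, inner_zero_left] at this
    nlinarith
  have hpi := pi_le_sum_angle hqper hq0
  -- The foot splits the edge, and by `hwp'` its first part is as long as the half-edge with index i
  -- - c - 1. Over a full period each half-edge is therefore counted twice.
  have hsplit : ∀ i, angle (ed v (i - 1)) (ed v i) =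
      angle (ed v (i - c - 1)) (p (i - c - 1)) + angle (ed v i) (p i) := by
    intro i
    obtain ⟨a, b, ha, hb, e⟩ := h.edge_rep i
    have hne : p i ≠ 0 := by
      intro e
      have := h.norm_foot i
      rw [e, norm_zero] at this
      exact zero_ne_one this
    rw [angle_split hne ha hb e, angle_comm (p i)]
    congr 1
    have e2 := hwp' (i - c - 1)
    rw [show i - c - 1 + c = i - 1 by ring, show i - 1 + 1 = i by ring] at e2
    rw [hang _ _ (hc.norm_ed _) (h.norm_foot _), hang _ _ (hc.norm_ed _) (h.norm_foot _), e2]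
  have hsum : ∑ i ∈ Finset.range n, angle (ed v ((i : ℤ) - 1)) (ed v i) =
      2 * ∑ i ∈ Finset.range n, angle (ed v i) (p i) := by
    have hfper : ∀ i : ℤ, angle (ed v (i + n)) (p (i + n)) = angle (ed v i) (p i) := by
      intro i; rw [hc.ed_per, hpp]
    have := sum_range_shift (n := n) (f := fun i => angle (ed v i) (p i)) (by omega) hfper (-c - 1)
    rw [Finset.sum_congr rfl fun (i : ℕ) _ => hsplit i, Finset.sum_add_distrib, two_mul, ← this]
    congr 1
    apply Finset.sum_congr rfl
    intro i _
    congr 2 <;> ring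
  -- Strictness needs one half-edge of positive length; otherwise the whole perimeter would vanish.
  have hex : ∃ i ∈ Finset.range n, g i < 1 := by
    by_contra hcon
    push Not at hcon
    have h3 : ∑ i ∈ Finset.range n, angle (ed v i) (p i) = 0 := by
      apply Finset.sum_eq_zero
      intro i hi
      rw [hang _ _ (hc.norm_ed _) (h.norm_foot _)]
      exact Real.arccos_eq_zero.2 (hcon i hi)
    have h4 : 0 < ∑ i ∈ Finset.range n, angle (ed v ((i : ℤ) - 1)) (ed v i) := by
      apply Finset.sum_pos
      · intro i _
        apply lt_of_le_of_ne (angle_nonneg _ _)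
        intro e
        rw [hang _ _ (hc.norm_ed _) (hc.norm_ed _), eq_comm, Real.arccos_eq_zero] at e
        have e2 := inner_eq_one_iff_of_norm_eq_one (𝕜 := ℝ) (hc.norm_ed ((i : ℤ) - 1))
          (hc.norm_ed i)
        exact hc.ed_pred_ne h.norm i (e2.1 (le_antisymm (hle1 _ _ (hc.norm_ed _) (hc.norm_ed _)) e))
      · exact ⟨0, Finset.mem_range.2 (by omega)⟩
    rw [hsum, h3] at h4
    linarith
  rw [hsum]
  have h5 : ∑ i ∈ Finset.range n, S * angle (q i) (-q (i + c + 1)) <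
      ∑ i ∈ Finset.range n, angle (ed v i) (p i) := by
    obtain ⟨i, hi, hi'⟩ := hex
    exact Finset.sum_lt_sum (fun i _ => hle i) ⟨i, hi, hlt i hi'⟩
  rw [← Finset.mul_sum] at h5
  rw [hn] at h5 ⊢
  nlinarith

end ChordSystem

namespace ChordSystem

variable {n : ℕ} {v : ℤ → E3} {μ : ℝ} {p : ℤ → E3} {o : ℤ → ℤ}

/-- For μ = 0 the normals of the sides are the vertices themselves, shifted by c, and `v i` is
orthogonal to `v (i + c + 1)`. The differences of these orthogonal pairs turn by an angle ψ with sin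
(l/2) = √2 sin (ψ/2), where l is the side, and hence √2 ψ < l. -/
lemma half_perimeter_of_eq_zero (h : ChordSystem n v μ p o) {c : ℕ} (hn : n = 2 * c + 1)
    (ho : ∀ i, o i = i + c) (hμ : μ = 0) :
    2 * Real.pi * √((1 - μ) / 2) <
      ∑ i ∈ Finset.range n, angle (ed v ((i : ℤ) - 1)) (ed v i) := by
  have hc := h.cycle
  have hk : ∀ i, ed v (i + c) = v i := fun i => by
    have := h.eq i
    rw [ho, hμ] at this
    simpa using this
  have hk' : ∀ i, ed v i = v (i + c + 1) := fun i => by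
    rw [← hk (i + c + 1), ← hc.ed_per i, hn]
    congr 1; push_cast; ring
  have hvv : ∀ i, inner ℝ (v i) (v (i + c + 1)) = 0 := fun i => by
    rw [← hk' i, real_inner_comm, Cycle.inner_ed_self]
  have hang : ∀ x y : E3, ‖x‖ = 1 → ‖y‖ = 1 → angle x y = Real.arccos (inner ℝ x y) :=
    fun x y hx hy => by rw [angle, hx, hy]; simp
  set m : ℤ → E3 := fun i => v i - v (i + c + 1) with hm
  have hmm : ∀ i, inner ℝ (m i) (m i) = 2 := fun i => by
    simp only [hm]
    rw [inner_sub_left, inner_sub_right, inner_sub_right, real_inner_comm (v i) (v (i + c + 1)),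
      hvv, inner_self_unit (h.norm _), inner_self_unit (h.norm _)]
    norm_num
  have hmn : ∀ i, ‖m i‖ = √2 := fun i => by
    rw [← hmm i, real_inner_self_eq_norm_sq, Real.sqrt_sq (norm_nonneg _)]
  have hψ : ∀ i, Real.cos (angle (m i) (-m (i + c + 1))) =
      (1 + inner ℝ (v i) (v (i + 1))) / 2 := fun i => by
    have e : v (i + c + 1 + c + 1) = v (i + 1) := by
      rw [← hc.per (i + 1), hn]; congr 1; push_cast; ring
    rw [cos_angle, norm_neg, hmn, hmn, Real.mul_self_sqrt (by norm_num), inner_neg_right]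
    simp only [hm]
    rw [inner_sub_left, inner_sub_right, inner_sub_right, e, hvv, inner_self_unit (h.norm _)]
    have := hvv (i + c + 1)
    rw [e] at this
    rw [this]; ring
  have hlt : ∀ i, √2 * angle (m i) (-m (i + c + 1)) < angle (v i) (v (i + 1)) := by
    intro i
    have h1 := hψ i
    set ψ := angle (m i) (-m (i + c + 1))
    have h2 : Real.cos (angle (v i) (v (i + 1))) = inner ℝ (v i) (v (i + 1)) := by
      rw [cos_angle, h.norm, h.norm]; simp
    set l := angle (v i) (v (i + 1)) with hl
    have hl0 : 0 < l := by
      apply lt_of_le_of_ne (angle_nonneg _ _)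
      intro e
      change 0 = l at e
      rw [← e, Real.cos_zero] at h2
      exact hc.succ_ne i ((inner_eq_one_iff_of_norm_eq_one (𝕜 := ℝ) (h.norm i) (h.norm (i + 1))).1
        h2.symm).symm
    have hlπ : l ≤ Real.pi := angle_le_pi _ _
    have hψ0 : 0 ≤ ψ := angle_nonneg _ _
    have hψπ : ψ ≤ Real.pi := angle_le_pi _ _
    rw [← h2] at h1
    have hcl := Real.neg_one_le_cos l
    have hψ2 : ψ ≤ Real.pi / 2 := by
      by_contra hcon
      push Not at hcon
      have := Real.cos_neg_of_pi_div_two_lt_of_lt hcon (by linarith)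
      linarith
    have h3 : Real.sin (l / 2) ^ 2 = 2 * Real.sin (ψ / 2) ^ 2 := by
      have a1 := Real.cos_sq' (l / 2)
      have a2 := Real.cos_sq' (ψ / 2)
      have a3 := Real.cos_two_mul (l / 2)
      have a4 := Real.cos_two_mul (ψ / 2)
      rw [mul_div_cancel₀ _ two_ne_zero] at a3 a4
      linarith
    have s2 : √2 ^ 2 = 2 := Real.sq_sqrt (by norm_num)
    have s0 : 0 ≤ √2 := Real.sqrt_nonneg _
    have s1 : 1 < √2 := by nlinarith
    have s3 : √2 < 2 := by nlinarith
    have hsl : 0 < Real.sin (l / 2) := Real.sin_pos_of_pos_of_lt_pi (by linarith) (by linarith)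
    have hsψ : 0 ≤ Real.sin (ψ / 2) := Real.sin_nonneg_of_nonneg_of_le_pi (by linarith) (by linarith)
    have h4 : Real.sin (l / 2) = √2 * Real.sin (ψ / 2) := by
      have h5 : Real.sin (l / 2) ^ 2 = (√2 * Real.sin (ψ / 2)) ^ 2 := by rw [mul_pow, s2, h3]
      exact (pow_left_inj₀ hsl.le (by positivity) two_ne_zero).1 h5
    have hψ1 : 0 < ψ := by
      apply lt_of_le_of_ne hψ0
      intro e
      rw [← e, zero_div, Real.sin_zero, mul_zero] at h4
      linarith
    have h6 : √2 * (ψ / 2) < Real.pi / 2 := by nlinarith [Real.pi_pos]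
    -- Strict concavity of sin on [0, π], with the value at √2 ψ/2 weighted by √2/2.
    have h7 : Real.sin (√2 * (ψ / 2)) < √2 * Real.sin (ψ / 2) := by
      have hcv := strictConcaveOn_sin_Icc.2 ⟨le_rfl, Real.pi_pos.le⟩
        (⟨by positivity, by linarith [Real.pi_pos]⟩ : √2 * (ψ / 2) ∈ Set.Icc 0 Real.pi)
        (by positivity) (by linarith : 0 < 1 - √2 / 2) (by linarith : 0 < √2 / 2) (by ring)
      simp only [smul_eq_mul, mul_zero, Real.sin_zero, zero_add] at hcv
      rw [show √2 / 2 * (√2 * (ψ / 2)) = √2 ^ 2 * (ψ / 2) / 2 by ring, s2,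
        mul_div_cancel_left₀ _ two_ne_zero] at hcv
      nlinarith
    rw [← h4] at h7
    have h8 := Real.strictMonoOn_sin.lt_iff_lt (a := √2 * (ψ / 2)) (b := l / 2)
      ⟨by nlinarith [Real.pi_pos], h6.le⟩ ⟨by linarith [Real.pi_pos], by linarith⟩
    have h9 := h8.1 h7
    linarith
  have hmper : ∀ i, m (i + (2 * c + 1 : ℕ)) = m i := by
    intro i
    simp only [hm]
    rw [← hn, hc.per, ← hc.per (i + c + 1)]
    congr 2; ring
  have hm0 : m 0 ≠ 0 := by
    intro e
    have := hmm 0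
    rw [e, inner_zero_left] at this
    norm_num at this
  have hpi := pi_le_sum_angle hmper hm0
  have hsum : ∑ i ∈ Finset.range n, angle (ed v ((i : ℤ) - 1)) (ed v i) =
      ∑ i ∈ Finset.range n, angle (v i) (v (i + 1)) := by
    have hfper : ∀ i : ℤ, angle (v (i + n)) (v (i + n + 1)) = angle (v i) (v (i + 1)) := by
      intro i; rw [hc.per, show i + (n : ℤ) + 1 = i + 1 + n by ring, hc.per]
    rw [← sum_range_shift (n := n) (f := fun i => angle (v i) (v (i + 1))) (by omega) hfper c]
    apply Finset.sum_congr rfl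
    intro i _
    rw [hk', hk']
    congr 2; ring
  rw [hsum]
  have h5 : ∑ i ∈ Finset.range n, √2 * angle (m i) (-m (i + c + 1)) <
      ∑ i ∈ Finset.range n, angle (v (i : ℤ)) (v (i + 1)) :=
    Finset.sum_lt_sum (fun i _ => (hlt i).le) ⟨0, Finset.mem_range.2 (by omega), hlt (0 : ℕ)⟩
  rw [← Finset.mul_sum] at h5
  have e : 2 * Real.pi * √((1 - μ) / 2) = √2 * Real.pi := by
    have h1 : √((1 - μ) / 2) = √2 / 2 := by
      rw [hμ, sub_zero, Real.sqrt_div zero_le_one, Real.sqrt_one, Real.sqrt_div_self'.symm]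
    rw [h1]; ring
  rw [e]
  rw [hn] at h5 ⊢
  have := mul_le_mul_of_nonneg_left hpi (Real.sqrt_nonneg 2)
  linarith

end ChordSystem

/-- A lower bound for the perimeter of the polar of a reduced polygon. -/
lemma Cycle.perimeter_lt {n : ℕ} {v : ℤ → E3} (h : Cycle n v) (hv : ∀ i, ‖v i‖ = 1)
    (hred : IsReduced (body v)) : 2 * Real.pi * Real.cos (thickness (body v) / 2) <
      ∑ i ∈ Finset.range n, angle (ed v ((i : ℤ) - 1)) (ed v i) := by
  obtain ⟨μ, hμ, h1, h2, ht⟩ := h.exists_isMinCos hv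
  obtain ⟨p, o, hs⟩ := h.exists_chordSystem hv hred hμ h1
  obtain ⟨c, hn, ho⟩ := hs.exists_half
  -- The thickness is π - arccos μ, so this is the half-angle formula for the cosine.
  have hcos : Real.cos (thickness (body v) / 2) = √((1 - μ) / 2) := by
    rw [ht, Real.cos_half (by linarith [Real.arccos_le_pi μ, Real.pi_pos])
      (by linarith [Real.arccos_nonneg μ]), Real.cos_pi_sub, Real.cos_arccos h1.le h2.le]
    rfl
  rw [hcos]
  rcases lt_or_eq_of_le hs.nonpos with h0 | h0
  · exact hs.half_perimeter hn ho h0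
  · exact hs.half_perimeter_of_eq_zero hn ho h0

/-! ### Areas of lunes and the theorem of Girard. -/

/-- The area of the part of the sphere on which `P` holds. -/
def areaOf (P : E3 → Prop) : ℝ := (volume : Measure E3).toSphere.real {x : S2 | P x}

lemma areaOf_nonneg (P : E3 → Prop) : 0 ≤ areaOf P := measureReal_nonneg

lemma areaOf_true : areaOf (fun _ => True) = 4 * Real.pi := by
  rw [areaOf, Set.ofPred_true, Measure.toSphere_real_apply_univ, Measure.real,
    EuclideanSpace.volume_ball_fin_three, finrank_euclideanSpace_fin]
  rw [ENNReal.toReal_mul, ENNReal.toReal_pow, ENNReal.toReal_ofReal zero_le_one,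
    ENNReal.toReal_ofReal (by positivity)]
  push_cast
  ring

lemma measurable_inner_coe (a : E3) : Measurable fun x : S2 => inner ℝ a (x : E3) :=
  (continuous_const.inner continuous_subtype_val).measurable

lemma areaOf_isometry (φ : E3 ≃ₗᵢ[ℝ] E3) {P : E3 → Prop} (hP : MeasurableSet {x : S2 | P x}) :
    areaOf (fun x => P (φ x)) = areaOf P := by
  have hφ : Measurable fun x : S2 => (⟨φ x, by simp⟩ : S2) :=
    (φ.continuous.measurable.comp measurable_subtype_coe).subtype_mk
  have hP' : MeasurableSet {x : S2 | P (φ x)} := hφ hP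
  rw [areaOf, areaOf, Measure.real, Measure.real, Measure.toSphere_apply' _ hP,
    Measure.toSphere_apply' _ hP']
  congr 2
  conv_rhs => rw [← φ.measurePreserving.measure_preimage_emb φ.toHomeomorph.measurableEmbedding]
  congr 1
  ext y
  simp only [Set.mem_smul, Set.mem_image, Set.mem_ofPred_eq, Set.mem_preimage]
  constructor
  · rintro ⟨r, hr, _, ⟨x, hx, rfl⟩, rfl⟩
    exact ⟨r, hr, φ x, ⟨⟨φ x, by simp⟩, hx, rfl⟩, by simp⟩
  · rintro ⟨r, hr, _, ⟨x, hx, rfl⟩, h⟩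
    refine ⟨r, hr, φ.symm x, ⟨⟨φ.symm x, by simp⟩, by simpa using hx, rfl⟩, ?_⟩
    rw [← φ.symm_apply_apply y, ← h]
    simp

-- The cone over a great circle lies in a plane and so has volume zero.
open scoped Pointwise in
lemma areaOf_circle {a : E3} (ha : a ≠ 0) : areaOf (fun x => inner ℝ a x = 0) = 0 := by
  have hm : MeasurableSet {x : S2 | inner ℝ a (x : E3) = 0} :=
    measurable_inner_coe a (measurableSet_singleton 0)
  rw [areaOf, Measure.real, Measure.toSphere_apply' _ hm]
  have h0 : (volume : Measure E3) ((LinearMap.ker (innerₛₗ ℝ a) : Submodule ℝ E3) : Set E3) = 0 := by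
    apply Measure.addHaar_submodule
    intro h
    have : a ∈ LinearMap.ker (innerₛₗ ℝ a) := h ▸ Submodule.mem_top
    rw [LinearMap.mem_ker, innerₛₗ_apply_apply, inner_self_eq_zero] at this
    exact ha this
  have h1 := measure_mono_null (μ := (volume : Measure E3))
    (s := Set.Ioo (0 : ℝ) 1 • (Subtype.val '' {x : S2 | inner ℝ a (x : E3) = 0})) ?_ h0
  · rw [h1]; simp
  · rintro _ ⟨r, _, _, ⟨x, hx, rfl⟩, rfl⟩
    have hx : inner ℝ a (x : E3) = 0 := hx
    simp [hx]

lemma areaOf_or {P Q : E3 → Prop} (hQ : MeasurableSet {x : S2 | Q x})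
    (h : ∀ x : S2, P x → ¬ Q x) : areaOf (fun x => P x ∨ Q x) = areaOf P + areaOf Q :=
  measureReal_union (Set.disjoint_left.2 fun x h1 h2 => h x h1 h2) hQ

lemma areaOf_congr {P Q : E3 → Prop} (h : ∀ x : S2, P x ↔ Q x) : areaOf P = areaOf Q := by
  rw [areaOf, areaOf]; congr 1; ext x; exact h x

/-- Conditions that differ on countably many great circles only hold on sets of equal area. -/
lemma areaOf_congr_of_ne {ι : Type*} [Countable ι] {P Q : E3 → Prop} {a : ι → E3}
    (ha : ∀ i, a i ≠ 0) (h : ∀ x : S2, (∀ i, inner ℝ (a i) (x : E3) ≠ 0) → (P x ↔ Q x)) :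
    areaOf P = areaOf Q := by
  rw [areaOf, areaOf]
  apply measureReal_congr
  have h1 : ∀ᵐ x : S2 ∂(volume : Measure E3).toSphere, ∀ i, inner ℝ (a i) (x : E3) ≠ 0 := by
    rw [ae_all_iff]
    intro i
    have := areaOf_circle (ha i)
    rw [areaOf, measureReal_eq_zero_iff] at this
    rw [ae_iff]; simpa using this
  filter_upwards [h1] with x hx
  exact propext (h x hx)

/-- An additive nonnegative function on an interval is linear. -/
lemma eq_mul_of_additive {G : ℝ → ℝ} {T : ℝ} (hT : 0 < T) (h0 : ∀ t, 0 ≤ G t)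
    (hadd : ∀ s t, 0 ≤ s → 0 ≤ t → s + t < 2 * T → G (s + t) = G s + G t) {t : ℝ} (ht : 0 ≤ t)
    (ht' : t < 2 * T) : G t = t / T * G T := by
  have hG0 : G 0 = 0 := by
    have := hadd 0 0 le_rfl le_rfl (by linarith)
    rw [add_zero] at this; linarith
  have hmul : ∀ (k : ℕ) (s : ℝ), 0 ≤ s → k * s < 2 * T → G (k * s) = k * G s := by
    intro k s hs
    induction k with
    | zero => intro _; simp [hG0]
    | succ k ih =>
      intro hk
      push_cast at hk ⊢
      rw [add_mul, one_mul] at hk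
      rw [add_mul, one_mul, hadd _ _ (by positivity) hs hk, ih (by linarith)]
      ring
  have hmono : ∀ s t, 0 ≤ s → s ≤ t → t < 2 * T → G s ≤ G t := by
    intro s t hs hst ht
    have := hadd s (t - s) hs (by linarith) (by linarith)
    rw [add_sub_cancel] at this
    linarith [h0 (t - s)]
  have hlow : ∀ t, 0 ≤ t → t < 2 * T → t / T * G T ≤ G t := by
    intro t ht ht'
    -- Additivity gives exact values at multiples of T / N, and rounding t down to such a multiple
    -- costs at most G T / N.
    have key : ∀ N : ℕ, 0 < N → t / T * G T ≤ G t + G T / N := by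
      intro N hN
      have hN' : (0 : ℝ) < N := by exact_mod_cast hN
      have hs : 0 < T / N := by positivity
      set k := ⌊t / (T / N)⌋₊ with hk
      have k1 : (k : ℝ) ≤ t / (T / N) := Nat.floor_le (by positivity)
      have k2 : t / (T / N) < k + 1 := Nat.lt_floor_add_one _
      have k3 : k * (T / N) ≤ t := (le_div_iff₀ hs).1 k1
      have k4 := hmul N (T / N) hs.le (by rw [mul_div_cancel₀ _ hN'.ne']; linarith)
      rw [mul_div_cancel₀ _ hN'.ne'] at k4
      have k5 := hmul k (T / N) hs.le (by linarith)
      have k6 := hmono _ _ (by positivity) k3 ht'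
      have k7 : t / T * G T = t / (T / N) * G (T / N) := by
        rw [k4]; field_simp
      have k8 : G T / N = G (T / N) := by rw [k4]; field_simp
      rw [k7, k8]
      have := mul_le_mul_of_nonneg_right k2.le (h0 (T / N))
      linarith
    have hlim : Filter.Tendsto (fun N : ℕ => G t + G T / N) Filter.atTop (nhds (G t + 0)) :=
      tendsto_const_nhds.add (tendsto_const_div_atTop_nhds_zero_nat _)
    rw [add_zero] at hlim
    exact ge_of_tendsto hlim (Filter.eventually_atTop.2 ⟨1, fun N hN => key N hN⟩)
  -- The lower bound at T - t is an upper bound at t. Halving the argument then extends the formula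
  -- to the whole interval.
  have hhalf : ∀ t, 0 ≤ t → t ≤ T → G t = t / T * G T := by
    intro t ht ht'
    apply le_antisymm _ (hlow t ht (by linarith))
    have h1 := hlow (T - t) (by linarith) (by linarith)
    have h2 := hadd t (T - t) ht (by linarith) (by linarith)
    rw [add_sub_cancel] at h2
    have h3 : (T - t) / T * G T = G T - t / T * G T := by field_simp
    linarith
  have h1 := hadd (t / 2) (t / 2) (by linarith) (by linarith) (by linarith)
  rw [add_halves, hhalf (t / 2) (by linarith) (by linarith)] at h1
  rw [h1]; ring

/-- Completion of two orthonormal vectors to an orthonormal basis. -/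
lemma exists_frame {a f : E3} (ha : ‖a‖ = 1) (hf : ‖f‖ = 1) (haf : inner ℝ a f = 0) :
    ∃ e : OrthonormalBasis (Fin 3) ℝ E3, e 0 = a ∧ e 1 = f ∧ e 2 = cr a f := by
  have hn : Orthonormal ℝ ![a, f, cr a f] := by
    have h1 : inner ℝ a (cr a f) = 0 := by rw [real_inner_comm]; exact tr_self_mid _ _
    have h2 : inner ℝ f (cr a f) = 0 := by rw [real_inner_comm]; exact tr_self_right _ _
    have h3 : inner ℝ (cr a f) (cr a f) = 1 := by
      rw [inner_cr_cr, inner_self_unit ha, inner_self_unit hf, haf]; ring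
    have h4 : inner ℝ f a = 0 := by rw [real_inner_comm]; exact haf
    have h5 : inner ℝ (cr a f) a = 0 := tr_self_mid _ _
    have h6 : inner ℝ (cr a f) f = 0 := tr_self_right _ _
    rw [orthonormal_iff_ite]
    intro i j
    fin_cases i <;> fin_cases j <;>
      simp [-inner_self_eq_norm_sq_to_K, h1, h2, h3, h4, h5, h6, haf,
        inner_self_unit ha, inner_self_unit hf]
  obtain ⟨e, he⟩ := Orthonormal.exists_orthonormalBasis_extension_of_card_eq (ι := Fin 3)
    (𝕜 := ℝ) (E := E3) (by simp) (v := ![a, f, cr a f]) (s := Set.univ)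
    (hn.comp _ Subtype.val_injective)
  exact ⟨e, he 0 trivial, he 1 trivial, he 2 trivial⟩

lemma measurableSet_nonneg (a : E3) : MeasurableSet {x : S2 | 0 ≤ inner ℝ a (x : E3)} :=
  measurableSet_le measurable_const (measurable_inner_coe a)

lemma measurableSet_neg (a : E3) : MeasurableSet {x : S2 | inner ℝ a (x : E3) < 0} :=
  measurableSet_lt (measurable_inner_coe a) measurable_const

lemma measurableSet_lune (a b : E3) :
    MeasurableSet {x : S2 | inner ℝ a (x : E3) < 0 ∧ 0 ≤ inner ℝ b (x : E3)} :=
  (measurableSet_neg a).inter (measurableSet_nonneg b)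

/-- The lunes spanned by equally inclined pairs of an orthonormal frame have equal areas. -/
lemma areaOf_lune_frame {a f a' f' : E3} (ha : ‖a‖ = 1) (hf : ‖f‖ = 1) (haf : inner ℝ a f = 0)
    (ha' : ‖a'‖ = 1) (hf' : ‖f'‖ = 1) (haf' : inner ℝ a' f' = 0) (t : ℝ) :
    areaOf (fun x => inner ℝ a x < 0 ∧ 0 ≤ inner ℝ (Real.cos t • a + Real.sin t • f) x) =
    areaOf (fun x => inner ℝ a' x < 0 ∧ 0 ≤ inner ℝ (Real.cos t • a' + Real.sin t • f') x) := by
  obtain ⟨e, he0, he1, -⟩ := exists_frame ha hf haf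
  obtain ⟨e', he0', he1', -⟩ := exists_frame ha' hf' haf'
  have h1 : ∀ x, inner ℝ a ((e'.equiv e (Equiv.refl _)) x) = inner ℝ a' x := by
    intro x
    rw [← he0, ← he0', ← (e'.equiv e (Equiv.refl _)).inner_map_map (e' 0) x,
      OrthonormalBasis.equiv_apply_basis, Equiv.refl_apply]
  have h2 : ∀ x, inner ℝ f ((e'.equiv e (Equiv.refl _)) x) = inner ℝ f' x := by
    intro x
    rw [← he1, ← he1', ← (e'.equiv e (Equiv.refl _)).inner_map_map (e' 1) x,
      OrthonormalBasis.equiv_apply_basis, Equiv.refl_apply]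
  rw [← areaOf_isometry (e'.equiv e (Equiv.refl _)) (measurableSet_lune _ _)]
  apply areaOf_congr
  intro x
  rw [inner_add_left, inner_add_left, real_inner_smul_left, real_inner_smul_left,
    real_inner_smul_left, real_inner_smul_left, h1, h2]

/-- The area of a lune is twice its angle. -/
lemma areaOf_lune_of_angle {a f : E3} (ha : ‖a‖ = 1) (hf : ‖f‖ = 1) (haf : inner ℝ a f = 0) {t : ℝ}
    (ht : 0 ≤ t) (ht' : t < Real.pi) :
    areaOf (fun x => inner ℝ a x < 0 ∧ 0 ≤ inner ℝ (Real.cos t • a + Real.sin t • f) x) =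
      2 * t := by
  set G : ℝ → ℝ := fun t =>
    areaOf (fun x => inner ℝ a x < 0 ∧ 0 ≤ inner ℝ (Real.cos t • a + Real.sin t • f) x) with hG
  have hna : a ≠ 0 := by rintro rfl; simp at ha
  have hu : ∀ (t : ℝ) (x : E3), inner ℝ (Real.cos t • a + Real.sin t • f) x =
      Real.cos t * inner ℝ a x + Real.sin t * inner ℝ f x := fun t x => by
    rw [inner_add_left, real_inner_smul_left, real_inner_smul_left]
  have hfa : inner ℝ f a = 0 := by rw [real_inner_comm]; exact haf
  have hunit : ∀ t : ℝ, ‖Real.cos t • a + Real.sin t • f‖ = 1 := fun t => by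
    have : ‖Real.cos t • a + Real.sin t • f‖ ^ 2 = 1 := by
      rw [← real_inner_self_eq_norm_sq, hu, inner_add_right, inner_add_right,
        real_inner_smul_right, real_inner_smul_right, real_inner_smul_right,
        real_inner_smul_right, inner_self_unit ha, inner_self_unit hf, haf, hfa]
      linear_combination Real.cos_sq_add_sin_sq t
    exact (pow_eq_one_iff_of_nonneg (norm_nonneg _) two_ne_zero).1 this
  have hadd : ∀ s t, 0 ≤ s → 0 ≤ t → s + t < 2 * (Real.pi / 2) → G (s + t) = G s + G t := by
    intro s t hs ht hst
    -- The lune of angle t is rotated by s, so that it adjoins the lune of angle s without overlap.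
    have h1 : G t = areaOf (fun x => inner ℝ (Real.cos s • a + Real.sin s • f) x < 0 ∧
        0 ≤ inner ℝ (Real.cos (s + t) • a + Real.sin (s + t) • f) x) := by
      rw [hG]
      dsimp only
      rw [areaOf_lune_frame ha hf haf (hunit s) (hunit (s + Real.pi / 2)) ?_ t]
      · apply areaOf_congr
        intro x
        simp only [inner_add_left, real_inner_smul_left, Real.cos_add, Real.sin_add,
          Real.cos_pi_div_two, Real.sin_pi_div_two]
        ring_nf
      · rw [hu, inner_add_right, inner_add_right, real_inner_smul_right, real_inner_smul_right,
          real_inner_smul_right, real_inner_smul_right, inner_self_unit ha, inner_self_unit hf,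
          haf, hfa, Real.cos_add_pi_div_two, Real.sin_add_pi_div_two]
        ring
    rw [h1, ← areaOf_or (measurableSet_lune _ _) (fun x hx hx' => not_lt_of_ge hx.2 hx'.1)]
    apply areaOf_congr
    intro x
    rw [hu, hu]
    set X := inner ℝ a (x : E3)
    set Y := inner ℝ f (x : E3)
    have id1 : Real.sin s * (Real.cos (s + t) * X + Real.sin (s + t) * Y) =
        Real.sin (s + t) * (Real.cos s * X + Real.sin s * Y) - Real.sin t * X := by
      have : Real.sin t = Real.sin (s + t - s) := by ring_nf
      rw [this, Real.sin_sub]; ring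
    have hss : 0 ≤ Real.sin s := Real.sin_nonneg_of_nonneg_of_le_pi hs (by linarith)
    have hst' : 0 ≤ Real.sin t := Real.sin_nonneg_of_nonneg_of_le_pi ht (by linarith)
    constructor
    · rintro ⟨hX, hY⟩
      rcases le_or_gt 0 (Real.cos s * X + Real.sin s * Y) with h | h
      · exact Or.inl ⟨hX, h⟩
      · exact Or.inr ⟨h, hY⟩
    · rintro (⟨hX, hY⟩ | ⟨hX, hY⟩)
      · refine ⟨hX, ?_⟩
        rcases eq_or_lt_of_le hs with rfl | hs
        · simp at hY; linarith
        · have h2 : 0 < Real.sin s := Real.sin_pos_of_pos_of_lt_pi hs (by linarith)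
          have h3 : 0 ≤ Real.sin (s + t) :=
            Real.sin_nonneg_of_nonneg_of_le_pi (by linarith) (by linarith)
          have h4 := mul_nonneg h3 hY
          have h5 := mul_nonneg hst' (neg_pos.2 hX).le
          refine nonneg_of_mul_nonneg_right ?_ h2
          rw [id1]; linarith
      · refine ⟨?_, hY⟩
        rcases eq_or_lt_of_le ht with rfl | ht
        · rw [add_zero] at hY; linarith
        · have h2 : 0 < Real.sin t := Real.sin_pos_of_pos_of_lt_pi ht (by linarith)
          have h3 : 0 < Real.sin (s + t) := Real.sin_pos_of_pos_of_lt_pi (by linarith) (by linarith)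
          have h4 := mul_neg_of_pos_of_neg h3 hX
          have h5 := mul_nonneg hss hY
          by_contra hcon
          push Not at hcon
          have := mul_nonneg h2.le hcon
          linarith
  have hneg : areaOf (fun x => inner ℝ a x < 0) = areaOf (fun x => 0 ≤ inner ℝ a x) := by
    rw [← areaOf_isometry (P := fun x => 0 ≤ inner ℝ a x) (LinearIsometryEquiv.neg ℝ)
      (measurableSet_nonneg a)]
    apply areaOf_congr_of_ne (a := fun _ : Unit => a) fun _ => hna
    intro x hx
    replace hx := hx ()
    rw [LinearIsometryEquiv.coe_neg]
    change _ ↔ 0 ≤ inner ℝ a (-(x : E3))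
    rw [inner_neg_right, neg_nonneg]
    exact ⟨le_of_lt, fun h => lt_of_le_of_ne h hx⟩
  have hhalf : areaOf (fun x => inner ℝ a x < 0) = 2 * Real.pi := by
    have h1 := areaOf_or (P := fun x => inner ℝ a x < 0) (Q := fun x => 0 ≤ inner ℝ a x)
      (measurableSet_nonneg a) (fun x hx hx' => not_lt_of_ge hx' hx)
    rw [← hneg, areaOf_congr (Q := fun _ => True) (fun x => by simpa using lt_or_ge _ _),
      areaOf_true] at h1
    linarith
  have hquarter : G (Real.pi / 2) = Real.pi := by
    have h1 : G (Real.pi / 2) = areaOf (fun x => inner ℝ a x < 0 ∧ inner ℝ f x < 0) := by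
      have h2 := areaOf_lune_frame ha hf haf hf (f' := -a) (by simpa using ha)
        (by rw [inner_neg_right, hfa, neg_zero]) (Real.pi / 2)
      rw [hG]
      dsimp only
      rw [h2]
      apply areaOf_congr_of_ne (a := fun _ : Unit => a) fun _ => hna
      intro x hx
      replace hx := hx ()
      simp only [Real.cos_pi_div_two, Real.sin_pi_div_two, zero_smul, one_smul, zero_add,
        inner_neg_left, neg_nonneg]
      exact ⟨fun h => ⟨lt_of_le_of_ne h.2 hx, h.1⟩, fun h => ⟨h.2, h.1.le⟩⟩
    have h3 := areaOf_or (P := fun x => inner ℝ a x < 0 ∧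
        0 ≤ inner ℝ (Real.cos (Real.pi / 2) • a + Real.sin (Real.pi / 2) • f) x)
      (Q := fun x => inner ℝ a x < 0 ∧ inner ℝ f x < 0)
      ((measurableSet_neg a).inter (measurableSet_neg f)) (fun x hx hx' => by
        have := hx.2
        simp only [Real.cos_pi_div_two, Real.sin_pi_div_two, zero_smul, one_smul, zero_add] at this
        linarith [hx'.2])
    rw [← h1, areaOf_congr (Q := fun x => inner ℝ a x < 0) (fun x => by
      simp only [Real.cos_pi_div_two, Real.sin_pi_div_two, zero_smul, one_smul, zero_add]
      rw [← and_or_left]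
      simp [le_or_gt]), hhalf] at h3
    change 2 * Real.pi = G (Real.pi / 2) + G (Real.pi / 2) at h3
    linarith
  have := eq_mul_of_additive (G := G) (T := Real.pi / 2) (by positivity) (fun t => areaOf_nonneg _)
    hadd ht (by linarith)
  change G t = 2 * t
  rw [this, hquarter]
  field_simp

lemma areaOf_lune {a b : E3} (ha : ‖a‖ = 1) (hb : ‖b‖ = 1) (hab : cr a b ≠ 0) :
    areaOf (fun x => inner ℝ a x < 0 ∧ 0 ≤ inner ℝ b x) = 2 * angle a b := by
  set c := inner ℝ a b with hc
  have hcr : inner ℝ (cr a b) (cr a b) = 1 - c ^ 2 := by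
    rw [inner_cr_cr, inner_self_unit ha, inner_self_unit hb, real_inner_comm a b, ← hc]; ring
  have hpos : 0 < 1 - c ^ 2 := by
    rw [← hcr]
    exact lt_of_le_of_ne real_inner_self_nonneg (Ne.symm (by rwa [Ne, inner_self_eq_zero]))
  set s := √(1 - c ^ 2) with hs
  have hs0 : 0 < s := Real.sqrt_pos.2 hpos
  have hs2 : s ^ 2 = 1 - c ^ 2 := Real.sq_sqrt hpos.le
  have hang : angle a b = Real.arccos c := by rw [angle, ha, hb]; simp [hc]
  have haa := inner_self_unit ha
  have hbb := inner_self_unit hb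
  set f := s⁻¹ • (b - c • a) with hf
  have haf : inner ℝ a f = 0 := by
    rw [hf, real_inner_smul_right, inner_sub_right, real_inner_smul_right, haa, ← hc]; ring
  have hfn : ‖f‖ = 1 := by
    have : ‖f‖ ^ 2 = 1 := by
      rw [← real_inner_self_eq_norm_sq, hf, real_inner_smul_right, real_inner_smul_left,
        inner_sub_left, inner_sub_right, inner_sub_right, real_inner_smul_right,
        real_inner_smul_right, real_inner_smul_left, real_inner_smul_left, haa, hbb,
        real_inner_comm a b, ← hc]
      field_simp
      linear_combination -hs2
    exact (pow_eq_one_iff_of_nonneg (norm_nonneg _) two_ne_zero).1 this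
  have hb' : b = Real.cos (Real.arccos c) • a + Real.sin (Real.arccos c) • f := by
    rw [Real.cos_arccos (by nlinarith) (by nlinarith), Real.sin_arccos, ← hs, hf, smul_smul,
      mul_inv_cancel₀ hs0.ne', one_smul]
    abel
  have h := areaOf_lune_of_angle ha hfn haf (Real.arccos_nonneg c)
    (lt_of_le_of_ne (Real.arccos_le_pi c) (fun e => by
      rw [Real.arccos_eq_pi] at e
      nlinarith))
  rw [← hb'] at h
  rw [h, hang]

lemma areaOf_exists {ι : Type*} (s : Finset ι) {P : ι → E3 → Prop}
    (hP : ∀ i, MeasurableSet {x : S2 | P i x})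
    (h : ∀ i ∈ s, ∀ j ∈ s, i ≠ j → ∀ x : S2, P i x → ¬ P j x) :
    areaOf (fun x => ∃ i ∈ s, P i x) = ∑ i ∈ s, areaOf (P i) := by
  have h1 : {x : S2 | ∃ i ∈ s, P i x} = ⋃ i ∈ s, {x : S2 | P i x} := by
    ext x; simp
  rw [areaOf, h1, measureReal_biUnion_finset _ fun i _ => hP i]
  · rfl
  · intro i hi j hj hij
    exact Set.disjoint_left.2 fun x hx hx' => h i hi j hj hij x hx hx'

namespace Cycle

variable {n : ℕ} {v : ℤ → E3}

/-- A linear functional changes sign from negative to nonnegative at most once along a convex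
cycle. -/
lemma not_two_sign_changes (h : Cycle n v) {i j : ℤ} (hij : i < j) (hj : j < i + n) {x : E3}
    (hi : inner ℝ (v (i - 1)) x < 0 ∧ 0 ≤ inner ℝ (v i) x)
    (hj' : inner ℝ (v (j - 1)) x < 0 ∧ 0 ≤ inner ℝ (v j) x) : False := by
  have h1 : i ≠ j - 1 := by
    rintro rfl
    linarith [hi.2, hj'.1]
  have h2 : j ≠ i - 1 + n := by
    intro e
    have := h.per (i - 1)
    rw [← e] at this
    rw [this] at hj'
    linarith [hi.1, hj'.2]
  -- With signs -, +, -, + at the four vectors, every term of the linear relation is at most 0 and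
  -- two are negative, so the sum cannot vanish.
  have e := congrArg (fun y => inner ℝ y x) (tr_relation (v (i - 1)) (v i) (v (j - 1)) (v j))
  simp only [inner_sub_left, inner_add_left, real_inner_smul_left, inner_zero_left] at e
  have p1 := h.pos3 (i := i) (j := j - 1) (l := j) (by omega) (by omega) (by omega)
  have p2 := h.pos3 (i := i - 1) (j := j - 1) (l := j) (by omega) (by omega) (by omega)
  have p3 := h.pos3 (i := i - 1) (j := i) (l := j) (by omega) (by omega) (by omega)
  have p4 := h.pos3 (i := i - 1) (j := i) (l := j - 1) (by omega) (by omega) (by omega)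
  have q1 := mul_neg_of_pos_of_neg p1 hi.1
  have q2 := mul_nonneg p2.le hi.2
  have q3 := mul_neg_of_pos_of_neg p3 hj'.1
  have q4 := mul_nonneg p4.le hj'.2
  linarith

lemma exists_sign_change (h : Cycle n v) {x : E3} {a b : ℤ} (ha : inner ℝ (v a) x < 0)
    (hb : 0 ≤ inner ℝ (v b) x) :
    ∃ i ∈ Finset.range n, inner ℝ (v ((i : ℤ) - 1)) x < 0 ∧ 0 ≤ inner ℝ (v i) x := by
  have h3 := h.three
  obtain ⟨l, hl, -, hlb⟩ := exists_rep (by omega) h.per a b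
  rw [← hlb] at hb
  have hex : ∃ k : ℕ, 0 ≤ inner ℝ (v (a + k)) x :=
    ⟨(l - a).toNat, by rwa [Int.toNat_of_nonneg (by omega), add_sub_cancel]⟩
  classical
  have hk := Nat.find_spec hex
  have hk' : ∀ m < Nat.find hex, ¬ 0 ≤ inner ℝ (v (a + m)) x := fun m hm => Nat.find_min hex hm
  set k := Nat.find hex with hkdef
  have hk0 : k ≠ 0 := by
    intro e
    rw [e, Nat.cast_zero, add_zero] at hk
    linarith
  obtain ⟨i, hi0, hi1, hi2⟩ : ∃ i : ℤ, 0 ≤ i ∧ i < n ∧ ∃ q : ℤ, a + k = i + n * q := by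
    refine ⟨(a + k) % n, Int.emod_nonneg _ (by omega), Int.emod_lt_of_pos _ (by omega),
      (a + k) / n, (Int.emod_add_mul_ediv _ _).symm⟩
  obtain ⟨q, hq⟩ := hi2
  refine ⟨i.toNat, Finset.mem_range.2 (by omega), ?_, ?_⟩
  · rw [Int.toNat_of_nonneg hi0, ← per_mul h.per _ q]
    have := hk' (k - 1) (by omega)
    push Not at this
    have e : ((k - 1 : ℕ) : ℤ) = k - 1 := by omega
    rwa [e, show a + ((k : ℤ) - 1) = i - 1 + n * q by linarith] at this
  · rw [Int.toNat_of_nonneg hi0, ← per_mul h.per _ q, ← hq]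
    exact hk

/-- The area of a convex polygon by the theorem of Girard, in terms of the perimeter of its
polar. -/
lemma area_body (h : Cycle n v) :
    area (body v) = 2 * Real.pi - ∑ i ∈ Finset.range n, angle (ed v ((i : ℤ) - 1)) (ed v i) := by
  set w := ed v with hw
  have hd : Cycle n w := h.dual
  have hwn : ∀ i, ‖w i‖ = 1 := h.norm_ed
  have hw0 : ∀ i, w i ≠ 0 := fun i e => by
    have := hwn i
    rw [e, norm_zero] at this
    exact zero_ne_one this
  have hbody : area (body v) = areaOf fun x => ∀ i, 0 ≤ inner ℝ (w i) x := rfl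
  have hmeas : MeasurableSet {x : S2 | ∀ i, 0 ≤ inner ℝ (w i) (x : E3)} := by
    have : {x : S2 | ∀ i, 0 ≤ inner ℝ (w i) (x : E3)} =
        ⋂ i, {x : S2 | 0 ≤ inner ℝ (w i) (x : E3)} := by ext x; simp
    rw [this]
    exact MeasurableSet.iInter fun i => measurableSet_nonneg (w i)
  have hmeas' : MeasurableSet {x : S2 | ∀ i, inner ℝ (w i) (x : E3) < 0} := by
    have : {x : S2 | ∀ i, inner ℝ (w i) (x : E3) < 0} =
        ⋂ i, {x : S2 | inner ℝ (w i) (x : E3) < 0} := by ext x; simp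
    rw [this]
    exact MeasurableSet.iInter fun i => measurableSet_neg (w i)
  have hneg : areaOf (fun x => ∀ i, inner ℝ (w i) x < 0) =
      areaOf (fun x => ∀ i, 0 ≤ inner ℝ (w i) x) := by
    rw [← areaOf_isometry (P := fun x => ∀ i, 0 ≤ inner ℝ (w i) x) (LinearIsometryEquiv.neg ℝ)
      hmeas]
    apply areaOf_congr_of_ne hw0
    intro x hx
    rw [LinearIsometryEquiv.coe_neg]
    change _ ↔ ∀ i, 0 ≤ inner ℝ (w i) (-(x : E3))
    simp only [inner_neg_right, neg_nonneg]
    exact ⟨fun h i => (h i).le, fun h i => lt_of_le_of_ne (h i) (hx i)⟩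
  -- Along the cyclic normals, the sign of ⟨w i, x⟩ is constant or changes exactly once from
  -- negative to nonnegative. So the sphere is the disjoint union of the polygon, the region where
  -- all signs are negative (of equal area by the antipodal map), and one lune for each place of
  -- change. Comparing with 4π gives the area.
  have hsum : areaOf (fun x => ∃ i ∈ Finset.range n,
      inner ℝ (w ((i : ℤ) - 1)) x < 0 ∧ 0 ≤ inner ℝ (w i) x) =
      ∑ i ∈ Finset.range n, 2 * angle (w ((i : ℤ) - 1)) (w i) := by
    rw [areaOf_exists _ fun (i : ℕ) => measurableSet_lune (w ((i : ℤ) - 1)) (w i)]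
    · apply Finset.sum_congr rfl
      intro i _
      apply areaOf_lune (hwn _) (hwn _)
      have := hd.cr_ne_zero ((i : ℤ) - 1)
      rwa [sub_add_cancel] at this
    · intro i hi j hj hij x hx hx'
      rw [Finset.mem_range] at hi hj
      rcases lt_or_gt_of_ne hij with hlt | hlt
      · exact hd.not_two_sign_changes (i := i) (j := j) (by omega) (by omega) hx hx'
      · exact hd.not_two_sign_changes (i := j) (j := i) (by omega) (by omega) hx' hx
  have h1 := areaOf_or (P := fun x => ∃ i ∈ Finset.range n,
      inner ℝ (w ((i : ℤ) - 1)) x < 0 ∧ 0 ≤ inner ℝ (w i) x)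
    (Q := fun x => ∀ i, inner ℝ (w i) x < 0) hmeas' (by
      rintro x ⟨i, _, _, hx⟩ hx'
      exact not_lt_of_ge hx (hx' i))
  have h2 := areaOf_or (P := fun x => (∃ i ∈ Finset.range n,
      inner ℝ (w ((i : ℤ) - 1)) x < 0 ∧ 0 ≤ inner ℝ (w i) x) ∨ ∀ i, inner ℝ (w i) x < 0)
    (Q := fun x => ∀ i, 0 ≤ inner ℝ (w i) x) hmeas (by
      rintro x (⟨i, _, hx, _⟩ | hx) hx'
      · exact not_lt_of_ge (hx' _) hx
      · exact not_lt_of_ge (hx' 0) (hx 0))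
  rw [h1, hsum, hneg, areaOf_congr (Q := fun _ => True), areaOf_true, ← hbody,
    ← Finset.mul_sum] at h2
  · linarith
  · intro x
    refine ⟨fun _ => trivial, fun _ => ?_⟩
    by_cases hn : ∀ i, 0 ≤ inner ℝ (w i) (x : E3)
    · exact Or.inr hn
    left
    by_cases hp : ∀ i, inner ℝ (w i) (x : E3) < 0
    · exact Or.inr hp
    left
    push Not at hn hp
    obtain ⟨a, ha⟩ := hn
    obtain ⟨b, hb⟩ := hp
    exact hd.exists_sign_change ha hb

end Cycle

/-! ### Thickness and area of regular polygons in standard position. -/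

namespace Cycle

variable {n : ℕ} {v : ℤ → E3}

/-- The largest angle between vectors of the dual cone, if not acute, is attained at an
extreme ray. -/
lemma exists_min_vertex (h : Cycle n v) (hv : ∀ i, ‖v i‖ = 1) {μ : ℝ}
    (hμ : IsMinCos (dualCone v) μ) (h0 : μ ≤ 0) (h1 : -1 < μ) :
    ∃ x ∈ dualCone v, ∃ j, ‖x‖ = 1 ∧ inner ℝ (ed v j) x = μ := by
  have h3 := h.three
  obtain ⟨x, hx, y, hy, hxn, hyn, hxy⟩ := hμ.attained
  obtain ⟨i, hi⟩ := h.exists_edge_of_isMin hμ h0 h1 hx hy hxn hyn hxy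
  obtain ⟨a, b, ha, hb, e⟩ := h.edge_rep hx hi
  rcases eq_or_lt_of_le ha with ha | ha
  · refine ⟨y, hy, i, hyn, ?_⟩
    rw [← h.eq_ed_of_smul hb hxn (by rw [e, ← ha]; simp), hxy]
  rcases eq_or_lt_of_le hb with hb | hb
  · refine ⟨y, hy, i - 1, hyn, ?_⟩
    rw [← h.eq_ed_of_smul ha.le hxn (by rw [e, ← hb]; simp), hxy]
  -- Here x is in the relative interior of its edge. The vector z is nonnegative on the cone and
  -- vanishes at x, hence on the whole edge, so it is a positive multiple of `v i`. Thus x is a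
  -- foot, and y is the opposite vertex.
  set z := y - μ • x with hz
  have hzq : ∀ q ∈ dualCone v, 0 ≤ inner ℝ z q := by
    intro q hq
    have := hμ.first_order h0 h1 hy hx hq hyn hxn (by rw [real_inner_comm, hxy])
    rw [hz, inner_sub_left, real_inner_smul_left]
    linarith
  have hzx : inner ℝ z x = 0 := by
    rw [hz, inner_sub_left, real_inner_smul_left, inner_self_unit hxn, real_inner_comm, hxy]
    ring
  have hz1 := hzq _ (h.ed_mem (i - 1))
  have hz2 := hzq _ (h.ed_mem i)
  rw [e, inner_add_right, real_inner_smul_right, real_inner_smul_right] at hzx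
  have hz1' : inner ℝ z (ed v (i - 1)) = 0 := by
    have := mul_nonneg hb.le hz2
    by_contra hne
    have := mul_pos ha (lt_of_le_of_ne hz1 (Ne.symm hne))
    linarith
  have hz2' : inner ℝ z (ed v i) = 0 := by
    have := mul_nonneg ha.le hz1
    by_contra hne
    have := mul_pos hb (lt_of_le_of_ne hz2 (Ne.symm hne))
    linarith
  set σ := inner ℝ z (v i) with hσ
  have hzv : z = σ • v i := by
    rw [← sub_eq_zero]
    refine eq_zero_of_inner (a := ed v (i - 1)) (b := ed v i) (c := v i) (h.tr_ed_ed_ne hv i) ?_ ?_ ?_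
    · rw [inner_sub_right, real_inner_smul_right, real_inner_comm, hz1', inner_ed_pred]; ring
    · rw [inner_sub_right, real_inner_smul_right, real_inner_comm, hz2', inner_ed_self]; ring
    · rw [inner_sub_right, real_inner_smul_right, inner_self_unit (hv i), real_inner_comm, ← hσ]
      ring
  have hσ0 : 0 ≤ σ := by
    have h4 := hzq _ (h.ed_mem (i + 1))
    have h5 := h.inner_ed_pos (i := i + 1) (j := i + n) (by omega) (by omega)
    rw [h.per] at h5
    rw [hzv, real_inner_smul_left, real_inner_comm] at h4
    exact nonneg_of_mul_nonneg_left h4 h5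
  have hσ1 : 0 < σ := by
    apply lt_of_le_of_ne hσ0
    intro e0
    rw [← e0, zero_smul, hz, sub_eq_zero] at hzv
    rw [hzv, norm_smul, hxn, mul_one, Real.norm_eq_abs, abs_of_nonpos h0] at hyn
    linarith
  obtain ⟨j, hj⟩ := h.exists_vertex_of_foot hv hμ h0 h1 hx hy hxn hyn hi
    (by rw [real_inner_comm, hxy]) hσ1 (by rw [← hzv, hz]; abel)
  exact ⟨x, hx, j, hxn, by rw [← hj, real_inner_comm, hxy]⟩

end Cycle

lemma cr_cr_right (a b c : E3) : cr a (cr b c) = inner ℝ a c • b - inner ℝ a b • c := by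
  apply ext_coord <;>
  · simp only [inner_eq_coord, cr_apply_zero, cr_apply_one, cr_apply_two, PiLp.sub_apply,
      PiLp.smul_apply, smul_eq_mul]
    ring

lemma cr_comb (e f g : E3) (x y z x' y' z' : ℝ) :
    cr (x • e + y • f + z • g) (x' • e + y' • f + z' • g) =
      (x * y' - y * x') • cr e f + (x * z' - z * x') • cr e g + (y * z' - z * y') • cr f g := by
  apply ext_coord <;>
  · simp only [cr_apply_zero, cr_apply_one, cr_apply_two, PiLp.add_apply,
      PiLp.smul_apply, smul_eq_mul]
    ring

/-- The first two vectors of a positively oriented orthonormal frame. -/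
structure IsFrame (e f : E3) : Prop where
  norm_left : ‖e‖ = 1
  norm_right : ‖f‖ = 1
  inner_eq : inner ℝ e f = 0

/-- The vector with the given coordinates in the positively oriented frame defined by `e`, `f`. -/
def fr (e f : E3) (x y z : ℝ) : E3 := x • e + y • f + z • cr e f

namespace IsFrame

variable {e f : E3}

lemma inner_fr (h : IsFrame e f) (x y z x' y' z' : ℝ) :
    inner ℝ (fr e f x y z) (fr e f x' y' z') = x * x' + y * y' + z * z' := by
  have h1 := inner_self_unit h.norm_left
  have h2 := inner_self_unit h.norm_right
  have h3 : inner ℝ f e = 0 := by rw [real_inner_comm, h.inner_eq]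
  have h4 : inner ℝ (cr e f) (cr e f) = 1 := by rw [inner_cr_cr, h1, h2, h.inner_eq]; ring
  have h5 : inner ℝ e (cr e f) = 0 := by rw [real_inner_comm, inner_cr_left]
  have h6 : inner ℝ f (cr e f) = 0 := by rw [real_inner_comm, inner_cr_right]
  simp only [fr, inner_add_left, inner_add_right, real_inner_smul_left, real_inner_smul_right,
    h1, h2, h3, h4, h5, h6, h.inner_eq, inner_cr_left, inner_cr_right]
  ring

lemma cr_fr (h : IsFrame e f) (x y z x' y' z' : ℝ) :
    cr (fr e f x y z) (fr e f x' y' z') =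
      fr e f (y * z' - z * y') (z * x' - x * z') (x * y' - y * x') := by
  have h3 : inner ℝ f e = 0 := by rw [real_inner_comm, h.inner_eq]
  rw [fr, fr, cr_comb, cr_cr_right, cr_cr_right, inner_self_unit h.norm_left,
    inner_self_unit h.norm_right, h.inner_eq, h3, fr]
  module

lemma tr_fr (h : IsFrame e f) (x y z x' y' z' x'' y'' z'' : ℝ) :
    tr (fr e f x y z) (fr e f x' y' z') (fr e f x'' y'' z'') =
      (y * z' - z * y') * x'' + (z * x' - x * z') * y'' + (x * y' - y * x') * z'' := by
  rw [tr, h.cr_fr, h.inner_fr]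

lemma norm_fr (h : IsFrame e f) {x y z : ℝ} (hx : x ^ 2 + y ^ 2 + z ^ 2 = 1) :
    ‖fr e f x y z‖ = 1 := by
  have : ‖fr e f x y z‖ ^ 2 = 1 := by
    rw [← real_inner_self_eq_norm_sq, h.inner_fr]
    linarith
  exact (pow_eq_one_iff_of_nonneg (norm_nonneg _) two_ne_zero).1 this

end IsFrame

lemma smul_fr (e f : E3) (t x y z : ℝ) : t • fr e f x y z = fr e f (t * x) (t * y) (t * z) := by
  rw [fr, fr]; module

/-- The points of a circle of spherical radius `R` at consecutive angular distance `α`. -/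
def reg (e f : E3) (R α : ℝ) (i : ℤ) : E3 :=
  fr e f (Real.sin R * Real.cos (i * α)) (Real.sin R * Real.sin (i * α)) (Real.cos R)

lemma norm_reg {e f : E3} (h : IsFrame e f) (R α : ℝ) (i : ℤ) : ‖reg e f R α i‖ = 1 := by
  apply h.norm_fr
  linear_combination Real.sin R ^ 2 * Real.sin_sq_add_cos_sq (i * α) + Real.sin_sq_add_cos_sq R

lemma reg_per (e f : E3) (R : ℝ) {n : ℕ} {α : ℝ} (hα : n * α = 2 * Real.pi) (i : ℤ) :
    reg e f R α (i + n) = reg e f R α i := by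
  have : ((i + n : ℤ) : ℝ) * α = i * α + 2 * Real.pi := by push_cast; rw [add_mul, hα]
  rw [reg, reg, this, Real.cos_add_two_pi, Real.sin_add_two_pi]

lemma sin_add_sin_sub (a b : ℝ) : Real.sin (2 * a) + Real.sin (2 * b) - Real.sin (2 * (a + b)) =
    4 * Real.sin a * Real.sin b * Real.sin (a + b) := by
  rw [mul_add, Real.sin_add, Real.sin_add, Real.cos_two_mul, Real.cos_two_mul, Real.sin_two_mul,
    Real.sin_two_mul, Real.cos_sq', Real.cos_sq']
  ring

/-- Factoring into sines of half the differences makes the orientation of three points of a circle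
visible. It yields convexity of `reg` and later the converse. -/
lemma tr_circle {e f : E3} (h : IsFrame e f) (ρ z x y w : ℝ) :
    tr (fr e f (ρ * Real.cos x) (ρ * Real.sin x) z) (fr e f (ρ * Real.cos y) (ρ * Real.sin y) z)
      (fr e f (ρ * Real.cos w) (ρ * Real.sin w) z) =
      4 * z * ρ ^ 2 * (Real.sin ((y - x) / 2) * Real.sin ((w - y) / 2) *
        Real.sin ((w - x) / 2)) := by
  have h1 := sin_add_sin_sub ((y - x) / 2) ((w - y) / 2)
  rw [show (y - x) / 2 + (w - y) / 2 = (w - x) / 2 by ring, mul_div_cancel₀ _ two_ne_zero,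
    mul_div_cancel₀ _ two_ne_zero, mul_div_cancel₀ _ two_ne_zero, Real.sin_sub, Real.sin_sub,
    Real.sin_sub] at h1
  rw [h.tr_fr]
  linear_combination z * ρ ^ 2 * h1

lemma cycle_reg {e f : E3} (h : IsFrame e f) {n : ℕ} (hn : 3 ≤ n) {R α : ℝ} (hR : 0 < R)
    (hR' : R < Real.pi / 2) (hα : n * α = 2 * Real.pi) : Cycle n (reg e f R α) := by
  have hn' : (0 : ℝ) < n := by positivity
  have hα0 : 0 < α := by
    have : 0 < n * α := by rw [hα]; positivity
    exact pos_of_mul_pos_right this hn'.le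
  refine ⟨hn, reg_per e f R hα, fun i j hij hj => ?_⟩
  rw [reg, reg, reg, tr_circle h]
  have hs : 0 < Real.sin R := Real.sin_pos_of_pos_of_lt_pi hR (by linarith [Real.pi_pos])
  have hc : 0 < Real.cos R := Real.cos_pos_of_mem_Ioo ⟨by linarith, hR'⟩
  have key : ∀ k : ℝ, 0 < k → k < n → 0 < Real.sin (k * α / 2) := by
    intro k hk hkn
    apply Real.sin_pos_of_pos_of_lt_pi (by positivity)
    have := mul_lt_mul_of_pos_right hkn hα0
    linarith
  have hij' : (i : ℝ) + 1 < j := by exact_mod_cast hij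
  have hj' : (j : ℝ) < i + n := by exact_mod_cast hj
  have h1 := key 1 one_pos (by exact_mod_cast (by omega : 1 < n))
  have h2 := key (j - (i + 1)) (by linarith) (by linarith)
  have h3 := key (j - i) (by linarith) (by linarith)
  push_cast
  rw [← sub_mul, ← sub_mul, ← sub_mul, add_sub_cancel_left]
  positivity

/-- The inradius of a regular polygon in terms of its circumradius. -/
structure IsRadii (R r α : ℝ) : Prop where
  circum_pos : 0 < R
  circum_lt : R < Real.pi / 2
  in_pos : 0 < r
  in_lt : r < Real.pi / 2
  eq : Real.sin R * Real.cos (α / 2) * Real.cos r = Real.cos R * Real.sin r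

namespace IsRadii

variable {R r α : ℝ}

lemma sin_circum (h : IsRadii R r α) : 0 < Real.sin R :=
  Real.sin_pos_of_pos_of_lt_pi h.circum_pos (by linarith [Real.pi_pos, h.circum_lt])

lemma cos_circum (h : IsRadii R r α) : 0 < Real.cos R :=
  Real.cos_pos_of_mem_Ioo ⟨by linarith [h.circum_pos, Real.pi_pos], h.circum_lt⟩

lemma cos_in (h : IsRadii R r α) : 0 < Real.cos r :=
  Real.cos_pos_of_mem_Ioo ⟨by linarith [h.in_pos, Real.pi_pos], h.in_lt⟩

lemma ed_reg (h : IsRadii R r α) {e f : E3} (hf : IsFrame e f) (hα : 0 < α)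
    (hα' : α < Real.pi) (i : ℤ) : ed (reg e f R α) i =
      fr e f (-Real.cos r * Real.cos ((i + 1 / 2) * α)) (-Real.cos r * Real.sin ((i + 1 / 2) * α))
        (Real.sin r) := by
  -- `D` is the cosine of half the side, and 2 sin R sin (α/2) `D`, the length of the cross product,
  -- is the sine of the side.
  set D := Real.cos R / Real.cos r with hD
  have hcr := h.cos_in.ne'
  have hD0 : 0 < D := div_pos h.cos_circum h.cos_in
  have hD1 : D * Real.cos r = Real.cos R := div_mul_cancel₀ _ hcr
  have hD2 : D * Real.sin r = Real.sin R * Real.cos (α / 2) := by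
    apply mul_right_cancel₀ hcr
    rw [h.eq, ← hD1]; ring
  have hs : 0 < Real.sin (α / 2) := Real.sin_pos_of_pos_of_lt_pi (by linarith) (by linarith)
  have e1 : ((i : ℤ) : ℝ) * α = (i + 1 / 2) * α - α / 2 := by ring
  have e2 : ((i + 1 : ℤ) : ℝ) * α = (i + 1 / 2) * α + α / 2 := by push_cast; ring
  have hcr : cr (reg e f R α i) (reg e f R α (i + 1)) =
      (2 * Real.sin R * Real.sin (α / 2) * D) • fr e f (-Real.cos r * Real.cos ((i + 1 / 2) * α))
        (-Real.cos r * Real.sin ((i + 1 / 2) * α)) (Real.sin r) := by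
    rw [reg, reg, hf.cr_fr, smul_fr, e1, e2, Real.cos_sub, Real.cos_add, Real.sin_sub,
      Real.sin_add]
    have hsc := Real.sin_sq_add_cos_sq (((i : ℝ) + 1 / 2) * α)
    congr 1
    · linear_combination (2 * Real.sin R * Real.sin (α / 2) * Real.cos ((i + 1 / 2) * α)) * hD1
    · linear_combination (2 * Real.sin R * Real.sin (α / 2) * Real.sin ((i + 1 / 2) * α)) * hD1
    · linear_combination (-2 * Real.sin R * Real.sin (α / 2)) * hD2 +
        (2 * Real.sin R ^ 2 * Real.sin (α / 2) * Real.cos (α / 2)) * hsc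
  have hsR := h.sin_circum
  rw [ed, hcr, nrm_smul (by positivity), nrm_of_unit]
  apply hf.norm_fr
  linear_combination Real.cos r ^ 2 * Real.sin_sq_add_cos_sq (((i : ℝ) + 1 / 2) * α) +
    Real.sin_sq_add_cos_sq r

/-- The exterior angles of a regular polygon. -/
lemma angle_ed (h : IsRadii R r α) {e f : E3} (hf : IsFrame e f) (hα : 0 < α)
    (hα' : α < Real.pi) (i : ℤ) : angle (ed (reg e f R α) (i - 1)) (ed (reg e f R α) i) =
      2 * Real.arcsin (Real.cos r * Real.sin (α / 2)) := by
  have hs : 0 < Real.sin (α / 2) := Real.sin_pos_of_pos_of_lt_pi (by linarith) (by linarith)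
  have hx0 : 0 ≤ Real.cos r * Real.sin (α / 2) := mul_nonneg h.cos_in.le hs.le
  have hx1 : Real.cos r * Real.sin (α / 2) ≤ 1 :=
    mul_le_one₀ (Real.cos_le_one _) hs.le (Real.sin_le_one _)
  have hn : ∀ i : ℤ, ‖fr e f (-Real.cos r * Real.cos ((i + 1 / 2) * α))
      (-Real.cos r * Real.sin ((i + 1 / 2) * α)) (Real.sin r)‖ = 1 := fun i => by
    apply hf.norm_fr
    linear_combination Real.cos r ^ 2 * Real.sin_sq_add_cos_sq (((i : ℝ) + 1 / 2) * α) +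
      Real.sin_sq_add_cos_sq r
  rw [h.ed_reg hf hα hα', h.ed_reg hf hα hα', angle, hn, hn, hf.inner_fr, mul_one, div_one]
  have e1 : -Real.cos r * Real.cos (((i - 1 : ℤ) + 1 / 2) * α) *
      (-Real.cos r * Real.cos ((i + 1 / 2) * α)) +
      -Real.cos r * Real.sin (((i - 1 : ℤ) + 1 / 2) * α) *
      (-Real.cos r * Real.sin ((i + 1 / 2) * α)) + Real.sin r * Real.sin r =
      Real.cos (2 * Real.arcsin (Real.cos r * Real.sin (α / 2))) := by
    rw [Real.cos_two_mul, Real.cos_sq', Real.sin_arcsin (by linarith) hx1]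
    have e2 : Real.cos α = Real.cos ((i + 1 / 2) * α - ((i - 1 : ℤ) + 1 / 2) * α) := by
      congr 1; push_cast; ring
    rw [Real.cos_sub] at e2
    have e3 := Real.cos_two_mul (α / 2)
    rw [mul_div_cancel₀ _ two_ne_zero, Real.cos_sq'] at e3
    linear_combination Real.cos r ^ 2 * (e3 - e2) + Real.sin_sq_add_cos_sq r
  rw [e1, Real.arccos_cos (by linarith [Real.arcsin_nonneg.2 hx0])
    (by linarith [Real.arcsin_le_pi_div_two (Real.cos r * Real.sin (α / 2))])]

lemma area_reg (h : IsRadii R r α) {e f : E3} (hf : IsFrame e f) {n : ℕ} (hn : 3 ≤ n)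
    (hα : n * α = 2 * Real.pi) (hα0 : 0 < α) (hα' : α < Real.pi) : area (body (reg e f R α)) =
      2 * Real.pi - 2 * (n * Real.arcsin (Real.cos r * Real.sin (α / 2))) := by
  rw [(cycle_reg hf hn h.circum_pos h.circum_lt hα).area_body,
    Finset.sum_congr rfl fun (i : ℕ) _ => h.angle_ed hf hα0 hα' i, Finset.sum_const,
    Finset.card_range, nsmul_eq_mul]
  ring

end IsRadii

/-- The midpoint of the edge of the polar of a regular polygon that belongs to the vertex `i`. -/
def polarMid (e f : E3) (R α : ℝ) (i : ℤ) : E3 :=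
  fr e f (-Real.cos R * Real.cos (i * α)) (-Real.cos R * Real.sin (i * α)) (Real.sin R)

namespace IsRadii

variable {R r α : ℝ} {e f : E3}

lemma norm_polarMid (hf : IsFrame e f) (i : ℤ) : ‖polarMid e f R α i‖ = 1 := by
  apply hf.norm_fr
  linear_combination Real.cos R ^ 2 * Real.sin_sq_add_cos_sq (i * α) + Real.sin_sq_add_cos_sq R

lemma polarMid_mem (h : IsRadii R r α) (hf : IsFrame e f) (i : ℤ) :
    polarMid e f R α i ∈ dualCone (reg e f R α) := by
  intro l
  rw [polarMid, reg, hf.inner_fr]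
  have h1 := Real.cos_le_one (i * α - l * α)
  rw [Real.cos_sub] at h1
  have := mul_nonneg (mul_pos h.cos_circum h.sin_circum).le (sub_nonneg.2 h1)
  linarith

lemma le_inner_polarMid_ed (h : IsRadii R r α) (hf : IsFrame e f) (hα : 0 < α)
    (hα' : α < Real.pi) (i l : ℤ) :
    -Real.cos (R + r) ≤ inner ℝ (polarMid e f R α i) (ed (reg e f R α) l) := by
  rw [h.ed_reg hf hα hα', polarMid, hf.inner_fr, Real.cos_add]
  have h1 := Real.neg_one_le_cos (i * α - (l + 1 / 2) * α)
  rw [Real.cos_sub] at h1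
  have := mul_nonneg (mul_pos h.cos_circum h.cos_in).le (neg_le_iff_add_nonneg.1 h1)
  linarith

variable {c : ℕ}

/-- Because 2c + 1 is odd, the normal i + c lies in the plane through the axis and `reg e f R α i`.
It is joined to the midpoint of the polar edge i by a chord orthogonal to that edge, of length π -
(R + r). -/
lemma ed_opposite (h : IsRadii R r α) (hf : IsFrame e f) (hα : 0 < α)
    (hα' : α < Real.pi) (hc : (2 * c + 1 : ℕ) * α = 2 * Real.pi) (i : ℤ) :
    ed (reg e f R α) (i + c) =
      -Real.cos (R + r) • polarMid e f R α i + Real.sin (R + r) • reg e f R α i := by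
  have e1 : ((i + c : ℤ) + 1 / 2 : ℝ) * α = i * α + Real.pi := by
    push_cast at hc ⊢
    linarith
  have e2 : Real.cos r = Real.cos (R + r - R) := by ring_nf
  have e3 : Real.sin r = Real.sin (R + r - R) := by ring_nf
  rw [Real.cos_sub] at e2
  rw [Real.sin_sub] at e3
  rw [h.ed_reg hf hα hα', e1, Real.cos_add_pi, Real.sin_add_pi, polarMid, reg, smul_fr, smul_fr,
    e2, e3, fr, fr, fr]
  module

lemma inner_ed_opposite (h : IsRadii R r α) (hf : IsFrame e f) (hα : 0 < α)
    (hα' : α < Real.pi) (hc : (2 * c + 1 : ℕ) * α = 2 * Real.pi) (i : ℤ) :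
    inner ℝ (polarMid e f R α i) (ed (reg e f R α) (i + c)) = -Real.cos (R + r) := by
  rw [h.ed_opposite hf hα hα' hc, inner_add_right, real_inner_smul_right, real_inner_smul_right,
    inner_self_unit (norm_polarMid hf i), polarMid, reg, hf.inner_fr]
  linear_combination (-Real.sin (R + r) * Real.cos R * Real.sin R) *
    Real.sin_sq_add_cos_sq (i * α)

lemma le_inner_ed (h : IsRadii R r α) (hf : IsFrame e f) (hα : 0 < α)
    (hα' : α < Real.pi) (hc : (2 * c + 1 : ℕ) * α = 2 * Real.pi) {x : E3}
    (hx : x ∈ dualCone (reg e f R α)) (i : ℤ) :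
    -Real.cos (R + r) * inner ℝ (polarMid e f R α i) x ≤
      inner ℝ (ed (reg e f R α) (i + c)) x := by
  rw [h.ed_opposite hf hα hα' hc, inner_add_left, real_inner_smul_left, real_inner_smul_left]
  have h1 := hx i
  rw [real_inner_comm] at h1
  have h2 : 0 ≤ Real.sin (R + r) := Real.sin_nonneg_of_nonneg_of_le_pi
    (by linarith [h.circum_pos, h.in_pos]) (by linarith [h.circum_lt, h.in_lt])
  have := mul_nonneg h2 h1
  linarith

lemma three_le (hα : 0 < α) (hα' : α < Real.pi) (hc : (2 * c + 1 : ℕ) * α = 2 * Real.pi) :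
    3 ≤ 2 * c + 1 := by
  by_contra hlt
  have : c = 0 := by omega
  rw [this] at hc
  push_cast at hc
  linarith

/-- The chord from an edge midpoint to its opposite vertex shows μ ≤ -cos (R + r). Conversely, a
diameter may be taken to end at a vertex, and `le_inner_ed` bounds its cosine below by -cos (R + r),
since cos (R + r) ≥ 0. -/
lemma thickness_reg (h : IsRadii R r α) (hf : IsFrame e f) (hα : 0 < α)
    (hα' : α < Real.pi) (hc : (2 * c + 1 : ℕ) * α = 2 * Real.pi) (hR : R + r ≤ Real.pi / 2) :
    thickness (body (reg e f R α)) = R + r := by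
  have hC := cycle_reg hf (three_le hα hα' hc) h.circum_pos h.circum_lt hc
  have hu := norm_reg hf R α
  obtain ⟨μ, hμ, h1, -, ht⟩ := hC.exists_isMinCos hu
  have hpos : 0 ≤ Real.cos (R + r) :=
    Real.cos_nonneg_of_mem_Icc ⟨by linarith [h.circum_pos, h.in_pos, Real.pi_pos], hR⟩
  have hle := hμ.le _ (h.polarMid_mem hf 0) _ (hC.ed_mem (0 + c))
  rw [h.inner_ed_opposite hf hα hα' hc, norm_polarMid hf, hC.norm_ed, mul_one, mul_one] at hle
  obtain ⟨x, hx, j, hxn, hj⟩ := hC.exists_min_vertex hu hμ (by linarith) h1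
  have h2 := h.le_inner_ed hf hα hα' hc hx (j - c)
  rw [sub_add_cancel, hj] at h2
  have h3 := real_inner_le_norm (polarMid e f R α (j - c)) x
  rw [norm_polarMid hf, hxn, mul_one] at h3
  have h4 := mul_le_mul_of_nonneg_left h3 hpos
  have h5 : μ = -Real.cos (R + r) := by linarith
  rw [ht, h5, Real.arccos_neg, Real.arccos_cos (by linarith [h.circum_pos, h.in_pos])
    (by linarith [Real.pi_pos])]
  ring

/-- Needed because for a given regular polygon only the thickness is known. If R + r > π/2, edge
midpoints have positive inner products with all polar vertices, and the bound of `le_inner_ed` would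
make μ positive. -/
lemma add_eq_thickness (h : IsRadii R r α) (hf : IsFrame e f) (hα : 0 < α)
    (hα' : α < Real.pi) (hc : (2 * c + 1 : ℕ) * α = 2 * Real.pi)
    (ht : thickness (body (reg e f R α)) ≤ Real.pi / 2) :
    R + r = thickness (body (reg e f R α)) := by
  rcases le_or_gt (R + r) (Real.pi / 2) with hR | hR
  · exact (h.thickness_reg hf hα hα' hc hR).symm
  exfalso
  have hC := cycle_reg hf (three_le hα hα' hc) h.circum_pos h.circum_lt hc
  have hu := norm_reg hf R α
  obtain ⟨μ, hμ, h1, -, ht'⟩ := hC.exists_isMinCos hu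
  have h0 : μ ≤ 0 := by
    by_contra hlt
    push Not at hlt
    have := Real.arccos_lt_pi_div_two.2 hlt
    linarith
  have hpos : 0 < -Real.cos (R + r) := by
    have := Real.cos_neg_of_pi_div_two_lt_of_lt hR (by linarith [h.circum_lt, h.in_lt])
    linarith
  obtain ⟨x, hx, j, hxn, hj⟩ := hC.exists_min_vertex hu hμ h0 h1
  have h2 := h.le_inner_ed hf hα hα' hc hx (j - c)
  rw [sub_add_cancel, hj] at h2
  obtain ⟨l, a, b, d, ha, hb, hd, ex⟩ := hC.dual.cone_rep (x := x) fun i => by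
    rw [hC.ed_ed hu, real_inner_comm]; exact hx _
  have hin := h.le_inner_polarMid_ed hf hα hα' (j - c)
  have h3 : 0 < inner ℝ (polarMid e f R α (j - c)) x := by
    have h4 : -Real.cos (R + r) * (a + b + d) ≤ inner ℝ (polarMid e f R α (j - c)) x := by
      rw [ex, inner_add_right, inner_add_right, real_inner_smul_right, real_inner_smul_right,
        real_inner_smul_right]
      have := mul_le_mul_of_nonneg_left (hin 0) ha
      have := mul_le_mul_of_nonneg_left (hin l) hb
      have := mul_le_mul_of_nonneg_left (hin (l + 1)) hd
      linarith
    refine lt_of_lt_of_le (mul_pos hpos ?_) h4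
    apply lt_of_le_of_ne (by positivity)
    intro h5
    have ha0 : a = 0 := by linarith
    have hb0 : b = 0 := by linarith
    have hd0 : d = 0 := by linarith
    rw [ex, ha0, hb0, hd0] at hxn
    simp at hxn
  have := mul_pos hpos h3
  linarith

end IsRadii

/-! ### Every regular polygon is in standard position. -/

lemma eq_of_succ_eq {β : Type*} {f : ℤ → β} (h : ∀ i, f (i + 1) = f i) (i : ℤ) : f i = f 0 := by
  have := Function.Periodic.int_mul_eq (f := f) (c := 1) h i
  simpa using this

/-- Solution of the linear recurrence with characteristic roots on the unit circle. -/
lemma eq_cos_add_sin {α : ℝ} (hα : Real.sin α ≠ 0) {z : ℤ → E3}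
    (hz : ∀ i, z (i + 2) = (2 * Real.cos α) • z (i + 1) - z i) (i : ℤ) :
    z i = Real.cos (i * α) • z 0 +
      Real.sin (i * α) • ((Real.sin α)⁻¹ • (z 1 - Real.cos α • z 0)) := by
  set B := (Real.sin α)⁻¹ • (z 1 - Real.cos α • z 0) with hB
  set w : ℤ → E3 := fun i => Real.cos (i * α) • z 0 + Real.sin (i * α) • B with hw
  have hrec : ∀ i, w (i + 2) = (2 * Real.cos α) • w (i + 1) - w i := by
    intro i
    have e1 : ((i + 2 : ℤ) : ℝ) * α = (i + 1 : ℤ) * α + α := by push_cast; ring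
    have e2 : (i : ℝ) * α = (i + 1 : ℤ) * α - α := by push_cast; ring
    simp only [hw]
    rw [e1, e2, Real.cos_add, Real.sin_add, Real.cos_sub, Real.sin_sub]
    module
  have h0 : z 0 = w 0 := by simp [hw]
  have h1 : z 1 = w 1 := by
    simp only [hw, hB]
    rw [Int.cast_one, one_mul, smul_smul, mul_inv_cancel₀ hα]
    module
  have key : ∀ i, z i = w i ∧ z (i + 1) = w (i + 1) := by
    intro i
    induction i using Int.induction_on with
    | zero => exact ⟨h0, h1⟩
    | succ i ih =>
      refine ⟨ih.2, ?_⟩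
      rw [add_assoc, one_add_one_eq_two, hz, hrec, ih.1, ih.2]
    | pred i ih =>
      rw [sub_add_cancel]
      refine ⟨?_, ih.1⟩
      have e1 := hz (-(i : ℤ) - 1)
      have e2 := hrec (-(i : ℤ) - 1)
      rw [show -(i : ℤ) - 1 + 2 = -i + 1 by ring, sub_add_cancel] at e1 e2
      rw [ih.1, ih.2] at e1
      have e3 : z (-(i : ℤ) - 1) = (2 * Real.cos α) • w (-i) - w (-i + 1) := by rw [e1]; abel
      rw [e3, e2]; abel
  exact (key i).1

/-- A rotation angle for which the orbit is in convex position is the least possible one. -/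
lemma angle_eq_of_sin_pos {n : ℕ} (hn : 3 ≤ n) {α : ℝ} (hα : 0 < α) (hα' : α < Real.pi)
    (hcos : Real.cos (n * α) = 1) (hsin : ∀ k : ℕ, 1 ≤ k → k < n → 0 < Real.sin (k * α / 2)) :
    n * α = 2 * Real.pi := by
  have hn' : (0 : ℝ) < n := by positivity
  have hpi := Real.pi_pos
  obtain ⟨m, hm⟩ := (Real.cos_eq_one_iff _).1 hcos
  have hm0 : 0 < m := by
    have : 0 < (m : ℝ) * (2 * Real.pi) := by rw [hm]; positivity
    exact_mod_cast pos_of_mul_pos_left this (by positivity)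
  obtain ⟨m, rfl⟩ := Int.eq_ofNat_of_zero_le hm0.le
  rw [Int.cast_natCast] at hm
  have hm2 : 2 * m < n := by
    have h1 : (m : ℝ) * (2 * Real.pi) < n * Real.pi := by
      rw [hm]; exact mul_lt_mul_of_pos_left hα' hn'
    have h2 : (2 * m : ℝ) < n := by nlinarith
    exact_mod_cast h2
  have hm1 : m = 1 := by
    by_contra hne
    have hm1 : 2 ≤ m := by omega
    have h1 : n / m ≤ n / 2 := Nat.div_le_div_left hm1 (by norm_num)
    have h2 : n < m * (n / m + 1) := Nat.lt_mul_div_succ n (by omega)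
    have h3 : m * (n / m) ≤ n := Nat.mul_div_le n m
    -- If the orbit winds m ≥ 2 times, then n < m k < 2n for this k, so k α / 2 = m k π / n is
    -- between π and 2π, where the sine is negative.
    set k := n / m + 1 with hk
    have h4 := hsin k (Nat.le_add_left 1 _) (by omega)
    have h5 : m * k < 2 * n := by
      have : m * k = m * (n / m) + m := by rw [hk]; ring
      omega
    have h2' : (n : ℝ) < m * k := by exact_mod_cast h2
    have h5' : (m : ℝ) * k < 2 * n := by exact_mod_cast h5
    have h6 : n * (k * α / 2) = m * k * Real.pi := by
      rw [show n * (k * α / 2) = k * (n * α) / 2 by ring, ← hm]; ring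
    have h7 : Real.pi < k * α / 2 := by
      by_contra hc
      push Not at hc
      have a1 := mul_le_mul_of_nonneg_left hc hn'.le
      have a2 := mul_lt_mul_of_pos_right h2' hpi
      linarith
    have h8 : k * α / 2 < 2 * Real.pi := by
      by_contra hc
      push Not at hc
      have a1 := mul_le_mul_of_nonneg_left hc hn'.le
      have a2 := mul_lt_mul_of_pos_right h5' hpi
      linarith
    have h9 : 0 < Real.sin (k * α / 2 - Real.pi) :=
      Real.sin_pos_of_pos_of_lt_pi (by linarith) (by linarith)
    rw [Real.sin_sub_pi] at h9
    linarith
  rw [← hm, hm1]; simp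

namespace Cycle

variable {n : ℕ} {u : ℤ → E3}

/-- The inner products s and d fix the square of the determinant of three consecutive vertices, and
convexity fixes its sign. Both sides therefore have the same inner products with two consecutive
vertices and with their cross product. -/
lemma three_term_recurrence (h : Cycle n u) (hu : ∀ i, ‖u i‖ = 1) {s d : ℝ}
    (hs : ∀ i, inner ℝ (u i) (u (i + 1)) = s) (hd : ∀ i, inner ℝ (u i) (u (i + 2)) = d)
    (hs1 : s < 1) (i : ℤ) :
    u (i + 3) = u i + ((s - d) / (1 - s)) • (u (i + 2) - u (i + 1)) := by
  have h3 := h.three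
  have hτ : ∀ i, tr (u i) (u (i + 1)) (u (i + 2)) * tr (u i) (u (i + 1)) (u (i + 2)) =
      1 - 2 * s ^ 2 + 2 * s ^ 2 * d - d ^ 2 := by
    intro i
    have e := hs (i + 1)
    rw [add_assoc, one_add_one_eq_two] at e
    rw [tr_mul_tr, inner_self_unit (hu _), inner_self_unit (hu _), inner_self_unit (hu _),
      real_inner_comm (u i) (u (i + 1)), real_inner_comm (u i) (u (i + 2)),
      real_inner_comm (u (i + 1)) (u (i + 2)), hs, hd, e]
    ring
  have hpos : ∀ i, 0 < tr (u i) (u (i + 1)) (u (i + 2)) := fun i =>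
    h.pos i (i + 2) (by omega) (by omega)
  have hττ : tr (u i) (u (i + 1)) (u (i + 2)) = tr (u (i + 1)) (u (i + 2)) (u (i + 3)) := by
    have e1 := hτ i
    have e2 := hτ (i + 1)
    have p1 := hpos i
    have p2 := hpos (i + 1)
    rw [show i + 1 + 1 = i + 2 by ring, show i + 1 + 2 = i + 3 by ring] at e2 p2
    rw [← e2] at e1
    exact (mul_self_inj p1.le p2.le).1 e1
  have hs12 : inner ℝ (u (i + 1)) (u (i + 2)) = s := by
    rw [show i + 2 = i + 1 + 1 by ring, hs]
  have hs23 : inner ℝ (u (i + 2)) (u (i + 3)) = s := by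
    rw [show i + 3 = i + 2 + 1 by ring, hs]
  have hd13 : inner ℝ (u (i + 1)) (u (i + 3)) = d := by
    rw [show i + 3 = i + 1 + 2 by ring, hd]
  have hs1' : 1 - s ≠ 0 := by linarith
  rw [← sub_eq_zero]
  refine eq_zero_of_inner (a := u (i + 1)) (b := u (i + 2))
    (c := cr (u (i + 1)) (u (i + 2))) ?_ ?_ ?_ ?_
  · have := h.cr_ne_zero (i + 1)
    rw [show i + 1 + 1 = i + 2 by ring] at this
    rwa [tr, Ne, inner_self_eq_zero]
  · rw [inner_sub_right, inner_add_right, real_inner_smul_right, inner_sub_right, hd13, hs12,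
      inner_self_unit (hu _), real_inner_comm, hs]
    field_simp
    ring
  · rw [inner_sub_right, inner_add_right, real_inner_smul_right, inner_sub_right, hs23,
      inner_self_unit (hu _), real_inner_comm, hd, real_inner_comm, hs12]
    field_simp
    ring
  · have e : tr (u (i + 1)) (u (i + 2)) (u i) = tr (u i) (u (i + 1)) (u (i + 2)) :=
      (tr_rotate _ _ _).symm
    rw [inner_sub_right, inner_add_right, real_inner_smul_right, inner_sub_right, inner_cr_left,
      inner_cr_right]
    change tr _ _ _ - (tr _ _ _ + _) = 0
    rw [e, hττ]; ring

/-- A convex equilateral and equiangular cycle is inscribed in a circle, with equally spaced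
vertices. -/
lemma exists_reg (h : Cycle n u) (hu : ∀ i, ‖u i‖ = 1) {s d : ℝ}
    (hs : ∀ i, inner ℝ (u i) (u (i + 1)) = s) (hd : ∀ i, inner ℝ (u i) (u (i + 2)) = d) :
    ∃ e f R α, IsFrame e f ∧ 0 < R ∧ R < Real.pi / 2 ∧ n * α = 2 * Real.pi ∧ 0 < α ∧
      α < Real.pi ∧ u = reg e f R α := by
  have h3 := h.three
  have hs1 : s < 1 := by
    have h1 := real_inner_le_norm (u 0) (u (0 + 1))
    rw [hs, hu, hu, mul_one] at h1
    apply lt_of_le_of_ne h1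
    intro e
    rw [← hs 0, inner_eq_one_iff_of_norm_eq_one (hu _) (hu _)] at e
    exact h.succ_ne 0 e.symm
  have hrec := h.three_term_recurrence hu hs hd hs1
  have hgram : 0 < (1 - d) * (1 + d - 2 * s ^ 2) := by
    have hp := h.pos 0 2 (by omega) (by omega)
    have e1 := hs 1
    have e2 := hs 0
    have e3 := hd 0
    rw [zero_add] at e2 e3 hp
    rw [one_add_one_eq_two] at e1
    have e := tr_mul_tr (u 0) (u 1) (u 2) (u 0) (u 1) (u 2)
    rw [inner_self_unit (hu _), inner_self_unit (hu _), inner_self_unit (hu _),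
      real_inner_comm (u 0) (u 1), real_inner_comm (u 0) (u 2), real_inner_comm (u 1) (u 2),
      e1, e2, e3] at e
    have := mul_pos hp hp
    linarith
  have hd1 : d < 1 := by
    have h1 := real_inner_le_norm (u 0) (u (0 + 2))
    rw [hd, hu, hu, mul_one] at h1
    apply lt_of_le_of_ne h1
    rintro rfl
    simp at hgram
  have hd2 : 0 < 1 + d - 2 * s ^ 2 := pos_of_mul_pos_right hgram (by linarith)
  set t := (s - d) / (1 - s) with ht
  have hts : t * (1 - s) = s - d := div_mul_cancel₀ _ (by linarith)
  -- The bound t > -1 amounts to d < 1, and t < 3 to d > 4s - 3, which follows from d > 2s² - 1.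
  have ht1 : -1 < t := by
    by_contra hc
    push Not at hc
    have := mul_nonneg (by linarith : 0 ≤ -1 - t) (by linarith : 0 ≤ 1 - s)
    linarith
  have ht3 : t < 3 := by
    by_contra hc
    push Not at hc
    have := mul_nonneg (by linarith : 0 ≤ t - 3) (by linarith : 0 ≤ 1 - s)
    nlinarith [sq_nonneg (s - 1)]
  -- The characteristic polynomial of the recurrence is (x - 1)(x² - (t - 1) x + 1), with roots 1
  -- and exp (±iα).
  set α := Real.arccos ((t - 1) / 2) with hα
  have hcosα : Real.cos α = (t - 1) / 2 := Real.cos_arccos (by linarith) (by linarith)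
  have hα0 : 0 < α := Real.arccos_pos.2 (by linarith)
  have hαπ : α < Real.pi := by
    apply lt_of_le_of_ne (Real.arccos_le_pi _)
    intro e
    rw [Real.arccos_eq_pi] at e
    linarith
  have hsinα : 0 < Real.sin α := Real.sin_pos_of_pos_of_lt_pi hα0 hαπ
  -- This combination is invariant under the recurrence, corresponding to the root 1. Divided by 3 -
  -- t, it is the center C of the circle in its plane.
  set N : ℤ → E3 := fun i => u (i + 2) + (1 - t) • u (i + 1) + u i with hN
  have hN0 : ∀ i, N i = N 0 := by
    apply eq_of_succ_eq
    intro i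
    simp only [hN]
    rw [show i + 1 + 2 = i + 3 by ring, show i + 1 + 1 = i + 2 by ring, hrec]
    module
  set C := (3 - t)⁻¹ • N 0 with hC
  have h3t : 3 - t ≠ 0 := by linarith
  have hNC : N 0 = (3 - t) • C := by rw [hC, smul_smul, mul_inv_cancel₀ h3t, one_smul]
  set z : ℤ → E3 := fun i => u i - C with hz
  have hzrec : ∀ i, z (i + 2) = (2 * Real.cos α) • z (i + 1) - z i := by
    intro i
    have e : u (i + 2) = N i - (1 - t) • u (i + 1) - u i := by simp only [hN]; abel
    simp only [hz]
    rw [e, hN0, hNC, hcosα]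
    module
  have huC : ∀ i, inner ℝ (u (i + 1)) C = (3 - t)⁻¹ * (2 * s + 1 - t) := by
    intro i
    rw [hC, real_inner_smul_right, ← hN0 i]
    simp only [hN]
    rw [inner_add_right, inner_add_right, real_inner_smul_right, inner_self_unit (hu _),
      real_inner_comm (u i), hs, show i + 2 = i + 1 + 1 by ring, hs]
    ring
  -- The inner product does not depend on i, and the recurrence for z multiplies this constant by t
  -- - 2. As t ≠ 3, it is zero.
  have hzC : ∀ i, inner ℝ (z i) C = 0 := by
    have e1 : ∀ i, inner ℝ (z (i + 1)) C = inner ℝ (z (0 + 1)) C := fun i => by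
      simp only [hz]
      rw [inner_sub_left, inner_sub_left, huC, huC]
    have e2 := congrArg (fun x => inner ℝ x C) (hzrec 1)
    simp only [inner_sub_left, real_inner_smul_left] at e2
    rw [show (1 : ℤ) + 2 = 2 + 1 by ring, e1 2, e1 1, hcosα] at e2
    have e3 := e1 0
    have e4 : (3 - t) * inner ℝ (z (0 + 1)) C = 0 := by
      rw [zero_add] at e2 ⊢
      linarith
    intro i
    have e5 := e1 (i - 1)
    rw [sub_add_cancel] at e5
    rw [e5]
    exact (mul_eq_zero.1 e4).resolve_left h3t
  set ρ2 := 1 - inner ℝ C C with hρ2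
  have huC' : ∀ i, inner ℝ (u i) C = inner ℝ C C := fun i => by
    have := hzC i
    simp only [hz, inner_sub_left] at this
    linarith
  have hzz : ∀ i, inner ℝ (z i) (z i) = ρ2 := fun i => by
    simp only [hz]
    rw [inner_sub_left, inner_sub_right, inner_sub_right, real_inner_comm (u i) C, huC',
      inner_self_unit (hu i)]
    ring
  have hzg : ∀ i, inner ℝ (z i) (z (i + 1)) = s - inner ℝ C C := fun i => by
    simp only [hz]
    rw [inner_sub_left, inner_sub_right, inner_sub_right, real_inner_comm (u (i + 1)) C, huC',
      huC', hs]
    ring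
  have hg : s - inner ℝ C C = Real.cos α * ρ2 := by
    have e := congrArg (fun x => inner ℝ x (z (0 + 1))) (hzrec 0)
    simp only [inner_sub_left, real_inner_smul_left] at e
    rw [hzz, hzg, real_inner_comm, show (0 : ℤ) + 2 = 0 + 1 + 1 by ring, hzg] at e
    linarith
  clear_value z C
  set A := z 0 with hA
  set B := (Real.sin α)⁻¹ • (z 1 - Real.cos α • z 0) with hB
  have hform : ∀ i : ℤ, z i = Real.cos (i * α) • A + Real.sin (i * α) • B :=
    eq_cos_add_sin hsinα.ne' hzrec
  have hz01 : inner ℝ (z 0) (z 1) = Real.cos α * ρ2 := by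
    rw [← hg, ← hzg 0, zero_add]
  have hAA : inner ℝ A A = ρ2 := hzz 0
  have hAB : inner ℝ A B = 0 := by
    rw [hB, real_inner_smul_right, inner_sub_right, real_inner_smul_right, hz01, hzz]; ring
  have hBB : inner ℝ B B = ρ2 := by
    rw [hB, real_inner_smul_right, real_inner_smul_left, inner_sub_left, inner_sub_right,
      inner_sub_right, real_inner_smul_right, real_inner_smul_right, real_inner_smul_left,
      real_inner_smul_left, real_inner_comm (z 0) (z 1), hz01, hzz, hzz]
    field_simp
    linear_combination (-ρ2) * Real.sin_sq_add_cos_sq α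
  have hCA : inner ℝ A C = 0 := hzC 0
  have hCB : inner ℝ B C = 0 := by
    rw [hB, real_inner_smul_left, inner_sub_left, real_inner_smul_left, hzC, hzC]; ring
  have hρ0 : 0 < ρ2 := by
    rw [← hAA]
    apply lt_of_le_of_ne real_inner_self_nonneg
    intro e
    have a1 : z 0 = 0 := inner_self_eq_zero.1 ((hzz 0).trans (hAA.symm.trans e.symm))
    have a2 : z 1 = 0 := inner_self_eq_zero.1 ((hzz 1).trans (hAA.symm.trans e.symm))
    simp only [hz, sub_eq_zero] at a1 a2
    exact h.succ_ne 0 (by rw [zero_add, a1, a2])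
  set ρ := √ρ2 with hρ
  have hρpos : 0 < ρ := Real.sqrt_pos.2 hρ0
  have hρsq : ρ ^ 2 = ρ2 := Real.sq_sqrt hρ0.le
  set e := ρ⁻¹ • A with he
  set f := ρ⁻¹ • B with hf
  have hAe : A = ρ • e := by rw [he, smul_smul, mul_inv_cancel₀ hρpos.ne', one_smul]
  have hBf : B = ρ • f := by rw [hf, smul_smul, mul_inv_cancel₀ hρpos.ne', one_smul]
  have hnorm : ∀ x : E3, inner ℝ x x = ρ2 → ‖ρ⁻¹ • x‖ = 1 := fun x hx => by
    rw [real_inner_self_eq_norm_sq] at hx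
    rw [norm_smul, Real.norm_of_nonneg (inv_nonneg.2 hρpos.le), hρ, ← hx,
      Real.sqrt_sq (norm_nonneg _), inv_mul_cancel₀]
    intro hx0
    rw [hx0] at hx
    simp at hx
    linarith
  have hframe : IsFrame e f := ⟨hnorm A hAA, hnorm B hBB, by
    rw [he, hf, real_inner_smul_left, real_inner_smul_right, hAB]; ring⟩
  have hc1 : inner ℝ (cr e f) (cr e f) = 1 := by
    rw [inner_cr_cr, inner_self_unit hframe.norm_left, inner_self_unit hframe.norm_right,
      hframe.inner_eq]; ring
  set y := inner ℝ (cr e f) C with hy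
  have hCy : C = y • cr e f := by
    rw [← sub_eq_zero]
    refine eq_zero_of_inner (a := e) (b := f) (c := cr e f) ?_ ?_ ?_ ?_
    · rw [tr, hc1]; norm_num
    · rw [inner_sub_right, real_inner_smul_right, real_inner_comm (cr e f) e, inner_cr_left, he,
        real_inner_smul_left, hCA]; ring
    · rw [inner_sub_right, real_inner_smul_right, real_inner_comm (cr e f) f, inner_cr_right, hf,
        real_inner_smul_left, hCB]; ring
    · rw [inner_sub_right, real_inner_smul_right, hc1]; ring
  have hyρ : ρ ^ 2 + y ^ 2 = 1 := by
    have : inner ℝ C C = y ^ 2 := by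
      rw [hCy, real_inner_smul_left, real_inner_smul_right, hc1]; ring
    rw [hρsq, hρ2, this]; ring
  have huf : ∀ i : ℤ, u i = fr e f (ρ * Real.cos (i * α)) (ρ * Real.sin (i * α)) y := fun i => by
    have : u i = z i + C := by simp only [hz]; abel
    rw [this, hform, hCy, hAe, hBf, fr]
    module
  -- Convexity, written in sines: k = 2 gives y > 0, then induction gives sin (k α / 2) > 0 for k <
  -- n, so the orbit winds around only once.
  have htr : ∀ k : ℕ, 2 ≤ k → k < n → 0 < 4 * y * ρ ^ 2 * (Real.sin (α / 2) *
      Real.sin ((k - 1) * α / 2) * Real.sin (k * α / 2)) := by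
    intro k hk hkn
    have e := h.pos 0 k (by omega) (by omega)
    rw [huf, huf, huf, tr_circle hframe] at e
    convert e using 5 <;> push_cast <;> ring
  have hhalf : 0 < Real.sin (α / 2) := Real.sin_pos_of_pos_of_lt_pi (by linarith) (by linarith)
  have hy0 : 0 < y := by
    have e := htr 2 le_rfl (by omega)
    rw [show ((2 : ℕ) - 1 : ℝ) * α / 2 = α / 2 by push_cast; ring,
      show ((2 : ℕ) : ℝ) * α / 2 = α by push_cast; ring] at e
    have h5 : 0 < 4 * ρ ^ 2 * (Real.sin (α / 2) * Real.sin (α / 2) * Real.sin α) := by positivity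
    have h6 : 0 < y * (4 * ρ ^ 2 * (Real.sin (α / 2) * Real.sin (α / 2) * Real.sin α)) := by
      linarith
    exact pos_of_mul_pos_left h6 h5.le
  have hsin : ∀ k : ℕ, 1 ≤ k → k < n → 0 < Real.sin (k * α / 2) := by
    intro k hk
    induction k, hk using Nat.le_induction with
    | base => intro _; simpa using hhalf
    | succ k hk ih =>
      intro hkn
      have e := htr (k + 1) (by omega) hkn
      have h5 := ih (by omega)
      rw [show ((k + 1 : ℕ) - 1 : ℝ) * α / 2 = k * α / 2 by push_cast; ring, ← mul_assoc] at e
      exact pos_of_mul_pos_right e (by positivity)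
  have hcos : Real.cos (n * α) = 1 := by
    have e1 : z (0 + n) = z 0 := by simp only [hz]; rw [h.per]
    have e2 := congrArg (fun x => inner ℝ A x) (hform (0 + n))
    simp only [e1, inner_add_right, real_inner_smul_right, hAB] at e2
    rw [← hA, hAA] at e2
    push_cast at e2
    rw [zero_add] at e2
    apply mul_right_cancel₀ hρ0.ne'
    linarith
  have hnα := angle_eq_of_sin_pos h3 hα0 hαπ hcos hsin
  have hy1 : y < 1 := by nlinarith
  refine ⟨e, f, Real.arccos y, α, hframe, Real.arccos_pos.2 hy1,
    Real.arccos_lt_pi_div_two.2 hy0, hnα, hα0, hαπ, funext fun i => ?_⟩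
  rw [reg, Real.cos_arccos (by linarith) hy1.le, Real.sin_arccos, huf,
    show 1 - y ^ 2 = ρ ^ 2 by linarith, Real.sqrt_sq hρpos.le]

end Cycle

lemma inner_eq_cos_angle {x y : E3} (hx : ‖x‖ = 1) (hy : ‖y‖ = 1) :
    inner ℝ x y = Real.cos (angle x y) := by
  rw [cos_angle, hx, hy, mul_one, div_one]

lemma inner_orthPart (p a b : S2) : inner ℝ (orthPart p a) (orthPart p b) =
    inner ℝ (a : E3) (b : E3) - inner ℝ (p : E3) (a : E3) * inner ℝ (p : E3) (b : E3) := by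
  rw [orthPart, orthPart, inner_sub_left, inner_sub_right, inner_sub_right, real_inner_smul_left,
    real_inner_smul_left, real_inner_smul_right, real_inner_smul_right,
    inner_self_unit (norm_coe_S2 p), real_inner_comm (p : E3) (a : E3)]
  ring

lemma norm_orthPart (p a : S2) : ‖orthPart p a‖ = √(1 - inner ℝ (p : E3) (a : E3) ^ 2) := by
  rw [← Real.sqrt_sq (norm_nonneg (orthPart p a)), ← real_inner_self_eq_norm_sq, inner_orthPart,
    inner_self_unit (norm_coe_S2 a), pow_two]

lemma exists_inradius {R α : ℝ} (hR : 0 < R) (hR' : R < Real.pi / 2) (hα : 0 < α)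
    (hα' : α < Real.pi) : ∃ r, IsRadii R r α := by
  have hpi := Real.pi_pos
  have hs : 0 < Real.sin R := Real.sin_pos_of_pos_of_lt_pi hR (by linarith)
  have hc : 0 < Real.cos R := Real.cos_pos_of_mem_Ioo ⟨by linarith, hR'⟩
  have hcα : 0 < Real.cos (α / 2) := Real.cos_pos_of_mem_Ioo ⟨by linarith, by linarith⟩
  refine ⟨Real.arctan (Real.tan R * Real.cos (α / 2)), hR, hR', ?_, Real.arctan_lt_pi_div_two _, ?_⟩
  · rw [Real.tan_eq_sin_div_cos]
    exact Real.arctan_pos.2 (by positivity)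
  · have h := Real.tan_mul_cos (Real.cos_arctan_pos (Real.tan R * Real.cos (α / 2))).ne'
    rw [Real.tan_arctan] at h
    rw [← h, Real.tan_eq_sin_div_cos]
    field_simp

/-- A regular polygon in standard position. -/
lemma IsRegular.exists_reg {n : ℕ} {W : Set S2} (h : IsRegular n W) :
    ∃ e f R r α, IsFrame e f ∧ IsRadii R r α ∧ n * α = 2 * Real.pi ∧ 0 < α ∧ α < Real.pi ∧
      W = body (reg e f R α) := by
  obtain ⟨v, hpoly, hccw, hside, hang⟩ := h
  have hn := hpoly.1
  have : NeZero n := ⟨by omega⟩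
  set u : ℤ → S2 := fun i => v (i : ZMod n) with hu
  have hcyc : Cycle n (fun i => (u i : E3)) := by
    refine ⟨hn, fun i => by simp [hu], fun i j hij hj => ?_⟩
    have h1 := hccw (i : ZMod n) (j : ZMod n) ?_ ?_
    · rw [triple_eq_tr] at h1
      simpa [hu] using h1
    · intro e
      rw [ZMod.intCast_eq_intCast_iff_dvd_sub] at e
      obtain ⟨k, hk⟩ := e
      have h1 : (n : ℤ) * (-k) = j - i := by linarith
      have h2 : 0 < -k := by
        by_contra hc
        push Not at hc
        have := mul_nonpos_of_nonneg_of_nonpos (Int.natCast_nonneg n) hc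
        omega
      have := mul_le_mul_of_nonneg_left h2 (Int.natCast_nonneg n)
      omega
    · intro e
      rw [← Int.cast_one, ← Int.cast_add, ZMod.intCast_eq_intCast_iff_dvd_sub] at e
      obtain ⟨k, hk⟩ := e
      have h1 : (n : ℤ) * (-k) = j - (i + 1) := by linarith
      have h2 : 0 < -k := by
        by_contra hc
        push Not at hc
        have := mul_nonpos_of_nonneg_of_nonpos (Int.natCast_nonneg n) hc
        omega
      have := mul_le_mul_of_nonneg_left h2 (Int.natCast_nonneg n)
      omega
  have hW : W = body (fun i => (u i : E3)) := by
    rw [← hcyc.hull_eq, hpoly.2.2.2]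
    congr 1
    ext x
    simp only [Set.mem_range, hu]
    constructor
    · rintro ⟨z, rfl⟩
      obtain ⟨i, rfl⟩ := ZMod.intCast_surjective z
      exact ⟨i, rfl⟩
    · rintro ⟨i, rfl⟩
      exact ⟨_, rfl⟩
  have hs : ∀ i : ℤ, inner ℝ (u i : E3) (u (i + 1) : E3) = inner ℝ (u 0 : E3) (u 1 : E3) := by
    intro i
    rw [inner_eq_cos_angle (norm_coe_S2 _) (norm_coe_S2 _),
      inner_eq_cos_angle (norm_coe_S2 _) (norm_coe_S2 _)]
    have := hside (i : ZMod n) 0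
    rw [sdist, sdist] at this
    simp only [hu]
    push_cast
    rw [this, zero_add]
  set s := inner ℝ (u 0 : E3) (u 1 : E3) with hsdef
  -- The spherical law of cosines: equal sides and equal angles give equal short diagonals.
  have hd : ∀ i : ℤ, inner ℝ (u i : E3) (u (i + 2) : E3) =
      Real.cos (sangle (v (0 - 1)) (v 0) (v (0 + 1))) * (√(1 - s ^ 2) * √(1 - s ^ 2)) + s * s := by
    intro i
    have e1 := hang ((i + 1 : ℤ) : ZMod n) 0
    have e2 := hs i
    have e3 := hs (i + 1)
    have c1 : (((i + 1 : ℤ) : ZMod n) - 1) = (i : ZMod n) := by push_cast; ring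
    have c2 : (((i + 1 : ℤ) : ZMod n) + 1) = ((i + 2 : ℤ) : ZMod n) := by push_cast; ring
    rw [show i + 1 + 1 = i + 2 by ring] at e3
    rw [← e1, c1, c2]
    change inner ℝ (u i : E3) (u (i + 2) : E3) =
      Real.cos (sangle (u i) (u (i + 1)) (u (i + 2))) * _ + s * s
    rw [real_inner_comm] at e2
    have e4 := cos_angle_mul_norm_mul_norm (orthPart (u (i + 1)) (u i))
      (orthPart (u (i + 1)) (u (i + 2)))
    rw [norm_orthPart, norm_orthPart, e2, e3, inner_orthPart, e2, e3] at e4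
    rw [sangle, e4]; ring
  obtain ⟨e, f, R, α, hf, hR, hR', hα, hα0, hαπ, hue⟩ :=
    hcyc.exists_reg (fun i => norm_coe_S2 _) hs hd
  obtain ⟨r, hr⟩ := exists_inradius hR hR' hα0 hαπ
  exact ⟨e, f, R, r, α, hf, hr, hα, hα0, hαπ, by rw [hW, hue]⟩

/-! ### Points equally spaced on a circle form a regular polygon. -/

lemma val_intCast {n : ℕ} [NeZero n] {β : Type*} {u : ℤ → β} (hu : ∀ i, u (i + n) = u i) (i : ℤ) :
    u ((i : ZMod n).val) = u i := by
  rw [ZMod.val_intCast, ← per_mul hu (i % n) (i / n), Int.emod_add_mul_ediv]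

lemma Cycle.isPolygonOn {n : ℕ} {u : ℤ → S2} (h : Cycle n fun i => (u i : E3)) :
    IsPolygonOn (fun z : ZMod n => u z.val) (body fun i => (u i : E3)) := by
  have h3 := h.three
  have : NeZero n := ⟨by omega⟩
  have hper : ∀ i, u (i + n) = u i := fun i => Subtype.ext (h.per i)
  have hrange : Set.range (fun z : ZMod n => u z.val) = Set.range u := by
    ext x
    constructor
    · rintro ⟨z, rfl⟩
      exact ⟨_, rfl⟩
    · rintro ⟨i, rfl⟩
      exact ⟨(i : ZMod n), val_intCast hper i⟩
  refine ⟨h3, ⟨body fun i => (u i : E3), h.isConvex_body, ?_⟩, ?_, ?_⟩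
  · rintro _ ⟨z, rfl⟩
    exact h.vertex_mem_body rfl
  · intro z hz
    set i : ℤ := ((z.val : ℕ) : ℤ) with hi
    -- The part of the polygon beyond the diagonal from i - 1 to i + 1 is convex and contains every
    -- vertex except the vertex i.
    set C : Set S2 := {x | x ∈ body (fun i => (u i : E3)) ∧
      0 ≤ inner ℝ (cr (u (i - 1)) (u (i + 1))) (x : E3)} with hC
    have hconv : IsConvex C := ⟨fun x hx hx' => h.not_antipodal hx.1 hx'.1,
      fun a ha b hb x hx => ⟨h.isConvex_body.2 a ha.1 b hb.1 hx,
        inner_nonneg_of_mem_arc ha.2 hb.2 hx⟩⟩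
    have hmem : u i ∈ C := by
      refine hz C ⟨hconv, ?_⟩
      rintro _ ⟨w, hw, rfl⟩
      refine ⟨h.vertex_mem_body rfl, ?_⟩
      change 0 ≤ tr _ _ _
      obtain ⟨l, h1, h2, e⟩ := exists_rep (n := n) (f := fun i : ℤ => (i : ZMod n)) (by omega)
        (fun i => by simp) (i + 1) ((w.val : ℕ) : ℤ)
      have ew : (l : ZMod n) = w := by simpa using e
      rw [← ew]
      dsimp only
      rw [val_intCast hper]
      rcases eq_or_lt_of_le h1 with rfl | h1
      · rw [tr_self_right]
      have hli : l ≠ i + n := by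
        rintro rfl
        apply hw
        rw [← ew]
        simp [hi]
      rcases eq_or_lt_of_le (show l ≤ i + n - 1 by omega) with rfl | h4
      · rw [show i + (n : ℤ) - 1 = i - 1 + n by ring, hper, tr_self_mid]
      exact (h.pos3 (i := i - 1) (j := i + 1) (l := l) (by omega) (by omega) (by omega)).le
    have h5 := hmem.2
    change 0 ≤ tr _ _ _ at h5
    rw [tr_swap_right] at h5
    have h6 := h.pos3 (i := i - 1) (j := i) (l := i + 1) (by omega) (by omega) (by omega)
    linarith
  · rw [hrange, h.hull_eq]

lemma Cycle.isCounterclockwise {n : ℕ} {u : ℤ → S2} (h : Cycle n fun i => (u i : E3)) :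
    IsCounterclockwise (fun z : ZMod n => u z.val) := by
  have h3 := h.three
  have : NeZero n := ⟨by omega⟩
  have hper : ∀ i, u (i + n) = u i := fun i => Subtype.ext (h.per i)
  intro z w hw hw'
  obtain ⟨i, rfl⟩ := ZMod.intCast_surjective z
  obtain ⟨l, h1, h2, e⟩ := exists_rep (n := n) (f := fun i : ℤ => (i : ZMod n)) (by omega)
    (fun i => by simp) i ((w.val : ℕ) : ℤ)
  have ew : (l : ZMod n) = w := by simpa using e
  subst ew
  have e1 : ((i : ZMod n) + 1) = ((i + 1 : ℤ) : ZMod n) := by push_cast; rfl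
  rw [e1] at hw' ⊢
  dsimp only
  rw [triple_eq_tr, val_intCast hper, val_intCast hper, val_intCast hper]
  refine h.pos i l ?_ h2
  have h4 : l ≠ i := by rintro rfl; exact hw rfl
  have h5 : l ≠ i + 1 := by rintro rfl; exact hw' rfl
  omega

lemma isRegular_body_reg {e f : E3} (hf : IsFrame e f) {n : ℕ} (hn : 3 ≤ n) {R α : ℝ}
    (hR : 0 < R) (hR' : R < Real.pi / 2) (hα : n * α = 2 * Real.pi) :
    IsRegular n (body (reg e f R α)) := by
  have : NeZero n := ⟨by omega⟩
  have hc := cycle_reg hf hn hR hR' hα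
  set u : ℤ → S2 := fun i => ⟨reg e f R α i, by simpa using norm_reg hf R α i⟩ with hu
  have hc' : Cycle n fun i => (u i : E3) := hc
  have hper : ∀ i, u (i + n) = u i := fun i => Subtype.ext (hc.per i)
  have hin : ∀ i j : ℤ, inner ℝ (u i : E3) (u j : E3) =
      Real.sin R ^ 2 * Real.cos ((j - i : ℤ) * α) + Real.cos R ^ 2 := by
    intro i j
    change inner ℝ (reg e f R α i) (reg e f R α j) = _
    rw [reg, reg, hf.inner_fr]
    push_cast
    rw [sub_mul, Real.cos_sub]
    ring
  have hsucc : ∀ i : ℤ, inner ℝ (u i : E3) (u (i + 1) : E3) =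
      Real.sin R ^ 2 * Real.cos α + Real.cos R ^ 2 := fun i => by
    rw [hin]; push_cast; rw [add_sub_cancel_left, one_mul]
  have hpred : ∀ i : ℤ, inner ℝ (u i : E3) (u (i - 1) : E3) =
      Real.sin R ^ 2 * Real.cos α + Real.cos R ^ 2 := fun i => by
    rw [real_inner_comm, ← hsucc (i - 1), sub_add_cancel]
  refine ⟨fun z => u z.val, hc'.isPolygonOn, hc'.isCounterclockwise, fun z w => ?_, fun z w => ?_⟩
  · obtain ⟨i, rfl⟩ := ZMod.intCast_surjective z
    obtain ⟨j, rfl⟩ := ZMod.intCast_surjective w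
    have key : ∀ i : ℤ, sdist (u ((i : ZMod n).val)) (u (((i : ZMod n) + 1).val)) =
        Real.arccos (Real.sin R ^ 2 * Real.cos α + Real.cos R ^ 2) := by
      intro i
      have e1 : ((i : ZMod n) + 1) = ((i + 1 : ℤ) : ZMod n) := by push_cast; rfl
      rw [e1, val_intCast hper, val_intCast hper, sdist, angle, hsucc, norm_coe_S2, norm_coe_S2,
        mul_one, div_one]
    exact (key i).trans (key j).symm
  · obtain ⟨i, rfl⟩ := ZMod.intCast_surjective z
    obtain ⟨j, rfl⟩ := ZMod.intCast_surjective w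
    have key : ∀ i : ℤ, sangle (u (((i : ZMod n) - 1).val)) (u ((i : ZMod n).val))
        (u (((i : ZMod n) + 1).val)) = sangle (u (0 - 1)) (u 0) (u (0 + 1)) := by
      intro i
      have e1 : ((i : ZMod n) + 1) = ((i + 1 : ℤ) : ZMod n) := by push_cast; rfl
      have e2 : ((i : ZMod n) - 1) = ((i - 1 : ℤ) : ZMod n) := by push_cast; rfl
      rw [e1, e2, val_intCast hper, val_intCast hper, val_intCast hper, sangle, sangle, angle,
        angle, inner_orthPart, inner_orthPart, norm_orthPart, norm_orthPart, norm_orthPart,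
        norm_orthPart, hsucc, hsucc, hpred, hpred, hin, hin]
      congr 6
      push_cast
      ring
    exact (key i).trans (key j).symm

lemma exists_isFrame : ∃ e f : E3, IsFrame e f :=
  ⟨EuclideanSpace.single 0 1, EuclideanSpace.single 1 1, by simp, by simp,
    by simp [inner_eq_coord]⟩

/-! ### Radii and area in terms of the thickness, and the limit. -/

/-- The difference of the circumradius and the inradius of a regular polygon of thickness `D`. -/
def radiiGap (D α : ℝ) : ℝ :=
  Real.arcsin (Real.sin D * ((1 - Real.cos (α / 2)) / (1 + Real.cos (α / 2))))

/-- The relation tan r = tan R cos (α/2) is equivalent to sin (R - r) = sin (R + r) tan² (α/4). -/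
lemma IsRadii.gap_eq {R r α : ℝ} (h : IsRadii R r α) (hα : 0 < α) (hα' : α < Real.pi) :
    R - r = radiiGap (R + r) α := by
  have hc : 0 < Real.cos (α / 2) := Real.cos_pos_of_mem_Ioo ⟨by linarith, by linarith⟩
  have e : Real.sin (R + r) * ((1 - Real.cos (α / 2)) / (1 + Real.cos (α / 2))) =
      Real.sin (R - r) := by
    rw [Real.sin_add, Real.sin_sub, ← h.eq]
    field_simp
  rw [radiiGap, e, Real.arcsin_sin (by linarith [h.circum_pos, h.in_lt])
    (by linarith [h.circum_lt, h.in_pos])]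

/-- Half the sum and half the difference of D and the gap are the radii. The gap is less than D ≤
π/2 because tan² (α/4) < 1, so both radii are admissible. -/
lemma exists_isRadii {D α : ℝ} (hD : 0 < D) (hD' : D ≤ Real.pi / 2) (hα : 0 < α)
    (hα' : α < Real.pi) : ∃ R r, IsRadii R r α ∧ R + r = D := by
  have hpi := Real.pi_pos
  have hc : 0 < Real.cos (α / 2) := Real.cos_pos_of_mem_Ioo ⟨by linarith, by linarith⟩
  have hc1 : Real.cos (α / 2) ≤ 1 := Real.cos_le_one _
  have hs : 0 < Real.sin D := Real.sin_pos_of_pos_of_lt_pi hD (by linarith)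
  set q := (1 - Real.cos (α / 2)) / (1 + Real.cos (α / 2)) with hq
  have hq0 : 0 ≤ q := div_nonneg (by linarith) (by linarith)
  have hq1 : q < 1 := by rw [hq, div_lt_one (by linarith)]; linarith
  have hlt : Real.sin D * q < Real.sin D := by
    have := mul_lt_mul_of_pos_left hq1 hs
    linarith
  have hx0 : 0 ≤ Real.sin D * q := mul_nonneg hs.le hq0
  have hδ0 : 0 ≤ radiiGap D α := Real.arcsin_nonneg.2 hx0
  have hδ1 : radiiGap D α < D := by
    rw [radiiGap, Real.arcsin_lt_iff_lt_sin ⟨by linarith, by linarith [Real.sin_le_one D]⟩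
      ⟨by linarith, hD'⟩]
    exact hlt
  have hsin : Real.sin (radiiGap D α) = Real.sin D * q :=
    Real.sin_arcsin (by linarith) (by linarith [Real.sin_le_one D])
  refine ⟨(D + radiiGap D α) / 2, (D - radiiGap D α) / 2,
    ⟨by linarith, by linarith, by linarith, by linarith, ?_⟩, by ring⟩
  set R := (D + radiiGap D α) / 2 with hR
  set r := (D - radiiGap D α) / 2 with hr
  have e1 : R + r = D := by rw [hR, hr]; ring
  have e2 : R - r = radiiGap D α := by rw [hR, hr]; ring
  have s1 := Real.sin_add R r
  have s2 := Real.sin_sub R r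
  rw [e1] at s1
  rw [e2, hsin] at s2
  have hqc : q * (1 + Real.cos (α / 2)) = 1 - Real.cos (α / 2) :=
    div_mul_cancel₀ _ (by linarith)
  linear_combination (-(1 / 2) * (Real.cos (α / 2) + 1)) * s2 +
    (1 / 2 * (1 - Real.cos (α / 2))) * s1 + Real.sin D / 2 * hqc

/-- The area of a regular polygon with an odd number of vertices in terms of its thickness. -/
lemma IsRegular.area_eq {c : ℕ} {W : Set S2} (h : IsRegular (2 * c + 1) W)
    (ht : thickness W ≤ Real.pi / 2) : area W = 2 * Real.pi - 2 * ((2 * c + 1 : ℕ) *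
      Real.arcsin (Real.cos ((thickness W -
        radiiGap (thickness W) (2 * Real.pi / (2 * c + 1 : ℕ))) / 2) *
        Real.sin (Real.pi / (2 * c + 1 : ℕ)))) := by
  obtain ⟨e, f, R, r, α, hf, hr, hα, hα0, hαπ, rfl⟩ := h.exists_reg
  have hD := hr.add_eq_thickness hf hα0 hαπ hα ht
  have hn : ((2 * c + 1 : ℕ) : ℝ) ≠ 0 := by positivity
  have e1 : 2 * Real.pi / (2 * c + 1 : ℕ) = α := by rw [← hα]; field_simp
  have e2 : Real.pi / (2 * c + 1 : ℕ) = α / 2 := by rw [← e1]; ring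
  rw [hr.area_reg hf (IsRadii.three_le hα0 hαπ hα) hα hα0 hαπ, ← hD, e1, e2,
    ← hr.gap_eq hα0 hαπ, show (R + r - (R - r)) / 2 = r by ring]

lemma tendsto_slope_zero {g : ℝ → ℝ} (hg : HasDerivAt g 1 0) (h0 : g 0 = 0) :
    Filter.Tendsto (fun x => g x / x) (nhdsWithin 0 {0}ᶜ) (nhds 1) := by
  have := hasDerivAt_iff_tendsto_slope.1 hg
  refine this.congr fun x => ?_
  rw [slope_def_field, h0, sub_zero, sub_zero]

/-- Here a stands for π / n, so that π / a is the number of vertices. As a tends to 0 the gap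
vanishes and the inradius tends to D / 2, while arcsin x / x and sin a / a tend to 1. -/
lemma tendsto_area_regular {D : ℝ} (hD : 0 < D) (hD' : D ≤ Real.pi / 2) :
    Filter.Tendsto (fun a : ℝ => Real.pi / a * Real.arcsin
      (Real.cos ((D - radiiGap D (2 * a)) / 2) * Real.sin a)) (nhdsWithin 0 (Set.Ioi 0))
      (nhds (Real.pi * Real.cos (D / 2))) := by
  have hpi := Real.pi_pos
  have hcont : ContinuousAt (fun a : ℝ => Real.cos ((D - radiiGap D (2 * a)) / 2)) 0 := by
    unfold radiiGap
    have : 1 + Real.cos (2 * 0 / 2) ≠ 0 := by simp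
    have h1 : ContinuousAt (fun a : ℝ =>
        Real.sin D * ((1 - Real.cos (2 * a / 2)) / (1 + Real.cos (2 * a / 2)))) 0 := by
      refine continuousAt_const.mul (ContinuousAt.div ?_ ?_ this) <;> fun_prop
    have h2 := (Real.continuous_arcsin.continuousAt (x := _)).comp h1
    exact Real.continuous_cos.continuousAt.comp ((continuousAt_const.sub h2).div_const 2)
  have hg := hcont.tendsto.mono_left (nhdsWithin_le_nhds (s := Set.Ioi 0))
  have hg0 : Real.cos ((D - radiiGap D (2 * 0)) / 2) = Real.cos (D / 2) := by simp [radiiGap]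
  rw [hg0] at hg
  have hcpos : 0 < Real.cos (D / 2) := Real.cos_pos_of_mem_Ioo ⟨by linarith, by linarith⟩
  have hsin := (tendsto_slope_zero (by simpa using Real.hasDerivAt_sin 0) Real.sin_zero).mono_left
    (nhdsWithin_mono 0 fun x (hx : 0 < x) => hx.ne')
  have hsin0 : Filter.Tendsto Real.sin (nhdsWithin 0 (Set.Ioi 0)) (nhds 0) := by
    have := Real.continuous_sin.tendsto 0
    rw [Real.sin_zero] at this
    exact this.mono_left nhdsWithin_le_nhds
  have hev : ∀ᶠ a : ℝ in nhdsWithin 0 (Set.Ioi 0), 0 < a ∧ a < Real.pi :=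
    Ioo_mem_nhdsGT hpi
  have hne : ∀ᶠ a : ℝ in nhdsWithin 0 (Set.Ioi 0),
      Real.cos ((D - radiiGap D (2 * a)) / 2) * Real.sin a ≠ 0 := by
    filter_upwards [hev, hg.eventually (lt_mem_nhds hcpos)] with a ha hga
    exact (mul_pos hga (Real.sin_pos_of_pos_of_lt_pi ha.1 ha.2)).ne'
  have hasin := (tendsto_slope_zero (by
    simpa using Real.hasDerivAt_arcsin (x := 0) (by norm_num) (by norm_num)) Real.arcsin_zero).comp
    (tendsto_nhdsWithin_of_tendsto_nhds_of_eventually_within _ (by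
      simpa using hg.mul hsin0) hne)
  have hlim := ((hasin.mul hg).mul hsin).const_mul Real.pi
  rw [one_mul, mul_one] at hlim
  refine hlim.congr' ?_
  filter_upwards [hev, hne] with a ha hna
  simp only [Function.comp]
  have h1 : a ≠ 0 := ha.1.ne'
  have h2 := left_ne_zero_of_mul hna
  have h3 := right_ne_zero_of_mul hna
  field_simp

/-! ### The three assertions of the theorem. -/

/-- The thickness of a reduced polygon is positive and at most a right angle. -/
lemma Cycle.thickness_mem {n : ℕ} {v : ℤ → E3} (h : Cycle n v) (hv : ∀ i, ‖v i‖ = 1)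
    (hred : IsReduced (body v)) : 0 < thickness (body v) ∧ thickness (body v) ≤ Real.pi / 2 := by
  obtain ⟨μ, hμ, h1, -, ht⟩ := h.exists_isMinCos hv
  have h0 := h.minCos_nonpos hv hred hμ
  rw [ht]
  constructor
  · have : Real.arccos μ < Real.pi := by
      apply lt_of_le_of_ne (Real.arccos_le_pi μ)
      intro e
      rw [Real.arccos_eq_pi] at e
      linarith
    linarith
  · have : Real.pi / 2 ≤ Real.arccos μ := by
      by_contra hc
      push Not at hc
      have := Real.arccos_lt_pi_div_two.1 hc
      linarith
    linarith

lemma thickness_mem_of_isReduced {V : Set S2} (hpoly : IsPolygon V) (hred : IsReduced V) :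
    0 < thickness V ∧ thickness V ≤ Real.pi / 2 := by
  obtain ⟨n, v, hc, hv, rfl⟩ := hpoly.exists_cycle
  exact hc.thickness_mem hv hred

lemma area_lt_of_isReduced {V : Set S2} (hpoly : IsPolygon V) (hred : IsReduced V) :
    area V < 2 * (1 - Real.cos (thickness V / 2)) * Real.pi := by
  obtain ⟨n, v, hc, hv, rfl⟩ := hpoly.exists_cycle
  have := hc.perimeter_lt hv hred
  rw [hc.area_body]
  linarith

lemma exists_isRegular_thickness_eq {D : ℝ} (hD : 0 < D) (hD' : D ≤ Real.pi / 2) {n : ℕ}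
    (hodd : Odd n) (hn : 3 ≤ n) : ∃ W : Set S2, IsRegular n W ∧ thickness W = D := by
  obtain ⟨c, rfl⟩ := hodd
  have hpi := Real.pi_pos
  have hn' : (0 : ℝ) < (2 * c + 1 : ℕ) := by positivity
  have hα : (2 * c + 1 : ℕ) * (2 * Real.pi / (2 * c + 1 : ℕ)) = 2 * Real.pi :=
    mul_div_cancel₀ _ hn'.ne'
  have hα0 : 0 < 2 * Real.pi / (2 * c + 1 : ℕ) := by positivity
  have hαπ : 2 * Real.pi / (2 * c + 1 : ℕ) < Real.pi := by
    rw [div_lt_iff₀ hn']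
    have : (3 : ℝ) ≤ (2 * c + 1 : ℕ) := by exact_mod_cast hn
    nlinarith
  obtain ⟨R, r, hr, hRr⟩ := exists_isRadii hD hD' hα0 hαπ
  obtain ⟨e, f, hf⟩ := exists_isFrame
  refine ⟨_, isRegular_body_reg hf hn hr.circum_pos hr.circum_lt hα, ?_⟩
  rw [hr.thickness_reg hf hα0 hαπ hα (by rw [hRr]; exact hD'), hRr]

lemma tendsto_area_of_isRegular {D : ℝ} (hD : 0 < D) (hD' : D ≤ Real.pi / 2) {W : ℕ → Set S2}
    (hW : ∀ k : ℕ, IsRegular (2 * k + 3) (W k) ∧ thickness (W k) = D) :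
    Filter.Tendsto (fun k => area (W k)) Filter.atTop
      (nhds (2 * (1 - Real.cos (D / 2)) * Real.pi)) := by
  have hseq : Filter.Tendsto (fun k : ℕ => Real.pi / (2 * (k + 1) + 1 : ℕ)) Filter.atTop
      (nhdsWithin 0 (Set.Ioi 0)) := by
    apply tendsto_nhdsWithin_of_tendsto_nhds_of_eventually_within
    · refine tendsto_const_nhds.div_atTop (tendsto_natCast_atTop_atTop.comp ?_)
      refine Filter.tendsto_atTop_mono (fun k => ?_) Filter.tendsto_id
      rw [id]
      omega
    · exact Filter.Eventually.of_forall fun k => div_pos Real.pi_pos (by positivity)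
  have hlim := (((tendsto_area_regular hD hD').comp hseq).const_mul 2).const_sub (2 * Real.pi)
  have e : 2 * (1 - Real.cos (D / 2)) * Real.pi =
      2 * Real.pi - 2 * (Real.pi * Real.cos (D / 2)) := by ring
  rw [e]
  refine hlim.congr fun k => ?_
  obtain ⟨hreg, ht⟩ := hW k
  -- The number 2k + 3 of vertices is 2c + 1 with c = k + 1.
  have hreg' : IsRegular (2 * (k + 1) + 1) (W k) := hreg
  rw [hreg'.area_eq (by rw [ht]; exact hD'), ht]
  simp only [Function.comp]
  rw [div_div_cancel₀ Real.pi_pos.ne', mul_div_assoc]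

end SphericalPolygon

end

theorem corollary4p5 (V : Set SphericalPolygon.S2)
    (hpoly : SphericalPolygon.IsPolygon V) (hred : SphericalPolygon.IsReduced V) :
    SphericalPolygon.area V
        < 2 * (1 - Real.cos (SphericalPolygon.thickness V / 2)) * Real.pi ∧
      (∀ n : ℕ, Odd n → 3 ≤ n → ∃ W : Set SphericalPolygon.S2,
        SphericalPolygon.IsRegular n W ∧
          SphericalPolygon.thickness W = SphericalPolygon.thickness V) ∧
      (∀ W : ℕ → Set SphericalPolygon.S2,
        (∀ k : ℕ, SphericalPolygon.IsRegular (2 * k + 3) (W k) ∧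
          SphericalPolygon.thickness (W k) = SphericalPolygon.thickness V) →
        Filter.Tendsto (fun k => SphericalPolygon.area (W k)) Filter.atTop
          (nhds (2 * (1 - Real.cos (SphericalPolygon.thickness V / 2)) * Real.pi))) := by
  obtain ⟨hD, hD'⟩ := SphericalPolygon.thickness_mem_of_isReduced hpoly hred
  exact ⟨SphericalPolygon.area_lt_of_isReduced hpoly hred,
    fun _ hodd hn => SphericalPolygon.exists_isRegular_thickness_eq hD hD' hodd hn,
    fun _ hW => SphericalPolygon.tendsto_area_of_isRegular hD hD' hW⟩
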